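/- Let $k$ be a field of any characteristic. Consider the following three cases, where $F/k$ is a separable quadratic field extension with non-trivial $k$-automorphism $\sigma$, and $\mathcal B$ is a quaternion algebra over $k$ (split or not) with canonical involution $*$: (a) $D=k$, $G_1=\mathrm{GL}_3(k)\times\mathrm{GL}_3(k)$, $Y=\mathrm M_3(k)$, with $(g_{11},g_{12})\cdot y=g_{11}\,y\,{}^tg_{12}$; (b) $D=F$, $G_1=\mathrm{GL}_3(F)$, $Y=\{y\in\mathrm M_3(F)\mid {}^ty=y^\sigma\}$, with $g\cdot y=g\,y\,{}^tg^\sigma$; (c) $D=\mathcal B$, $G_1=\mathrm{GL}_3(\mathcal B)$, $Y=\{y\in\mathrm M_3(\mathcal B)\mid {}^ty^*=y,\ y_{ii}\in k \text{ for all } i\}$, with $g\cdot y=g\,y\,{}^tg^*$ (the condition $y_{ii}\in k$ is automatic if $\operatorname{char}k\ne2$). Let $G(k)=G_1\times\mathrm{GL}_2(k)$ act on $V=Y\oplus Y$ by $(g_1,g_2)\cdot x=\bigl(g_1\cdot(ax_1+bx_2),\,g_1\cdot(cx_1+dx_2)\bigr)$ for $g_2=\begin{pmatrix}a&b\\c&d\end{pmatrix}$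 and $x=(x_1,x_2)$. For $x\in V$ let $F_x(v)\in k[v_1,v_2]$ be the binary cubic form $\det(x_1v_1+x_2v_2)$ in Cases (a), (b), and $\mathrm{Pfaff}(x_1v_1+x_2v_2)$ in Case (c), where $\mathrm{Pfaff}$ is the cubic form on $Y$ that is the square root of the reduced norm with $\mathrm{Pfaff}(1)=1$. Let $V^{\mathrm{ss}}(k)$ be the set of $x\in V$ such that the discriminant of $F_x$ is non-zero, and for such $x$ put $Z_x=\mathrm{Proj}\,k[v_1,v_2]/(F_x)$ and $L_x=\Gamma(Z_x,\mathcal O_{Z_x})$. Let $$V^{(1)}=\{x\in V^{\mathrm{ss}}(k)\mid L_x\cong k\times k\times k \text{ as } k\text{-algebras}\}.$$ Let $W\subset V$ be the subspace of the $(x_1,x_2)$ such that the first row and the first column of $x_1$ vanish, and $W^{(1)}=W\cap V^{(1)}$. Let $$U=\{(\mathrm{diag}(0,b,-c),\,\mathrm{diag}(a,-b,0))\mid a,b,c\in k\},\qquad U^{\mathrm{ss}}(k)=U\cap V^{\mathrm{ss}}(k).$$ Let $\mathrm P_{1,2}(D)\subset\mathrm{GL}_3(D)$ be the subgroup of the matrices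 with first row $(*,0,0)$, $\mathrm T_3(D)\subset\mathrm{GL}_3(D)$ the subgroup of diagonal matrices, $\mathrm B_2(k)\subset\mathrm{GL}_2(k)$ the subgroup of lower triangular matrices and $\mathrm Z_2(k)$ the center of $\mathrm{GL}_2(k)$. Put $P(k)=\mathrm P_{1,2}(k)\times\mathrm P_{1,2}(k)\times\mathrm B_2(k)$ and $H^\circ(k)=\mathrm T_3(k)\times\mathrm T_3(k)\times\mathrm Z_2(k)$ in Case (a), and $P(k)=\mathrm P_{1,2}(D)\times\mathrm B_2(k)$ and $H^\circ(k)=\mathrm T_3(D)\times\mathrm Z_2(k)$ in Cases (b), (c). With $$\theta_1=\begin{pmatrix}0&0&1\\1&0&0\\0&1&0\end{pmatrix},\quad \theta_2=\begin{pmatrix}0&1\\-1&-1\end{pmatrix},\quad \eta_1=\begin{pmatrix}1&0&0\\0&0&1\\0&1&0\end{pmatrix},\quad \eta_2=\begin{pmatrix}-1&0\\1&1\end{pmatrix},$$ let $\mathfrak S_3\subset G(k)$ be the subgroup generated by $(\theta_1,\theta_1,\theta_2)$ and $(\eta_1,\eta_1,\eta_2)$ in Case (a), and by $(\theta_1,\theta_2)$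 and $(\eta_1,\eta_2)$ in Cases (b), (c); it is isomorphic to the symmetric group of degree $3$ and normalizes $H^\circ(k)$. Let $H(k)=H^\circ(k)\rtimes\mathfrak S_3$, the subgroup of $G(k)$ generated by $H^\circ(k)$ and $\mathfrak S_3$. For subgroups $K\subset A$ of $G(k)$ and subsets $S,T\subset V$, write $T=A\times_KS$ if $K$ maps $S$ to itself and the map $(a,s)\mapsto as$ induces a bijection onto $T$ from the quotient of $A\times S$ by the action $h\cdot(a,s)=(ah^{-1},hs)$ of $K$. Then, in each of the three cases, $$V^{(1)}=G(k)\times_{H(k)}U^{\mathrm{ss}}(k),\qquad W^{(1)}=P(k)\times_{H(k)\cap P(k)}U^{\mathrm{ss}}(k).$$ -/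

import Mathlib

open MvPolynomial Matrix AlgebraicGeometry CategoryTheory
open scoped Quaternion

namespace CubicReducible

universe u v

/-! ### Binary cubic forms and the cubic algebra of a binary cubic form -/

section BinaryCubic

variable {k : Type u} [Field k]

/-- Binary cubic forms over `k` in the variables `v₁ = X 0`, `v₂ = X 1`. -/
abbrev BinaryCubic (k : Type u) [Field k] : Type u :=
  homogeneousSubmodule (Fin 2) k 3

/-- The coefficient of `v₁ ^ i * v₂ ^ j`. -/
noncomputable def binaryCoeff (i j : ℕ) (f : MvPolynomial (Fin 2) k) : k :=
  coeff (Finsupp.single 0 i + Finsupp.single 1 j) f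

/-- The discriminant `b²c² - 4ac³ - 4b³d - 27a²d² + 18abcd` of
`a v₁³ + b v₁² v₂ + c v₁ v₂² + d v₂³`. -/
noncomputable def disc (f : BinaryCubic k) : k :=
  Cubic.discr
    ⟨binaryCoeff 3 0 f.1, binaryCoeff 2 1 f.1, binaryCoeff 1 2 f.1, binaryCoeff 0 3 f.1⟩

/-- The homogeneous coordinate ring `k[v₁, v₂] / (f)`. -/
abbrev CoordRing (f : BinaryCubic k) : Type u :=
  MvPolynomial (Fin 2) k ⧸ Ideal.span {f.1}

/-- The homogeneous parts of `k[v₁, v₂] / (f)`: the images of the homogeneous polynomials. -/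
noncomputable def coordGrading (f : BinaryCubic k) (i : ℕ) : Submodule k (CoordRing f) :=
  (homogeneousSubmodule (Fin 2) k i).map (Ideal.Quotient.mkₐ k (Ideal.span {f.1})).toLinearMap

theorem mem_coordGrading (f : BinaryCubic k) (i : ℕ) (x : CoordRing f) :
    x ∈ coordGrading f i ↔
      ∃ p : MvPolynomial (Fin 2) k, p.IsHomogeneous i ∧ Ideal.Quotient.mk _ p = x :=
  Iff.rfl

theorem homogeneousComponent_mem_span (f : BinaryCubic k) {p : MvPolynomial (Fin 2) k}
    (hp : p ∈ Ideal.span {f.1}) (i : ℕ) : homogeneousComponent i p ∈ Ideal.span {f.1} := by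
  let _ : GradedAlgebra (homogeneousSubmodule (Fin 2) k) := MvPolynomial.gradedAlgebra
  have hI : (Ideal.span {f.1}).IsHomogeneous (homogeneousSubmodule (Fin 2) k) := by
    refine Ideal.homogeneous_span _ _ ?_
    intro x hx
    rw [Set.mem_singleton_iff] at hx
    exact ⟨3, hx ▸ f.2⟩
  exact (MvPolynomial.mem_iff_homogeneousComponent_mem hI p).1 hp i

instance coordGrading_gradedMonoid (f : BinaryCubic k) :
    SetLike.GradedMonoid (coordGrading f) where
  one_mem := (mem_coordGrading _ _ _).2 ⟨1, isHomogeneous_one _ _, map_one _⟩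
  mul_mem := by
    intro i j x y hx hy
    obtain ⟨p, hp, rfl⟩ := (mem_coordGrading _ _ _).1 hx
    obtain ⟨q, hq, rfl⟩ := (mem_coordGrading _ _ _).1 hy
    exact (mem_coordGrading _ _ _).2 ⟨p * q, hp.mul hq, map_mul _ _ _⟩

theorem coordGrading_isInternal (f : BinaryCubic k) :
    DirectSum.IsInternal (coordGrading f) := by
  classical
  constructor
  · rw [injective_iff_map_eq_zero]
    intro x hx
    choose p hp hpx using fun i => (mem_coordGrading f i (x i)).1 (x i).2
    have hsum : Ideal.Quotient.mk (Ideal.span {f.1}) (∑ i ∈ DFinsupp.support x, p i) = 0 := by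
      rw [map_sum, ← hx, DirectSum.coeAddMonoidHom_eq_dfinsuppSum, DFinsupp.sum]
      exact Finset.sum_congr rfl fun i _ => hpx i
    rw [Ideal.Quotient.eq_zero_iff_mem] at hsum
    refine DFinsupp.ext fun i => ?_
    by_cases hi : i ∈ DFinsupp.support x
    · have h1 := homogeneousComponent_mem_span f hsum i
      have h2 : homogeneousComponent i (∑ j ∈ DFinsupp.support x, p j) = p i := by
        rw [map_sum, Finset.sum_eq_single i]
        · rw [homogeneousComponent_of_mem (hp i), if_pos rfl]
        · intro j _ hj
          rw [homogeneousComponent_of_mem (hp j), if_neg hj.symm]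
        · intro h; exact absurd hi h
      rw [h2, ← Ideal.Quotient.eq_zero_iff_mem, hpx i] at h1
      exact Subtype.ext h1
    · simpa using hi
  · intro y
    obtain ⟨p, rfl⟩ := Ideal.Quotient.mk_surjective y
    refine ⟨∑ i ∈ Finset.range (p.totalDegree + 1),
      DirectSum.of (fun i => coordGrading f i) i ⟨Ideal.Quotient.mk _ (homogeneousComponent i p),
        (mem_coordGrading _ _ _).2 ⟨_, homogeneousComponent_isHomogeneous i p, rfl⟩⟩, ?_⟩
    rw [map_sum]
    simp only [DirectSum.coeAddMonoidHom_of]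
    rw [← map_sum, sum_homogeneousComponent]

noncomputable instance coordGrading_gradedAlgebra (f : BinaryCubic k) :
    GradedAlgebra (coordGrading f) :=
  { coordGrading_gradedMonoid f, (coordGrading_isInternal f).chooseDecomposition with }

/-- The scheme `Z = Proj k[v₁, v₂] / (f)` of zeros of `f` in the projective line. -/
noncomputable def zeroScheme (f : BinaryCubic k) : Scheme.{u} :=
  Proj (coordGrading f)

/-- The structure morphism `Z ⟶ Spec k`. -/
noncomputable def zeroSchemeToSpec (f : BinaryCubic k) : zeroScheme f ⟶ Spec (.of k) :=
  Proj.toSpecZero (coordGrading f) ≫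
    Spec.map (CommRingCat.ofHom (algebraMap k (coordGrading f 0)))

/-- The ring `L = Γ(Z, 𝒪_Z)` of global functions on `Z`. -/
def CubicAlgebra (f : BinaryCubic k) : Type u :=
  Γ(zeroScheme f, ⊤)

noncomputable instance (f : BinaryCubic k) : CommRing (CubicAlgebra f) :=
  inferInstanceAs (CommRing Γ(zeroScheme f, ⊤))

/-- `L = Γ(Z, 𝒪_Z)` is a `k`-algebra through `Z ⟶ Spec k`. -/
noncomputable instance (f : BinaryCubic k) : Algebra k (CubicAlgebra f) :=
  RingHom.toAlgebra ((Scheme.ΓSpecIso (.of k)).inv ≫ (zeroSchemeToSpec f).appTop).hom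

/-- The semistable points: the discriminant of the cubic form `F x` does not vanish. -/
def semistable {V : Type v} (F : V → BinaryCubic k) : Set V :=
  {x | disc (F x) ≠ 0}

/-- The semistable points `x` with `L_x ≅ k × k × k` as `k`-algebras. -/
def totallySplit {V : Type v} (F : V → BinaryCubic k) : Set V :=
  {x | x ∈ semistable F ∧ Nonempty (CubicAlgebra (F x) ≃ₐ[k] k × k × k)}

end BinaryCubic

/-! ### Contracted products -/

section ContractedProduct

variable {k : Type u} [Field k] {V : Type v} [AddCommGroup V] [Module k V]
  {G : Type*} [Group G]

/-- The relation on `A × S` given by the action `h · (a, s) = (a h⁻¹, h s)` of `K`. -/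
def contractedSetoid (ρ : Representation k G V) (A K : Subgroup G) (S : Set V) :
    Setoid (A × S) where
  r p q := ∃ h ∈ K, (q.1 : G) = p.1 * h⁻¹ ∧ (q.2 : V) = ρ h p.2
  iseqv :=
    { refl := fun p => ⟨1, K.one_mem, by simp, by simp⟩
      symm := by
        rintro p q ⟨h, hK, h1, h2⟩
        refine ⟨h⁻¹, K.inv_mem hK, by simp [h1], ?_⟩
        rw [h2, ← Module.End.mul_apply, ← map_mul, inv_mul_cancel, map_one, Module.End.one_apply]
      trans := by
        rintro p q r ⟨h, hK, h1, h2⟩ ⟨h', hK', h1', h2'⟩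
        refine ⟨h' * h, K.mul_mem hK' hK, by simp [h1, h1', mul_assoc], ?_⟩
        rw [h2', h2, map_mul, Module.End.mul_apply] }

/-- The contracted product `A ×_K S`. -/
def ContractedProduct (ρ : Representation k G V) (A K : Subgroup G) (S : Set V) :=
  Quotient (contractedSetoid ρ A K S)

/-- The map `A ×_K S → V`, `[a, s] ↦ a s`. -/
def ContractedProduct.toSpace (ρ : Representation k G V) (A K : Subgroup G) (S : Set V) :
    ContractedProduct ρ A K S → V :=
  Quotient.lift (fun p : A × S => ρ p.1 p.2) (by
    rintro p q ⟨h, -, h1, h2⟩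
    simp only [h1, h2]
    rw [← Module.End.mul_apply, ← map_mul, inv_mul_cancel_right])

/-- `T = A ×_K S`: the subgroup `K` of `A` preserves `S`, and `[a, s] ↦ a s` is a bijection of the
contracted product `A ×_K S` onto `T`. -/
def IsContractedProduct (ρ : Representation k G V) (A K : Subgroup G) (S T : Set V) : Prop :=
  K ≤ A ∧ (∀ h ∈ K, ∀ s ∈ S, ρ h s ∈ S) ∧
    Function.Injective (ContractedProduct.toSpace ρ A K S) ∧
    Set.range (ContractedProduct.toSpace ρ A K S) = T

end ContractedProduct

/-! ### Groups of matrices -/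

section Groups

/-- The units of a finite-dimensional algebra `M` that lie in a subalgebra `S`. -/
def unitsIn (K : Type*) {M : Type*} [Field K] [Ring M] [Algebra K M] [FiniteDimensional K M]
    (S : Subalgebra K M) : Subgroup Mˣ where
  carrier := {g | (g : M) ∈ S}
  one_mem' := S.one_mem
  mul_mem' := fun ha hb => S.mul_mem ha hb
  inv_mem' := by
    intro g hg
    let L : S →ₗ[K] S := LinearMap.mulLeft K (⟨g, hg⟩ : S)
    have hinj : Function.Injective L := by
      intro a b hab
      have h : (g : M) * a = g * b := congrArg Subtype.val hab
      exact Subtype.ext (by simpa using h)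
    obtain ⟨s, hs⟩ := LinearMap.injective_iff_surjective.1 hinj 1
    have h : (g : M) * s = 1 := congrArg Subtype.val hs
    have h' : ((g⁻¹ : Mˣ) : M) = s := by
      rw [Units.inv_eq_of_mul_eq_one_right h]
    change ((g⁻¹ : Mˣ) : M) ∈ S
    rw [h']
    exact s.2

/-- The `n × n` matrices over `D` whose `(i, j)` entry may be non-zero only if `r i j`. -/
def patternSubalgebra (K D : Type*) [Field K] [Ring D] [Algebra K D] {n : ℕ}
    (r : Fin n → Fin n → Prop) (hr : ∀ i, r i i) (ht : ∀ i j l, r i j → r j l → r i l) :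
    Subalgebra K (Matrix (Fin n) (Fin n) D) where
  carrier := {x | ∀ i j, ¬ r i j → x i j = 0}
  mul_mem' := by
    intro x y hx hy i l hil
    rw [Matrix.mul_apply]
    refine Finset.sum_eq_zero fun j _ => ?_
    by_cases hij : r i j
    · rw [hy j l fun hjl => hil (ht i j l hij hjl), mul_zero]
    · rw [hx i j hij, zero_mul]
  add_mem' := by
    intro x y hx hy i j hij
    rw [Matrix.add_apply, hx i j hij, hy i j hij, add_zero]
  algebraMap_mem' := by
    intro t i j hij
    have : i ≠ j := fun h => hij (h ▸ hr i)
    rw [Matrix.algebraMap_matrix_apply, if_neg this]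

/-- `P_{1,2}(D)`: the invertible matrices whose first row is `(*, 0, 0)`. -/
def P12 (K D : Type*) [Field K] [Ring D] [Algebra K D] [FiniteDimensional K D] :
    Subgroup (Matrix (Fin 3) (Fin 3) D)ˣ :=
  unitsIn K (patternSubalgebra K D (fun i j => i = 0 → j = 0) (fun _ h => h)
    (fun _ _ _ h h' hi => h' (h hi)))

/-- `T_3(D)`: the invertible diagonal matrices. -/
def T3 (K D : Type*) [Field K] [Ring D] [Algebra K D] [FiniteDimensional K D] :
    Subgroup (Matrix (Fin 3) (Fin 3) D)ˣ :=
  unitsIn K (patternSubalgebra K D (fun i j => i = j) (fun _ => rfl) (fun _ _ _ => Eq.trans))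

/-- `B_2(k)`: the invertible lower triangular `2 × 2` matrices. -/
def B2 (k : Type*) [Field k] : Subgroup (GL (Fin 2) k) :=
  unitsIn k (patternSubalgebra k k (fun i j => j ≤ i) (fun _ => le_rfl)
    (fun _ _ _ h h' => h'.trans h))

/-- The matrix `θ₁`. -/
def theta1 (D : Type*) [Ring D] : (Matrix (Fin 3) (Fin 3) D)ˣ where
  val := !![0, 0, 1; 1, 0, 0; 0, 1, 0]
  inv := !![0, 1, 0; 0, 0, 1; 1, 0, 0]
  val_inv := by ext i j; fin_cases i <;> fin_cases j <;> simp [Matrix.mul_apply, Fin.sum_univ_three]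
  inv_val := by ext i j; fin_cases i <;> fin_cases j <;> simp [Matrix.mul_apply, Fin.sum_univ_three]

/-- The matrix `η₁`. -/
def eta1 (D : Type*) [Ring D] : (Matrix (Fin 3) (Fin 3) D)ˣ where
  val := !![1, 0, 0; 0, 0, 1; 0, 1, 0]
  inv := !![1, 0, 0; 0, 0, 1; 0, 1, 0]
  val_inv := by ext i j; fin_cases i <;> fin_cases j <;> simp [Matrix.mul_apply, Fin.sum_univ_three]
  inv_val := by ext i j; fin_cases i <;> fin_cases j <;> simp [Matrix.mul_apply, Fin.sum_univ_three]

/-- The matrix `θ₂`. -/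
def theta2 (k : Type*) [Field k] : GL (Fin 2) k where
  val := !![0, 1; -1, -1]
  inv := !![-1, -1; 1, 0]
  val_inv := by ext i j; fin_cases i <;> fin_cases j <;> simp [Matrix.mul_apply, Fin.sum_univ_two]
  inv_val := by ext i j; fin_cases i <;> fin_cases j <;> simp [Matrix.mul_apply, Fin.sum_univ_two]

/-- The matrix `η₂`. -/
def eta2 (k : Type*) [Field k] : GL (Fin 2) k where
  val := !![-1, 0; 1, 1]
  inv := !![-1, 0; 1, 1]
  val_inv := by ext i j; fin_cases i <;> fin_cases j <;> simp [Matrix.mul_apply, Fin.sum_univ_two]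
  inv_val := by ext i j; fin_cases i <;> fin_cases j <;> simp [Matrix.mul_apply, Fin.sum_univ_two]

end Groups

/-! ### The space `V = Y ⊕ Y` and its subspaces -/

section Pairs

variable {k : Type u} [Field k]

/-- For a representation of `G₁` on `Y`, the action of `G₁ × GL₂` on `Y ⊕ Y` given by
`(g₁, (a, b; c, d)) · (x₁, x₂) = (g₁ (a x₁ + b x₂), g₁ (c x₁ + d x₂))`, that is, by
`(g · x)(v) = g₁ x(v g₂)` for `x(v) = x₁ v₁ + x₂ v₂` and the row vector `v = (v₁, v₂)`. -/
def pairRep {G₁ : Type*} [Group G₁] {Y : Type*} [AddCommGroup Y] [Module k Y]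
    (ρ : Representation k G₁ Y) : Representation k (G₁ × GL (Fin 2) k) (Y × Y) where
  toFun g :=
    { toFun := fun x =>
        (ρ g.1 (g.2 0 0 • x.1 + g.2 0 1 • x.2), ρ g.1 (g.2 1 0 • x.1 + g.2 1 1 • x.2))
      map_add' := by
        intro x y
        ext <;> simp only [Prod.fst_add, Prod.snd_add, smul_add, map_add] <;> abel
      map_smul' := by
        intro t x
        ext <;> simp [smul_comm t] }
  map_one' := by
    ext x <;> simp
  map_mul' g h := by
    refine LinearMap.ext fun x => ?_
    ext <;>
    · simp [Matrix.mul_apply, Fin.sum_univ_two, add_smul, mul_smul]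
      try abel

variable {D : Type*} [Ring D] [Algebra k D]

/-- The subspace `W = Z ⊕ Y` of `Y ⊕ Y`, where `Z` consists of the matrices in `Y` whose first row
and first column vanish. -/
def subspaceW (Y : Submodule k (Matrix (Fin 3) (Fin 3) D)) : Submodule k (Y × Y) where
  carrier := {x | ∀ i, x.1.1 0 i = 0 ∧ x.1.1 i 0 = 0}
  zero_mem' := fun i => ⟨rfl, rfl⟩
  add_mem' := by
    intro x y hx hy i
    simp [(hx i).1, (hx i).2, (hy i).1, (hy i).2]
  smul_mem' := by
    intro t x hx i
    simp [(hx i).1, (hx i).2]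

/-- The subspace `U` of `Y ⊕ Y` of the pairs `(diag(0, b, -c), diag(a, -b, 0))`, `a, b, c ∈ k`. -/
def subspaceU (Y : Submodule k (Matrix (Fin 3) (Fin 3) D)) : Submodule k (Y × Y) where
  carrier := {x | ∃ a b c : k,
    x.1.1 = Matrix.diagonal ![0, algebraMap k D b, -algebraMap k D c] ∧
    x.2.1 = Matrix.diagonal ![algebraMap k D a, -algebraMap k D b, 0]}
  zero_mem' := by
    refine ⟨0, 0, 0, ?_, ?_⟩ <;>
      ext i j <;> fin_cases i <;> fin_cases j <;> simp
  add_mem' := by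
    rintro x y ⟨a, b, c, h1, h2⟩ ⟨a', b', c', h1', h2'⟩
    refine ⟨a + a', b + b', c + c', ?_, ?_⟩
    · simp only [Prod.fst_add, Submodule.coe_add, h1, h1']
      ext i j; fin_cases i <;> fin_cases j <;> simp [add_comm]
    · simp only [Prod.snd_add, Submodule.coe_add, h2, h2']
      ext i j; fin_cases i <;> fin_cases j <;> simp [add_comm]
  smul_mem' := by
    rintro t x ⟨a, b, c, h1, h2⟩
    refine ⟨t * a, t * b, t * c, ?_, ?_⟩
    · simp only [Prod.smul_fst, Submodule.coe_smul, h1]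
      ext i j; fin_cases i <;> fin_cases j <;> simp [Algebra.smul_def]
    · simp only [Prod.smul_snd, Submodule.coe_smul, h2]
      ext i j; fin_cases i <;> fin_cases j <;> simp [Algebra.smul_def]

/-- The matrix `x₁ v₁ + x₂ v₂` of linear forms, for matrices `x₁`, `x₂` over a commutative ring. -/
noncomputable def linearMatrix {R : Type*} [CommRing R] (x₁ x₂ : Matrix (Fin 3) (Fin 3) R) :
    Matrix (Fin 3) (Fin 3) (MvPolynomial (Fin 2) R) :=
  Matrix.of fun i j => C (x₁ i j) * X 0 + C (x₂ i j) * X 1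

theorem isHomogeneous_linear {R : Type*} [CommRing R] (a b : R) :
    (C a * X 0 + C b * X 1 : MvPolynomial (Fin 2) R).IsHomogeneous 1 :=
  (isHomogeneous_C_mul_X a 0).add (isHomogeneous_C_mul_X b 1)

theorem isHomogeneous_det_linearMatrix {R : Type*} [CommRing R]
    (x₁ x₂ : Matrix (Fin 3) (Fin 3) R) : (linearMatrix x₁ x₂).det.IsHomogeneous 3 := by
  rw [Matrix.det_apply]
  refine IsHomogeneous.sum _ _ _ fun σ _ => ?_
  have h : (∏ i, linearMatrix x₁ x₂ (σ i) i).IsHomogeneous (∑ _i : Fin 3, 1) :=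
    IsHomogeneous.prod _ _ _ fun i _ => isHomogeneous_linear _ _
  rcases Int.units_eq_one_or (Equiv.Perm.sign σ) with hs | hs
  · simpa [hs] using h
  · simpa [hs, Units.smul_def] using h.neg

end Pairs

/-! ### Case (a): `GL₃(k) × GL₃(k) × GL₂(k)` acting on `M₃(k) ⊕ M₃(k)` -/

section CaseA

variable (k : Type u) [Field k]

/-- `G = G₁ × GL₂(k)` with `G₁ = GL₃(k) × GL₃(k)`. -/
abbrev GroupA : Type u := (GL (Fin 3) k × GL (Fin 3) k) × GL (Fin 2) k

/-- `Y = M₃(k)`. -/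
abbrev SpaceA : Submodule k (Matrix (Fin 3) (Fin 3) k) := ⊤

/-- `(g₁₁, g₁₂) · y = g₁₁ y ᵗg₁₂`. -/
def repA₁ : Representation k (GL (Fin 3) k × GL (Fin 3) k) (SpaceA k) where
  toFun g :=
    { toFun := fun y => ⟨g.1.1 * y.1 * g.2.1ᵀ, Submodule.mem_top⟩
      map_add' := fun x y => Subtype.ext (by simp [mul_add, add_mul])
      map_smul' := fun t x => Subtype.ext (by simp) }
  map_one' := by
    refine LinearMap.ext fun y => Subtype.ext ?_
    simp
  map_mul' g h := by
    refine LinearMap.ext fun y => Subtype.ext ?_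
    simp [mul_assoc]

/-- The representation of `G` on `V = Y ⊕ Y`. -/
def repA : Representation k (GroupA k) (SpaceA k × SpaceA k) := pairRep (repA₁ k)

/-- `F_x(v) = det (x₁ v₁ + x₂ v₂)`. -/
noncomputable def formA (x : SpaceA k × SpaceA k) : BinaryCubic k :=
  ⟨(linearMatrix x.1.1 x.2.1).det, isHomogeneous_det_linearMatrix _ _⟩

/-- `P = P_{1,2}(k) × P_{1,2}(k) × B₂(k)`. -/
def parabolicA : Subgroup (GroupA k) := ((P12 k k).prod (P12 k k)).prod (B2 k)

/-- `H = H° 𝔖₃`, where `H° = T₃(k) × T₃(k) × Z₂(k)` and `𝔖₃` is generated by `θ` and `η`. -/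
def stabA : Subgroup (GroupA k) :=
  ((T3 k k).prod (T3 k k)).prod (Subgroup.center (GL (Fin 2) k)) ⊔
    Subgroup.closure {((theta1 k, theta1 k), theta2 k), ((eta1 k, eta1 k), eta2 k)}

end CaseA

/-! ### Case (b): `GL₃(F) × GL₂(k)` acting on pairs of Hermitian matrices over `F / k` -/

section CaseB

variable {k : Type u} [Field k] {F : Type v} [Field F] [Algebra k F]

/-- `H₃(F) = {y ∈ M₃(F) | ᵗy = y^σ}`. -/
def SpaceB (σ : F ≃ₐ[k] F) : Submodule k (Matrix (Fin 3) (Fin 3) F) where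
  carrier := {y | yᵀ = y.map σ}
  zero_mem' := by ext i j; simp
  add_mem' := by
    intro x y hx hy
    change (x + y)ᵀ = (x + y).map σ
    rw [Matrix.transpose_add, hx, hy]
    ext i j; simp
  smul_mem' := by
    intro t x hx
    change (t • x)ᵀ = (t • x).map σ
    rw [Matrix.transpose_smul, hx]
    ext i j; simp

variable [Algebra.IsQuadraticExtension k F]

theorem involutive_of_quadratic (σ : F ≃ₐ[k] F) (z : F) : σ (σ z) = z := by
  have hc : Nat.card (F ≃ₐ[k] F) ≤ 2 := by
    have := AlgEquiv.card_le (F := k) (K := F)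
    rw [Algebra.IsQuadraticExtension.finrank_eq_two k F] at this
    simpa [Nat.card_eq_fintype_card] using this
  have h : σ * σ = 1 := by
    have h1 : σ ^ Nat.card (F ≃ₐ[k] F) = 1 := pow_card_eq_one'
    have h0 : 0 < Nat.card (F ≃ₐ[k] F) := Nat.card_pos
    interval_cases hn : Nat.card (F ≃ₐ[k] F)
    · rw [pow_one] at h1; simp [h1]
    · rwa [pow_two] at h1
  exact DFunLike.congr_fun h z

theorem exists_algebraMap_eq (σ : F ≃ₐ[k] F) (hσ : σ ≠ 1) (z : F) (hz : σ z = z) :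
    ∃ t : k, algebraMap k F t = z := by
  by_contra hcon
  push Not at hcon
  have hli : LinearIndependent k ![(1 : F), z] := by
    rw [LinearIndependent.pair_iff]
    intro s t hst
    by_cases ht : t = 0
    · subst ht
      refine ⟨?_, rfl⟩
      simpa using hst
    · exfalso
      refine hcon (-(t⁻¹ * s)) ?_
      have h2 : algebraMap k F t ≠ 0 := by simpa using ht
      rw [Algebra.smul_def, Algebra.smul_def, mul_one] at hst
      rw [map_neg, map_mul, map_inv₀]
      field_simp
      linear_combination -hst
  have hspan : Submodule.span k (Set.range ![(1 : F), z]) = ⊤ :=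
    hli.span_eq_top_of_card_eq_finrank'
      (by rw [Algebra.IsQuadraticExtension.finrank_eq_two k F]; rfl)
  apply hσ
  have : σ.toLinearMap = LinearMap.id := by
    refine LinearMap.ext_on_range hspan fun i => ?_
    fin_cases i
    · simp
    · simpa using hz
  exact AlgEquiv.ext fun y => LinearMap.congr_fun this y

/-- `g · y = g y ᵗg^σ`. -/
def repB₁ (σ : F ≃ₐ[k] F) : Representation k (GL (Fin 3) F) (SpaceB σ) where
  toFun g :=
    { toFun := fun y => ⟨g.1 * y.1 * (g.1.map σ)ᵀ, by
        have hy : y.1ᵀ = y.1.map σ := y.2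
        have hσσ : (g.1.map σ).map σ = g.1 := by
          ext i j; simp [involutive_of_quadratic]
        change _ = _
        rw [Matrix.transpose_mul, Matrix.transpose_mul, hy, Matrix.transpose_transpose,
          Matrix.map_mul, Matrix.map_mul, Matrix.transpose_map, hσσ, mul_assoc]⟩
      map_add' := fun x y => Subtype.ext (by simp [mul_add, add_mul])
      map_smul' := fun t x => Subtype.ext (by simp) }
  map_one' := by
    refine LinearMap.ext fun y => Subtype.ext ?_
    simp
  map_mul' g h := by
    refine LinearMap.ext fun y => Subtype.ext ?_
    simp [mul_assoc, Matrix.map_mul]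

variable (k F) in
/-- `G = GL₃(F) × GL₂(k)`. -/
abbrev GroupB : Type (max u v) := GL (Fin 3) F × GL (Fin 2) k

/-- The representation of `G` on `V = Y ⊕ Y`. -/
def repB (σ : F ≃ₐ[k] F) : Representation k (GroupB k F) (SpaceB σ × SpaceB σ) :=
  pairRep (repB₁ σ)

/-- The determinant of `x₁ v₁ + x₂ v₂` is a binary cubic form with coefficients in `k`. -/
theorem exists_formB (σ : F ≃ₐ[k] F) (hσ : σ ≠ 1) (x : SpaceB σ × SpaceB σ) :
    ∃ f : BinaryCubic k, map (algebraMap k F) f.1 = (linearMatrix x.1.1 x.2.1).det := by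
  have hx1 : x.1.1ᵀ = x.1.1.map σ := x.1.2
  have hx2 : x.2.1ᵀ = x.2.1.map σ := x.2.2
  have hfix : map (σ : F →+* F) (linearMatrix x.1.1 x.2.1).det
      = (linearMatrix x.1.1 x.2.1).det := by
    rw [RingHom.map_det, ← Matrix.det_transpose (linearMatrix x.1.1 x.2.1)]
    congr 1
    ext1 i j
    have h1 : x.1.1 j i = σ (x.1.1 i j) := congrFun (congrFun hx1 i) j
    have h2 : x.2.1 j i = σ (x.2.1 i j) := congrFun (congrFun hx2 i) j
    simp [linearMatrix, h1, h2]
  have hmem : (linearMatrix x.1.1 x.2.1).det ∈ Set.range (map (σ := Fin 2) (algebraMap k F)) := by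
    rw [mem_range_map_iff_coeffs_subset]
    intro c hc
    obtain ⟨m, -, rfl⟩ := mem_coeffs_iff.1 hc
    obtain ⟨t, ht⟩ := exists_algebraMap_eq σ hσ (coeff m (linearMatrix x.1.1 x.2.1).det) (by
      conv_rhs => rw [← hfix]
      rw [coeff_map]; rfl)
    exact ⟨t, ht⟩
  obtain ⟨f, hf⟩ := hmem
  refine ⟨⟨f, ?_⟩, hf⟩
  have h := isHomogeneous_det_linearMatrix x.1.1 x.2.1
  rw [← hf] at h
  exact h.of_map (algebraMap k F).injective

/-- `F_x(v) = det (x₁ v₁ + x₂ v₂)`, as a form over `k`. -/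
noncomputable def formB (σ : F ≃ₐ[k] F) (hσ : σ ≠ 1) (x : SpaceB σ × SpaceB σ) : BinaryCubic k :=
  (exists_formB σ hσ x).choose

theorem map_formB (σ : F ≃ₐ[k] F) (hσ : σ ≠ 1) (x : SpaceB σ × SpaceB σ) :
    map (algebraMap k F) (formB σ hσ x).1 = (linearMatrix x.1.1 x.2.1).det :=
  (exists_formB σ hσ x).choose_spec

variable (k F)

/-- `P = P_{1,2}(F) × B₂(k)`. -/
def parabolicB : Subgroup (GroupB k F) := (P12 F F).prod (B2 k)

/-- `H = H° 𝔖₃`, where `H° = T₃(F) × Z₂(k)` and `𝔖₃` is generated by `θ` and `η`. -/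
def stabB : Subgroup (GroupB k F) :=
  (T3 F F).prod (Subgroup.center (GL (Fin 2) k)) ⊔
    Subgroup.closure {(theta1 F, theta2 k), (eta1 F, eta2 k)}

end CaseB

/-! ### Case (c): `GL₃(B) × GL₂(k)` acting on pairs of Hermitian matrices over a quaternion
algebra `B = ℍ[k, c₁, c₂, c₃]` -/

section CaseC

/-- The reduced trace `b + b*`. -/
def trd {R : Type*} [CommRing R] {c₁ c₂ c₃ : R} (b : ℍ[R,c₁,c₂,c₃]) : R := (b + star b).re

/-- The reduced norm `b b*`. -/
def nrd {R : Type*} [CommRing R] {c₁ c₂ c₃ : R} (b : ℍ[R,c₁,c₂,c₃]) : R := (b * star b).re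

/-- The Pfaffian of the Hermitian matrix `(α, p, q; p*, β, r; q*, r*, γ)` with scalars
`α`, `β`, `γ`: the cubic form `α β γ + Trd(p r q*) - α Nrd(r) - β Nrd(q) - γ Nrd(p)`, which is the
square root of the reduced norm with value `1` at the identity matrix. -/
def pfaff {R : Type*} [CommRing R] {c₁ c₂ c₃ : R}
    (y : Matrix (Fin 3) (Fin 3) ℍ[R,c₁,c₂,c₃]) : R :=
  (y 0 0).re * (y 1 1).re * (y 2 2).re + trd (y 0 1 * y 1 2 * y 2 0)
    - (y 0 0).re * nrd (y 1 2) - (y 1 1).re * nrd (y 0 2) - (y 2 2).re * nrd (y 0 1)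

theorem pfaff_one {R : Type*} [CommRing R] {c₁ c₂ c₃ : R} :
    pfaff (1 : Matrix (Fin 3) (Fin 3) ℍ[R,c₁,c₂,c₃]) = 1 := by
  simp [pfaff, nrd, trd]

variable {k : Type u} [Field k] (c₁ c₂ c₃ : k)

/-- `H₃(B)`: the matrices `y` over `B` with `y = ᵗy*` and with diagonal entries in `k`. The second
condition follows from the first one if the characteristic is not `2`. -/
def SpaceC : Submodule k (Matrix (Fin 3) (Fin 3) ℍ[k,c₁,c₂,c₃]) where
  carrier := {y | yᴴ = y ∧ ∀ i, ∃ t : k, y i i = algebraMap k ℍ[k,c₁,c₂,c₃] t}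
  zero_mem' := ⟨Matrix.conjTranspose_zero, fun i => ⟨0, by simp⟩⟩
  add_mem' := by
    rintro x y ⟨hx, hx'⟩ ⟨hy, hy'⟩
    refine ⟨by rw [Matrix.conjTranspose_add, hx, hy], fun i => ?_⟩
    obtain ⟨s, hs⟩ := hx' i
    obtain ⟨t, ht⟩ := hy' i
    exact ⟨s + t, by rw [Matrix.add_apply, hs, ht, map_add]⟩
  smul_mem' := by
    rintro t x ⟨hx, hx'⟩
    refine ⟨?_, fun i => ?_⟩
    · ext1 i j
      rw [Matrix.conjTranspose_apply, Matrix.smul_apply, Matrix.smul_apply,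
        QuaternionAlgebra.star_smul, ← Matrix.conjTranspose_apply, hx]
    · obtain ⟨s, hs⟩ := hx' i
      exact ⟨t * s, by rw [Matrix.smul_apply, hs, Algebra.smul_def, map_mul]⟩

theorem mem_SpaceC_iff_of_two_ne_zero (h2 : (2 : k) ≠ 0)
    (y : Matrix (Fin 3) (Fin 3) ℍ[k,c₁,c₂,c₃]) : y ∈ SpaceC c₁ c₂ c₃ ↔ yᴴ = y := by
  refine ⟨fun h => h.1, fun h => ⟨h, fun i => ⟨(y i i).re, ?_⟩⟩⟩
  have hs : star (y i i) = y i i := congrFun (congrFun h i) i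
  have hzero : ∀ t : k, -t = t → t = 0 := by
    intro t ht
    have : 2 * t = 0 := by linear_combination -ht
    exact (mul_eq_zero.1 this).resolve_left h2
  have hI := hzero _ (congrArg QuaternionAlgebra.imI hs)
  have hJ := hzero _ (congrArg QuaternionAlgebra.imJ hs)
  have hK := hzero _ (congrArg QuaternionAlgebra.imK hs)
  ext <;> simp [hI, hJ, hK]

theorem sandwich_mem_SpaceC (g y : Matrix (Fin 3) (Fin 3) ℍ[k,c₁,c₂,c₃])
    (hy : y ∈ SpaceC c₁ c₂ c₃) : g * y * gᴴ ∈ SpaceC c₁ c₂ c₃ := by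
  obtain ⟨hH, hd⟩ := hy
  refine ⟨?_, fun i => ?_⟩
  · rw [Matrix.conjTranspose_mul, Matrix.conjTranspose_mul, Matrix.conjTranspose_conjTranspose, hH,
      mul_assoc]
  · have key : ∀ a b : ℍ[k,c₁,c₂,c₃],
        (∃ s : k, a = algebraMap k _ s) → (∃ t : k, b = algebraMap k _ t) →
          ∃ r : k, a + b = algebraMap k _ r := by
      rintro _ _ ⟨s, rfl⟩ ⟨t, rfl⟩; exact ⟨s + t, (map_add _ _ _).symm⟩
    have hdiag : ∀ j, ∃ s : k, g i j * y j j * star (g i j) = algebraMap k _ s := by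
      intro j
      obtain ⟨t, ht⟩ := hd j
      refine ⟨t * (g i j * star (g i j)).re, ?_⟩
      rw [ht, ← Algebra.commutes, mul_assoc, map_mul]
      exact congrArg _ (QuaternionAlgebra.mul_star_eq_coe _)
    have hoff : ∀ j l, ∃ s : k,
        g i j * y j l * star (g i l) + g i l * y l j * star (g i j) = algebraMap k _ s := by
      intro j l
      have h1 : g i l * y l j * star (g i j) = star (g i j * y j l * star (g i l)) := by
        have : y l j = star (y j l) := (congrFun (congrFun hH l) j).symm
        rw [this]; simp [mul_assoc]
      rw [h1]
      exact ⟨_, QuaternionAlgebra.self_add_star' _⟩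
    have hexp : (g * y * gᴴ) i i =
        (g i 0 * y 0 0 * star (g i 0) + g i 1 * y 1 1 * star (g i 1))
          + g i 2 * y 2 2 * star (g i 2)
          + (g i 0 * y 0 1 * star (g i 1) + g i 1 * y 1 0 * star (g i 0))
          + (g i 0 * y 0 2 * star (g i 2) + g i 2 * y 2 0 * star (g i 0))
          + (g i 1 * y 1 2 * star (g i 2) + g i 2 * y 2 1 * star (g i 1)) := by
      simp only [Matrix.mul_apply, Fin.sum_univ_three, Matrix.conjTranspose_apply, add_mul]
      abel
    rw [hexp]
    exact key _ _ (key _ _ (key _ _ (key _ _ (key _ _ (hdiag 0) (hdiag 1)) (hdiag 2)) (hoff 0 1))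
      (hoff 0 2)) (hoff 1 2)

/-- `g · y = g y ᵗg*`. -/
def repC₁ : Representation k (Matrix (Fin 3) (Fin 3) ℍ[k,c₁,c₂,c₃])ˣ (SpaceC c₁ c₂ c₃) where
  toFun g :=
    { toFun := fun y => ⟨g.1 * y.1 * g.1ᴴ, sandwich_mem_SpaceC c₁ c₂ c₃ _ _ y.2⟩
      map_add' := fun x y => Subtype.ext (by simp [mul_add, add_mul])
      map_smul' := fun t x => Subtype.ext (by simp) }
  map_one' := by
    refine LinearMap.ext fun y => Subtype.ext ?_
    simp
  map_mul' g h := by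
    refine LinearMap.ext fun y => Subtype.ext ?_
    simp [mul_assoc]

/-- `G = GL₃(B) × GL₂(k)`. -/
abbrev GroupC : Type u := (Matrix (Fin 3) (Fin 3) ℍ[k,c₁,c₂,c₃])ˣ × GL (Fin 2) k

/-- The representation of `G` on `V = Y ⊕ Y`. -/
def repC : Representation k (GroupC c₁ c₂ c₃) (SpaceC c₁ c₂ c₃ × SpaceC c₁ c₂ c₃) :=
  pairRep (repC₁ c₁ c₂ c₃)

/-- The matrix `x₁ v₁ + x₂ v₂` over the quaternion algebra `B ⊗ k[v₁, v₂]`. -/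
noncomputable def linearMatrixC (x₁ x₂ : Matrix (Fin 3) (Fin 3) ℍ[k,c₁,c₂,c₃]) :
    Matrix (Fin 3) (Fin 3)
      ℍ[MvPolynomial (Fin 2) k,(C c₁ : MvPolynomial (Fin 2) k),C c₂,C c₃] :=
  Matrix.of fun i j =>
    { re := C (x₁ i j).re * X 0 + C (x₂ i j).re * X 1
      imI := C (x₁ i j).imI * X 0 + C (x₂ i j).imI * X 1
      imJ := C (x₁ i j).imJ * X 0 + C (x₂ i j).imJ * X 1
      imK := C (x₁ i j).imK * X 0 + C (x₂ i j).imK * X 1 }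

/-- All coordinates of a quaternion over `k[v₁, v₂]` are homogeneous of degree `n`. -/
def QuatHomogeneous {c₁ c₂ c₃ : k}
    (q : ℍ[MvPolynomial (Fin 2) k,(C c₁ : MvPolynomial (Fin 2) k),C c₂,C c₃]) (n : ℕ) : Prop :=
  q.re.IsHomogeneous n ∧ q.imI.IsHomogeneous n ∧ q.imJ.IsHomogeneous n ∧ q.imK.IsHomogeneous n

theorem QuatHomogeneous.mul {c₁ c₂ c₃ : k}
    {p q : ℍ[MvPolynomial (Fin 2) k,(C c₁ : MvPolynomial (Fin 2) k),C c₂,C c₃]} {m n : ℕ}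
    (hp : QuatHomogeneous p m) (hq : QuatHomogeneous q n) : QuatHomogeneous (p * q) (m + n) := by
  obtain ⟨p0, p1, p2, p3⟩ := hp
  obtain ⟨q0, q1, q2, q3⟩ := hq
  have hC : ∀ (t : k) {f g : MvPolynomial (Fin 2) k}, f.IsHomogeneous m → g.IsHomogeneous n →
      (C t * f * g).IsHomogeneous (m + n) := by
    intro t f g hf hg
    simpa [mul_assoc] using (isHomogeneous_C (Fin 2) t).mul (hf.mul hg)
  have hCC : ∀ (s t : k) {f g : MvPolynomial (Fin 2) k}, f.IsHomogeneous m → g.IsHomogeneous n →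
      (C s * C t * f * g).IsHomogeneous (m + n) := by
    intro s t f g hf hg
    rw [← C_mul]
    exact hC _ hf hg
  refine ⟨?_, ?_, ?_, ?_⟩
  · rw [QuaternionAlgebra.re_mul]
    exact ((((p0.mul q0).add (hC _ p1 q1)).add (hC _ p2 q2)).add (hCC _ _ p2 q3)).sub (hCC _ _ p3 q3)
  · rw [QuaternionAlgebra.imI_mul]
    exact ((((p0.mul q1).add (p1.mul q0)).add (hC _ p1 q1)).sub (hC _ p2 q3)).add (hC _ p3 q2)
  · rw [QuaternionAlgebra.imJ_mul]
    exact ((((p0.mul q2).add (hC _ p1 q3)).add (p2.mul q0)).add (hC _ p2 q1)).sub (hC _ p3 q1)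
  · rw [QuaternionAlgebra.imK_mul]
    exact ((((p0.mul q3).add (p1.mul q2)).add (hC _ p1 q3)).sub (p2.mul q1)).add (p3.mul q0)

theorem QuatHomogeneous.star {c₁ c₂ c₃ : k}
    {p : ℍ[MvPolynomial (Fin 2) k,(C c₁ : MvPolynomial (Fin 2) k),C c₂,C c₃]} {n : ℕ}
    (hp : QuatHomogeneous p n) : QuatHomogeneous (Star.star p) n := by
  obtain ⟨p0, p1, p2, p3⟩ := hp
  refine ⟨?_, p1.neg, p2.neg, p3.neg⟩
  rw [QuaternionAlgebra.re_star]
  have h := (isHomogeneous_C (Fin 2) c₂).mul p1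
  rw [zero_add] at h
  exact p0.add h

theorem isHomogeneous_pfaff_linearMatrixC (x₁ x₂ : Matrix (Fin 3) (Fin 3) ℍ[k,c₁,c₂,c₃]) :
    (pfaff (linearMatrixC c₁ c₂ c₃ x₁ x₂)).IsHomogeneous 3 := by
  have hq : ∀ i j, QuatHomogeneous (linearMatrixC c₁ c₂ c₃ x₁ x₂ i j) 1 := fun i j =>
    ⟨isHomogeneous_linear _ _, isHomogeneous_linear _ _, isHomogeneous_linear _ _,
      isHomogeneous_linear _ _⟩
  have hn : ∀ i j, (nrd (linearMatrixC c₁ c₂ c₃ x₁ x₂ i j)).IsHomogeneous 2 := fun i j =>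
    ((hq i j).mul (hq i j).star).1
  have ht := ((hq 0 1).mul (hq 1 2)).mul (hq 2 0)
  exact (((((((hq 0 0).1.mul (hq 1 1).1).mul (hq 2 2).1).add (ht.1.add ht.star.1)).sub
    ((hq 0 0).1.mul (hn 1 2))).sub ((hq 1 1).1.mul (hn 0 2))).sub ((hq 2 2).1.mul (hn 0 1)))

/-- `F_x(v) = Pfaff (x₁ v₁ + x₂ v₂)`. -/
noncomputable def formC (x : SpaceC c₁ c₂ c₃ × SpaceC c₁ c₂ c₃) : BinaryCubic k :=
  ⟨pfaff (linearMatrixC c₁ c₂ c₃ x.1.1 x.2.1), isHomogeneous_pfaff_linearMatrixC _ _ _ _ _⟩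

/-- `P = P_{1,2}(B) × B₂(k)`. -/
def parabolicC : Subgroup (GroupC c₁ c₂ c₃) := (P12 k ℍ[k,c₁,c₂,c₃]).prod (B2 k)

/-- `H = H° 𝔖₃`, where `H° = T₃(B) × Z₂(k)` and `𝔖₃` is generated by `θ` and `η`. -/
def stabC : Subgroup (GroupC c₁ c₂ c₃) :=
  (T3 k ℍ[k,c₁,c₂,c₃]).prod (Subgroup.center (GL (Fin 2) k)) ⊔
    Subgroup.closure
      {(theta1 ℍ[k,c₁,c₂,c₃], theta2 k), (eta1 ℍ[k,c₁,c₂,c₃], eta2 k)}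

end CaseC

end CubicReducible

open CubicReducible

/-!
The three cases are treated together. In each of them, the matrices in `Y` are the Hermitian
`3 × 3` matrices over an algebra `D` with an involution `*` for which `x x*` and `x + x*` are scalars,
where `D` is `k × k` with the exchange of the factors in Case (a), `F` in Case (b) and the quaternion
algebra in Case (c); the form `F_x` is the cubic norm `N` of `x₁ v₁ + x₂ v₂`.

A point `x` lies in `V^{(1)}` if and only if `F_x` has three distinct zeros in the projective line over
`k` (`hasThreeZeros_iff`). If it does, `GL₂(k)` moves them to `(1, 0)`, `(0, 1)` and `(1, 1)`, so that
`x₁`, `x₂` and `x₁ + x₂` are singular. The zeros are simple, hence the adjoint `y#` of each of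
these three matrices `y` is non-zero. The relations `y y# = N(y) = 0`, `(y#)# = N(y) y = 0` and
`z y' z = T(z, y') z` for Hermitian matrices `z` with `z# = 0` show that `w = y# e` is killed by `y`, for
every column vector `e`, and that `w* y' w = (e* y# e) T(y#, y')` for all `y'`. As the trace form of `D`
is nondegenerate, `e` can be chosen with `e* y# e ≠ 0`. The three vectors `w` obtained in this way are
orthogonal to one another for `x₁` and `x₂`, and the simplicity of the zeros makes them a basis in
which the two matrices become `diag(0, b, -c)` and `diag(a, -b, 0)` with `a b c ≠ 0`
(`HermData.exists_unit_diagonal`). Hence every point of `V^{(1)}` is in the orbit of a point of `U^ss`.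

If `g` maps a point of `U^ss` to a point of `U^ss`, then its component in `GL₂(k)` permutes the three zeros,
and after a multiplication by an element of `𝔖₃` it is scalar. Comparing `g u` with `u' h⁻¹` for the
two diagonal matrices then shows that the other component is diagonal as well
(`IsCubicPair.mem_stab_of_mem`). This gives the first decomposition. For the second one, a point of `W`
has `(1, 0)` as a zero of its form, and `𝔖₃` permutes the zeros transitively; so the element that
moves a point of `U^ss` to it can be chosen with lower triangular component in `GL₂(k)`, and then it
lies in `P` (`IsCubicPair.isContractedProduct_parabolic`).

In Case (c) it has to be known that the action of `GL₃` preserves the singular matrices and, over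
`k[v₁, v₂]`, the non-vanishing of forms. This holds since the norm of a Hermitian matrix is non-zero if
and only if the matrix is not a left zero divisor (`HermData.norm_ne_zero_iff`).
-/

namespace CubicReducible

universe u v

/-! ### Global functions on the zeros of a binary cubic form -/

section GlobalFunctions

variable {k : Type u} [Field k]

theorem aeval_mul_of_isHomogeneous {R : Type*} [CommRing R] [Algebra k R] {n : ℕ}
    {a : MvPolynomial (Fin 2) k} (ha : a.IsHomogeneous n) (r : R) (x : Fin 2 → R) :
    aeval (fun i => r * x i) a = r ^ n * aeval x a := by
  rw [aeval_def, aeval_def, eval₂_eq, eval₂_eq, Finset.mul_sum]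
  refine Finset.sum_congr rfl fun d hd => ?_
  rw [ha.degree_eq_sum_deg_support hd, ← Finset.prod_pow_eq_pow_sum, mul_left_comm,
    ← Finset.prod_mul_distrib]
  simp only [mul_pow]

/-- If `q` vanishes nowhere on `Z`, then `Z` is affine, and its global functions are the elements of
degree zero of `(k[v₁, v₂] / (f))[1 / q]`. -/
theorem exists_ringEquiv_away (f : BinaryCubic k) {q : CoordRing f} {m : ℕ}
    (hq : q ∈ coordGrading f m) (hm : 0 < m) (htop : Proj.basicOpen (coordGrading f) q = ⊤) :
    ∃ e : CubicAlgebra f ≃+* HomogeneousLocalization.Away (coordGrading f) q,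
      ∀ t : k, e (algebraMap k _ t) =
        HomogeneousLocalization.fromZeroRingHom (coordGrading f) _
          (algebraMap k (coordGrading f 0) t) := by
  let j : Spec (.of (HomogeneousLocalization.Away (coordGrading f) q)) ⟶ zeroScheme f :=
    Proj.awayι (coordGrading f) q hq hm
  have : IsOpenImmersion j := inferInstanceAs (IsOpenImmersion (Proj.awayι _ q hq hm))
  have : IsIso j := by
    have h1 : j.opensRange = ⊤ := (Proj.opensRange_awayι _ _ hq hm).trans htop
    have : Epi j.base := by
      rw [TopCat.epi_iff_surjective, ← Set.range_eq_univ]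
      exact congrArg SetLike.coe h1
    exact IsOpenImmersion.isIso j
  have hj : IsIso j.appTop := inferInstanceAs (IsIso (j.app ⊤))
  let i : Γ(zeroScheme f, ⊤) ≅ .of (HomogeneousLocalization.Away (coordGrading f) q) :=
    @asIso _ _ _ _ j.appTop hj ≪≫ Scheme.ΓSpecIso _
  refine ⟨i.commRingCatIsoToRingEquiv, fun t => ?_⟩
  have h4 : Proj.awayι (coordGrading f) q hq hm ≫ Proj.toSpecZero (coordGrading f) ≫
      Spec.map (CommRingCat.ofHom (algebraMap k (coordGrading f 0))) =
      Spec.map (CommRingCat.ofHom (algebraMap k (coordGrading f 0)) ≫ CommRingCat.ofHom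
        (HomogeneousLocalization.fromZeroRingHom (coordGrading f) (Submonoid.powers q))) := by
    rw [Spec.map_comp, ← Category.assoc, Proj.awayι_toSpecZero]
  have h5 : (zeroSchemeToSpec f).appTop ≫ j.appTop = _ :=
    (Scheme.Hom.comp_appTop j (zeroSchemeToSpec f)).symm.trans (congrArg Scheme.Hom.appTop h4)
  have h3 : ((Scheme.ΓSpecIso (.of k)).inv ≫ (zeroSchemeToSpec f).appTop) ≫ i.hom =
      CommRingCat.ofHom (algebraMap k (coordGrading f 0)) ≫ CommRingCat.ofHom
        (HomogeneousLocalization.fromZeroRingHom (coordGrading f) _) := by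
    simp only [i, Iso.trans_hom, Category.assoc]
    rw [asIso_hom, reassoc_of% h5, Scheme.ΓSpecIso_naturality, Iso.inv_hom_id_assoc]
  exact congrArg (fun φ => φ.hom t) h3

/-- A homogeneous element vanishes nowhere on `Z` if every prime ideal that contains it contains
`v₁` and `v₂`, as a point of `Z` is a prime ideal that does not contain the irrelevant ideal. -/
theorem basicOpen_eq_top (f : BinaryCubic k) {q : CoordRing f}
    (h : ∀ I : Ideal (CoordRing f), I.IsPrime → q ∈ I → ∀ i, Ideal.Quotient.mk _ (X i) ∈ I) :
    Proj.basicOpen (coordGrading f) q = ⊤ := by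
  ext x
  simp only [TopologicalSpace.Opens.coe_top, Set.mem_univ, iff_true, SetLike.mem_coe,
    Proj.mem_basicOpen]
  intro hqx
  refine x.not_irrelevant_le ?_
  have hX := h x.asHomogeneousIdeal.toIdeal x.isPrime hqx
  rw [HomogeneousIdeal.irrelevant_le]
  rintro i hi a ha
  obtain ⟨p, hp, rfl⟩ := (mem_coordGrading _ _ _).1 ha
  let φ : MvPolynomial (Fin 2) k →ₐ[k] CoordRing f ⧸ x.asHomogeneousIdeal.toIdeal :=
    (Ideal.Quotient.mkₐ k _).comp (Ideal.Quotient.mkₐ k _)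
  have hφ : φ = aeval (fun i => 0 * (0 : Fin 2 → CoordRing f ⧸ x.asHomogeneousIdeal.toIdeal) i) := by
    refine algHom_ext fun i => ?_
    rw [aeval_X, zero_mul]
    exact Ideal.Quotient.eq_zero_iff_mem.2 (hX i)
  refine Ideal.Quotient.eq_zero_iff_mem.1 (?_ : φ p = 0)
  rw [hφ, aeval_mul_of_isHomogeneous hp, zero_pow hi.ne', zero_mul]

/-- The determinant of the `2 × 2` matrix with rows `r` and `s`. -/
def det2 (r s : Fin 2 → k) : k := r 0 * s 1 - r 1 * s 0

/-- The linear form `v ↦ det (v, r)`, which vanishes exactly on the line of `r`. -/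
noncomputable def lineForm (r : Fin 2 → k) : MvPolynomial (Fin 2) k :=
  C (r 1) * X 0 - C (r 0) * X 1

theorem eval_lineForm (r s : Fin 2 → k) : eval s (lineForm r) = det2 s r := by
  simp [lineForm, det2]; ring

theorem isHomogeneous_lineForm (r : Fin 2 → k) : (lineForm r).IsHomogeneous 1 :=
  (isHomogeneous_C_mul_X _ _).sub (isHomogeneous_C_mul_X _ _)

theorem aeval_lineForm {R : Type*} [CommRing R] [Algebra k R] (p : Fin 2 → k) (x : Fin 2 → R) :
    aeval x (lineForm p) = algebraMap k R (p 1) * x 0 - algebraMap k R (p 0) * x 1 := by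
  simp [lineForm]

/-- If `x` lies on the line of `p`, then `x i • p = p i • x`, so a form takes the same value at
both multiples. -/
theorem aeval_eq_of_line {R : Type*} [CommRing R] [Algebra k R] {n : ℕ}
    {a : MvPolynomial (Fin 2) k} (ha : a.IsHomogeneous n) (p : Fin 2 → k) (x : Fin 2 → R)
    (h : aeval x (lineForm p) = 0) (i : Fin 2) :
    algebraMap k R (p i) ^ n * aeval x a = x i ^ n * algebraMap k R (eval p a) := by
  have hx : ∀ j, algebraMap k R (p i) * x j = x i * algebraMap k R (p j) := by
    rw [aeval_lineForm, sub_eq_zero] at h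
    intro j
    fin_cases i <;> fin_cases j
    · exact mul_comm _ _
    · exact h.symm.trans (mul_comm _ _)
    · exact h.trans (mul_comm _ _)
    · exact mul_comm _ _
  rw [← aeval_mul_of_isHomogeneous ha]
  simp only [hx]
  rw [aeval_mul_of_isHomogeneous ha]
  exact congrArg _ (aeval_algebraMap_apply R p a)

/-- A form that vanishes at `r` is divisible by the linear form of `r`, as its class modulo this
linear form is, up to a unit, its value at `r`. -/
theorem lineForm_dvd {n : ℕ} {p : MvPolynomial (Fin 2) k} (hp : p.IsHomogeneous n)
    {r : Fin 2 → k} (hr : r ≠ 0) (h : eval r p = 0) : lineForm r ∣ p := by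
  rw [← Ideal.mem_span_singleton, ← Ideal.Quotient.eq_zero_iff_mem]
  set I := Ideal.span {lineForm r}
  have h3 : aeval (fun j => Ideal.Quotient.mk I (X j)) = Ideal.Quotient.mkₐ k I :=
    algHom_ext fun j => by simp
  obtain ⟨i, hi⟩ := Function.ne_iff.1 hr
  have h1 := aeval_eq_of_line hp r (fun j => Ideal.Quotient.mk I (X j)) (by
    rw [h3]
    exact Ideal.Quotient.eq_zero_iff_mem.2 (Ideal.mem_span_singleton_self _)) i
  rw [h3, h, map_zero, mul_zero, ← map_pow, ← Algebra.smul_def] at h1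
  exact (smul_eq_zero_iff_right (pow_ne_zero _ hi)).1 h1

/-- If `f p ≠ 0`, then the linear form of `p` vanishes nowhere on `Z`. -/
theorem eq_zero_of_lineForm_eq_zero {R : Type*} [CommRing R] [IsDomain R] [Algebra k R]
    (f : BinaryCubic k) {p : Fin 2 → k} (hp : eval p f.1 ≠ 0) (π : MvPolynomial (Fin 2) k →ₐ[k] R)
    (h1 : π (lineForm p) = 0) (h2 : π f.1 = 0) (j : Fin 2) : π (X j) = 0 := by
  have h3 : π = aeval (fun j => π (X j)) := algHom_ext fun j => by simp
  -- in a domain where `f` and the linear form of `p` vanish, `v_j ^ 3 f(p) = 0`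
  have h4 := aeval_eq_of_line f.2 p (fun j => π (X j)) (by rw [← h3, h1]) j
  rw [← h3, h2, mul_zero, eq_comm, mul_eq_zero] at h4
  exact eq_zero_of_pow_eq_zero (h4.resolve_right (by simpa using hp))

theorem eq_zero_of_two_lineForm_eq_zero {R : Type*} [CommRing R] [Algebra k R]
    {r s : Fin 2 → k} (hrs : det2 r s ≠ 0) (π : MvPolynomial (Fin 2) k →ₐ[k] R)
    (hr : π (lineForm r) = 0) (hs : π (lineForm s) = 0) (j : Fin 2) : π (X j) = 0 := by
  have h : π (C (det2 r s) * X j) = 0 := by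
    have : C (det2 r s) * X j = C (r j) * lineForm s - C (s j) * lineForm r := by
      fin_cases j <;> simp [det2, lineForm] <;> ring
    rw [this, map_sub, map_mul, map_mul, hr, hs, mul_zero, mul_zero, sub_zero]
  rw [← smul_eq_C_mul, map_smul] at h
  exact (smul_eq_zero_iff_right hrs).1 h

/-- Three linear forms that are pairwise independent, and the sum of the products of two of them,
have no common zero with their product. -/
theorem eq_zero_of_prod_eq_zero {R : Type*} [CommRing R] [IsDomain R] [Algebra k R]
    (r : Fin 3 → Fin 2 → k) (hr : ∀ i j, i ≠ j → det2 (r i) (r j) ≠ 0)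
    (π : MvPolynomial (Fin 2) k →ₐ[k] R)
    (h1 : π (lineForm (r 0) * lineForm (r 1) * lineForm (r 2)) = 0)
    (h2 : π (∑ i, lineForm (r (i + 1)) * lineForm (r (i + 2))) = 0) (j : Fin 2) :
    π (X j) = 0 := by
  have key : ∀ a b, a ≠ b → π (lineForm (r a)) = 0 → π (lineForm (r b)) = 0 → π (X j) = 0 :=
    fun a b hab ha hb => eq_zero_of_two_lineForm_eq_zero (hr a b hab) π ha hb j
  rw [Fin.sum_univ_three] at h2
  simp only [map_add, map_mul, mul_eq_zero, zero_add, Fin.reduceAdd] at h1 h2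
  rcases h1 with (h | h) | h <;> simp only [h, zero_mul, mul_zero, add_zero, zero_add, mul_eq_zero] at h2
  · rcases h2 with h' | h'
    exacts [key 0 1 (by decide) h h', key 0 2 (by decide) h h']
  · rcases h2 with h' | h'
    exacts [key 1 2 (by decide) h h', key 1 0 (by decide) h h']
  · rcases h2 with h' | h'
    exacts [key 2 0 (by decide) h h', key 2 1 (by decide) h h']

theorem X_mem_of_lineForm_mem (f : BinaryCubic k) {p : Fin 2 → k} (hp : eval p f.1 ≠ 0)
    {J : Ideal (MvPolynomial (Fin 2) k)} (hJ : J.IsPrime) (h1 : lineForm p ∈ J) (h2 : f.1 ∈ J)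
    (j : Fin 2) : X j ∈ J :=
  Ideal.Quotient.eq_zero_iff_mem.1 (eq_zero_of_lineForm_eq_zero f hp (Ideal.Quotient.mkₐ k J)
    (Ideal.Quotient.eq_zero_iff_mem.2 h1) (Ideal.Quotient.eq_zero_iff_mem.2 h2) j)

theorem X_mem_of_prod_mem (r : Fin 3 → Fin 2 → k) (hr : ∀ i j, i ≠ j → det2 (r i) (r j) ≠ 0)
    {J : Ideal (MvPolynomial (Fin 2) k)} (hJ : J.IsPrime)
    (h1 : lineForm (r 0) * lineForm (r 1) * lineForm (r 2) ∈ J)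
    (h2 : ∑ i, lineForm (r (i + 1)) * lineForm (r (i + 2)) ∈ J) (j : Fin 2) : X j ∈ J :=
  Ideal.Quotient.eq_zero_iff_mem.1 (eq_zero_of_prod_eq_zero r hr (Ideal.Quotient.mkₐ k J)
    (Ideal.Quotient.eq_zero_iff_mem.2 h1) (Ideal.Quotient.eq_zero_iff_mem.2 h2) j)

theorem mk_self_mem (f : BinaryCubic k) (I : Ideal (CoordRing f)) :
    Ideal.Quotient.mk (Ideal.span {f.1}) f.1 ∈ I := by
  have : Ideal.Quotient.mk (Ideal.span {f.1}) f.1 = 0 :=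
    Ideal.Quotient.eq_zero_iff_mem.2 (Ideal.mem_span_singleton_self _)
  exact this ▸ I.zero_mem

/-- If `L = Γ(Z, 𝒪_Z)` is `k × k × k`, then `f` has three zeros. Unless `f` vanishes on all of
`k × k`, a linear form `ℓ` vanishes nowhere on `Z`, and `L` is generated by `v₁ / ℓ` and `v₂ / ℓ`.
The three projections of `k × k × k` map these functions to the coordinates of zeros of `f`, which
are on different lines as the projections differ. -/
theorem exists_three_zeros (f : BinaryCubic k)
    (h : Nonempty (CubicAlgebra f ≃ₐ[k] k × k × k)) :
    ∃ r : Fin 3 → Fin 2 → k, (∀ i, eval (r i) f.1 = 0) ∧ ∀ i j, i ≠ j → det2 (r i) (r j) ≠ 0 := by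
  obtain ⟨ψ⟩ := h
  by_cases hall : ∀ p : Fin 2 → k, eval p f.1 = 0
  -- This covers `f = 0`, and a product of all linear forms over the field with two elements.
  · refine ⟨![![1, 0], ![0, 1], ![1, 1]], fun i => hall _, fun i j hij => ?_⟩
    fin_cases i <;> fin_cases j <;> simp [det2] at hij ⊢
  push Not at hall
  obtain ⟨p, hp⟩ := hall
  set ℓ : CoordRing f := Ideal.Quotient.mk _ (lineForm p) with hℓ
  have hdeg : ℓ ∈ coordGrading f 1 :=
    (mem_coordGrading _ _ _).2 ⟨_, isHomogeneous_lineForm p, rfl⟩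
  have htop : Proj.basicOpen (coordGrading f) (ℓ) = ⊤ := by
    refine basicOpen_eq_top f fun I hI hpI j => ?_
    have hJ := hI.comap (Ideal.Quotient.mk (Ideal.span {f.1}))
    exact X_mem_of_lineForm_mem f hp hJ hpI (mk_self_mem f I) j
  obtain ⟨e, he⟩ := exists_ringEquiv_away f hdeg one_pos htop
  let c : k →+* HomogeneousLocalization.Away (coordGrading f) ℓ :=
    (HomogeneousLocalization.fromZeroRingHom (coordGrading f) _).comp
      (algebraMap k (coordGrading f 0))
  have hX : ∀ i, Ideal.Quotient.mk (Ideal.span {f.1}) (X i) ∈ coordGrading f (1 • 1) :=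
    fun i => (mem_coordGrading _ _ _).2 ⟨_, isHomogeneous_X k i, rfl⟩
  let ξ : Fin 2 → HomogeneousLocalization.Away (coordGrading f) ℓ := fun i =>
    HomogeneousLocalization.Away.mk (coordGrading f) hdeg 1 _ (hX i)
  -- Here `ξ` consists of `v₁ / ℓ` and `v₂ / ℓ`; for a form `a` of degree `n` the function `a / ℓ ^ n`
  -- is the value `a(ξ)`.
  have key : ∀ (n : ℕ) (a : MvPolynomial (Fin 2) k) (ha : a.IsHomogeneous (n • 1)),
      HomogeneousLocalization.Away.mk (coordGrading f) hdeg n (Ideal.Quotient.mk _ a)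
        ((mem_coordGrading _ _ _).2 ⟨a, ha, rfl⟩) = eval₂ c ξ a := by
    intro n a ha
    let S := Localization.Away ℓ
    let u : S := Localization.mk 1 ⟨ℓ, Submonoid.mem_powers ℓ⟩
    have hc : (algebraMap (HomogeneousLocalization.Away (coordGrading f) ℓ) S).comp c =
        algebraMap k S := rfl
    have hξ : ∀ i, algebraMap (HomogeneousLocalization.Away (coordGrading f) ℓ) S (ξ i) =
        u * algebraMap (CoordRing f) S (Ideal.Quotient.mk _ (X i)) := by
      intro i
      rw [HomogeneousLocalization.algebraMap_apply, HomogeneousLocalization.Away.val_mk,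
        ← Localization.mk_one_eq_algebraMap, Localization.mk_mul]
      simp
    have ha' : aeval (fun i => algebraMap (CoordRing f) S (Ideal.Quotient.mk _ (X i))) a =
        algebraMap (CoordRing f) S (Ideal.Quotient.mk _ a) := by
      have : aeval (fun i => algebraMap (CoordRing f) S (Ideal.Quotient.mk _ (X i))) =
          (IsScalarTower.toAlgHom k (CoordRing f) S).comp (Ideal.Quotient.mkₐ k _) :=
        algHom_ext fun j => by simp
      rw [this]; rfl
    apply HomogeneousLocalization.val_injective
    rw [HomogeneousLocalization.Away.val_mk, ← HomogeneousLocalization.algebraMap_apply, hom_eval₂,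
      hc, ← aeval_def, funext hξ, aeval_mul_of_isHomogeneous (by simpa using ha), ha',
      ← Localization.mk_one_eq_algebraMap, Localization.mk_pow, Localization.mk_mul]
    simp
  have hφ : ∀ φ : k × k × k →ₐ[k] k, ∀ t, φ (ψ (e.symm (c t))) = t := by
    intro φ t
    have : e.symm (c t) = algebraMap k _ t := by rw [RingEquiv.symm_apply_eq, he]; rfl
    rw [this, AlgEquiv.commutes, AlgHom.commutes]; rfl
  let r : (k × k × k →ₐ[k] k) → Fin 2 → k := fun φ i => φ (ψ (e.symm (ξ i)))
  have hr : ∀ φ a, φ (ψ (e.symm (eval₂ c ξ a))) = eval (r φ) a := by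
    intro φ a
    let Φ : HomogeneousLocalization.Away (coordGrading f) ℓ →+* k :=
      (φ : k × k × k →+* k).comp ((ψ : CubicAlgebra f →+* k × k × k).comp (e.symm : _ →+* _))
    have : Φ.comp c = RingHom.id k := RingHom.ext (hφ φ)
    change Φ _ = _
    rw [hom_eval₂, this]
    rfl
  have hr0 : ∀ φ, eval (r φ) f.1 = 0 := by
    intro φ
    rw [← hr, ← key 3 f.1 f.2]
    have : HomogeneousLocalization.Away.mk (coordGrading f) hdeg 3
        (Ideal.Quotient.mk (Ideal.span {f.1}) f.1) ((mem_coordGrading _ _ _).2 ⟨_, f.2, rfl⟩) = 0 :=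
      HomogeneousLocalization.mk_eq_zero_of_num _
        (Subtype.ext (Ideal.Quotient.eq_zero_iff_mem.2 (Ideal.mem_span_singleton_self f.1)))
    rw [this, map_zero, map_zero, map_zero]
  -- The zeros are normalized by `ℓ / ℓ = 1`, so that zeros on the same line agree.
  have hr1 : ∀ φ, det2 (r φ) p = 1 := by
    intro φ
    rw [← eval_lineForm, ← hr, ← key 1 _ (isHomogeneous_lineForm p)]
    have : HomogeneousLocalization.Away.mk (coordGrading f) hdeg 1 ℓ hdeg = 1 := by
      apply HomogeneousLocalization.val_injective
      rw [HomogeneousLocalization.Away.val_mk, HomogeneousLocalization.val_one]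
      simp only [pow_one]
      exact Localization.mk_self (⟨ℓ, Submonoid.mem_powers ℓ⟩ : Submonoid.powers ℓ)
    exact (congrArg (fun z => φ (ψ (e.symm z))) this).trans (by simp)
  have hinj : ∀ φ φ', det2 (r φ) (r φ') = 0 → φ = φ' := by
    intro φ φ' h0
    have hrr : r φ = r φ' := by
      have e1 := hr1 φ
      have e2 := hr1 φ'
      simp only [det2] at e1 e2 h0
      ext i
      fin_cases i
      · change r φ 0 = r φ' 0
        linear_combination r φ' 0 * e1 - r φ 0 * e2 - p 0 * h0
      · change r φ 1 = r φ' 1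
        linear_combination r φ' 1 * e1 - r φ 1 * e2 - p 1 * h0
    refine AlgHom.ext fun y => ?_
    obtain ⟨z, rfl⟩ := ψ.surjective y
    obtain ⟨z, rfl⟩ := e.symm.surjective z
    obtain ⟨n, a, ha, rfl⟩ := HomogeneousLocalization.Away.mk_surjective (coordGrading f) hdeg z
    obtain ⟨a, ha', rfl⟩ := (mem_coordGrading _ _ _).1 ha
    rw [key n a ha', hr, hr, hrr]
  let π : Fin 3 → (k × k × k →ₐ[k] k) :=
    ![AlgHom.fst k k _, (AlgHom.fst k k _).comp (AlgHom.snd k k _),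
      (AlgHom.snd k k _).comp (AlgHom.snd k k _)]
  refine ⟨fun i => r (π i), fun i => hr0 _, fun i j hij h0 => hij ?_⟩
  have h1 := hinj _ _ h0
  have h2 : ∀ v, π i v = π j v := fun v => by rw [h1]
  have h3 := h2 (1, 0, 0)
  have h4 := h2 (0, 1, 0)
  fin_cases i <;> fin_cases j <;> simp [π] at h3 h4 ⊢

/-- If `f` is a product of three pairwise independent linear forms `l₀`, `l₁`, `l₂`, then
`L = Γ(Z, 𝒪_Z)` is `k × k × k` by the evaluation at the three zeros. The denominator is
`q = l₁ l₂ + l₂ l₀ + l₀ l₁`, whose summands `m₀`, `m₁`, `m₂` give the idempotents `m_i / q` of `L`. In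
contrast to a linear form without zeros on `Z`, it exists over every field. -/
theorem nonempty_algEquiv_of_eq_prod (f : BinaryCubic k) {c : k} (hc : c ≠ 0)
    (r : Fin 3 → Fin 2 → k) (hr : ∀ i j, i ≠ j → det2 (r i) (r j) ≠ 0)
    (hf : f.1 = C c * (lineForm (r 0) * lineForm (r 1) * lineForm (r 2))) :
    Nonempty (CubicAlgebra f ≃ₐ[k] k × k × k) := by
  let m : Fin 3 → MvPolynomial (Fin 2) k := fun i => lineForm (r (i + 1)) * lineForm (r (i + 2))
  have hmf : ∀ i, lineForm (r i) * m i * C c = f.1 := by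
    intro i
    rw [hf]
    fin_cases i <;> simp [m] <;> ring
  have hm : ∀ i, (m i).IsHomogeneous 2 := fun i =>
    (isHomogeneous_lineForm _).mul (isHomogeneous_lineForm _)
  have hmne : ∀ i, eval (r i) (m i) ≠ 0 := by
    intro i
    simp only [m, map_mul, eval_lineForm]
    exact mul_ne_zero (hr _ _ (by simp)) (hr _ _ (by simp))
  have hmeq : ∀ i j, i ≠ j → eval (r i) (m j) = 0 := by
    intro i j hij
    simp only [m, map_mul, eval_lineForm, mul_eq_zero]
    have : i = j + 1 ∨ i = j + 2 := by revert i j; decide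
    rcases this with rfl | rfl
    · left; simp only [det2]; ring
    · right; simp only [det2]; ring
  have hmI : ∀ i, Ideal.Quotient.mk (Ideal.span {f.1}) (lineForm (r i) * m i) = 0 := by
    intro i
    rw [Ideal.Quotient.eq_zero_iff_mem, Ideal.mem_span_singleton]
    exact ⟨C c⁻¹, by rw [← hmf i, mul_assoc _ (C c), ← C_mul, mul_inv_cancel₀ hc, C_1, mul_one]⟩
  have hne : ∀ i, r i ≠ 0 := by
    intro i h0
    exact hr i (i + 1) (by simp) (by simp [h0, det2])
  let q : MvPolynomial (Fin 2) k := ∑ i, m i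
  have hq : q.IsHomogeneous 2 := IsHomogeneous.sum _ _ _ fun i _ => hm i
  have hqr : ∀ i, eval (r i) q = eval (r i) (m i) := by
    intro i
    rw [map_sum]
    exact Finset.sum_eq_single i (fun j _ hj => hmeq i j hj.symm) (by simp)
  have hdeg : Ideal.Quotient.mk _ q ∈ coordGrading f 2 := (mem_coordGrading _ _ _).2 ⟨_, hq, rfl⟩
  have htop : Proj.basicOpen (coordGrading f) (Ideal.Quotient.mk _ q) = ⊤ := by
    refine basicOpen_eq_top f fun I hI hqI j => ?_
    have hJ := hI.comap (Ideal.Quotient.mk (Ideal.span {f.1}))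
    refine X_mem_of_prod_mem r hr hJ ?_ hqI j
    rw [mul_assoc, Ideal.mem_comap]
    exact (hmI 0).symm ▸ I.zero_mem
  set Q : CoordRing f := Ideal.Quotient.mk _ q with hQ
  obtain ⟨e, he⟩ := exists_ringEquiv_away f hdeg two_pos htop
  let ev : Fin 3 → CoordRing f →+* k := fun i => Ideal.Quotient.lift _ (eval (r i)) (by
    intro a ha
    obtain ⟨b, rfl⟩ := Ideal.mem_span_singleton.1 ha
    rw [← hmf i, map_mul, map_mul, map_mul, eval_lineForm, det2, mul_comm (r i 0), sub_self]
    simp)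
  have hev : ∀ i a, ev i (Ideal.Quotient.mk _ a) = eval (r i) a := fun i a => rfl
  have hevQ : ∀ i, ev i Q * (eval (r i) (m i))⁻¹ = 1 := fun i => by
    rw [hQ, hev, hqr, mul_inv_cancel₀ (hmne i)]
  let φ : Fin 3 → HomogeneousLocalization.Away (coordGrading f) Q →+* k := fun i =>
    (Localization.awayLift (ev i) Q (.of_mul_eq_one _ (hevQ i))).comp
      (algebraMap _ (Localization.Away Q))
  have hφ : ∀ i n a ha, φ i (HomogeneousLocalization.Away.mk (coordGrading f) hdeg n a ha) =
      ev i a * (eval (r i) (m i))⁻¹ ^ n := by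
    intro i n a ha
    exact Localization.awayLift_mk (ev i) Q a _ (hevQ i) n
  let Φ : Fin 3 → CubicAlgebra f →ₐ[k] k := fun i =>
    { (φ i).comp (e : CubicAlgebra f →+* _) with
      commutes' := by
        intro t
        change φ i (e _) = t
        have h0 : algebraMap k (CoordRing f) t ∈ coordGrading f (0 • 2) :=
          (mem_coordGrading _ _ _).2 ⟨C t, by simpa using isHomogeneous_C _ t, rfl⟩
        have h1 : HomogeneousLocalization.fromZeroRingHom (coordGrading f) _
            (algebraMap k (coordGrading f 0) t) =
            HomogeneousLocalization.Away.mk (coordGrading f) hdeg 0 _ h0 := by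
          apply HomogeneousLocalization.val_injective
          rw [HomogeneousLocalization.Away.val_mk]
          simp only [pow_zero]
          rfl
        have h2 : ev i (algebraMap k (CoordRing f) t) = t := (hev i (C t)).trans (eval_C t)
        rw [he, h1, hφ, h2, pow_zero, mul_one] }
  let Ψ : CubicAlgebra f →ₐ[k] k × k × k := (Φ 0).prod ((Φ 1).prod (Φ 2))
  refine ⟨AlgEquiv.ofBijective Ψ ⟨?_, ?_⟩⟩
  · rw [injective_iff_map_eq_zero]
    intro z hz
    obtain ⟨y, rfl⟩ := e.symm.surjective z
    obtain ⟨n, a, ha, rfl⟩ := HomogeneousLocalization.Away.mk_surjective (coordGrading f) hdeg y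
    obtain ⟨p, hp, rfl⟩ := (mem_coordGrading _ _ _).1 ha
    have h0 : ∀ i, eval (r i) p = 0 := by
      intro i
      have h1 : Φ i (e.symm (HomogeneousLocalization.Away.mk (coordGrading f) hdeg n _ ha)) = 0 := by
        fin_cases i
        · exact congrArg Prod.fst hz
        · exact congrArg (fun t => t.2.1) hz
        · exact congrArg (fun t => t.2.2) hz
      change φ i (e (e.symm _)) = 0 at h1
      rw [RingEquiv.apply_symm_apply, hφ, mul_eq_zero] at h1
      exact h1.resolve_right (pow_ne_zero _ (inv_ne_zero (hmne i)))
    -- A form `p` that vanishes at the `i`-th zero is killed by `m_i`, since `l_i m_i` is `f` up to a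
    -- constant.
    have h1 : Q * Ideal.Quotient.mk _ p = 0 := by
      rw [hQ, ← map_mul, Finset.sum_mul, map_sum]
      refine Finset.sum_eq_zero fun i _ => ?_
      obtain ⟨b, rfl⟩ := lineForm_dvd hp (hne i) (h0 i)
      rw [show m i * (lineForm (r i) * b) = lineForm (r i) * m i * b by ring, map_mul, hmI, zero_mul]
    have h2 : HomogeneousLocalization.Away.mk (coordGrading f) hdeg n _ ha = 0 := by
      apply HomogeneousLocalization.val_injective
      rw [HomogeneousLocalization.Away.val_mk, HomogeneousLocalization.val_zero,
        Localization.mk_eq_mk', IsLocalization.mk'_eq_zero_iff]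
      exact ⟨⟨Q, Submonoid.mem_powers Q⟩, h1⟩
    rw [h2, map_zero]
  · have hmem : ∀ i, Ideal.Quotient.mk (Ideal.span {f.1}) (m i) ∈ coordGrading f (1 • 2) :=
      fun i => (mem_coordGrading _ _ _).2 ⟨_, hm i, rfl⟩
    let s : Fin 3 → CubicAlgebra f := fun i =>
      e.symm (HomogeneousLocalization.Away.mk (coordGrading f) hdeg 1 _ (hmem i))
    have hs : ∀ i j, Φ i (s j) = if i = j then 1 else 0 := by
      intro i j
      change φ i (e (e.symm _)) = _
      rw [RingEquiv.apply_symm_apply, hφ, hev, pow_one]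
      split_ifs with hij
      · rw [← hij, mul_inv_cancel₀ (hmne i)]
      · rw [hmeq i j hij, zero_mul]
    rintro ⟨t₀, t₁, t₂⟩
    refine ⟨t₀ • s 0 + t₁ • s 1 + t₂ • s 2, ?_⟩
    simp [Ψ, hs]

end GlobalFunctions

/-! ### Binary cubic forms with three zeros -/

section Forms

variable {k : Type u} [Field k]

/-- The polynomial `a v₁³ + b v₁² v₂ + c v₁ v₂² + d v₂³`. -/
noncomputable def cubicPoly {R : Type*} [CommRing R] (a b c d : R) : MvPolynomial (Fin 2) R :=
  C a * X 0 ^ 3 + C b * (X 0 ^ 2 * X 1) + C c * (X 0 * X 1 ^ 2) + C d * X 1 ^ 3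

theorem coeff_C_mul_X_pow_mul_X_pow {R : Type*} [CommRing R] (a : R) (i j i' j' : ℕ) :
    coeff (Finsupp.single 0 i' + Finsupp.single 1 j')
      (C a * (X 0 ^ i * X 1 ^ j) : MvPolynomial (Fin 2) R) = if i = i' ∧ j = j' then a else 0 := by
  have h : (X 0 ^ i * X 1 ^ j : MvPolynomial (Fin 2) R) =
      monomial (Finsupp.single 0 i + Finsupp.single 1 j) 1 := by
    rw [X_pow_eq_monomial, X_pow_eq_monomial, monomial_mul, mul_one]
  have h' : (Finsupp.single (0 : Fin 2) i + Finsupp.single 1 j =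
      Finsupp.single 0 i' + Finsupp.single 1 j') ↔ i = i' ∧ j = j' := by
    simp [Finsupp.ext_iff, Fin.forall_fin_two]
  rw [coeff_C_mul, h, coeff_monomial]
  simp [h']

theorem coeff_cubicPoly {R : Type*} [CommRing R] (a b c d : R) (i j : ℕ) :
    coeff (Finsupp.single 0 i + Finsupp.single 1 j) (cubicPoly a b c d) =
      (if 3 = i ∧ 0 = j then a else 0) + (if 2 = i ∧ 1 = j then b else 0) +
      (if 1 = i ∧ 2 = j then c else 0) + (if 0 = i ∧ 3 = j then d else 0) := by
  have h : cubicPoly a b c d = C a * (X 0 ^ 3 * X 1 ^ 0) + C b * (X 0 ^ 2 * X 1 ^ 1) +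
      C c * (X 0 ^ 1 * X 1 ^ 2) + C d * (X 0 ^ 0 * X 1 ^ 3) := by
    simp [cubicPoly]
  simp only [h, coeff_add, coeff_C_mul_X_pow_mul_X_pow]

theorem eq_cubicPoly (f : BinaryCubic k) :
    f.1 = cubicPoly (binaryCoeff 3 0 f.1) (binaryCoeff 2 1 f.1) (binaryCoeff 1 2 f.1)
      (binaryCoeff 0 3 f.1) := by
  ext d
  obtain ⟨i, j, rfl⟩ : ∃ i j, d = Finsupp.single 0 i + Finsupp.single 1 j :=
    ⟨d 0, d 1, by simp [Finsupp.ext_iff, Fin.forall_fin_two]⟩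
  rw [coeff_cubicPoly]
  by_cases hij : i + j = 3
  · obtain ⟨rfl, rfl⟩ | ⟨rfl, rfl⟩ | ⟨rfl, rfl⟩ | ⟨rfl, rfl⟩ :
        (i = 0 ∧ j = 3) ∨ (i = 1 ∧ j = 2) ∨ (i = 2 ∧ j = 1) ∨ (i = 3 ∧ j = 0) := by omega
    all_goals simp [binaryCoeff]
  · have h0 : coeff (Finsupp.single 0 i + Finsupp.single 1 j) f.1 = 0 := by
      refine IsHomogeneous.coeff_eq_zero f.2 ?_
      simpa [Finsupp.degree_eq_sum] using hij
    rw [h0, if_neg (by omega), if_neg (by omega), if_neg (by omega), if_neg (by omega)]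
    simp

theorem disc_eq_of_eq_cubicPoly {f : BinaryCubic k} {a b c d : k} (h : f.1 = cubicPoly a b c d) :
    disc f = b ^ 2 * c ^ 2 - 4 * a * c ^ 3 - 4 * b ^ 3 * d - 27 * a ^ 2 * d ^ 2
      + 18 * a * b * c * d := by
  simp only [disc, Cubic.discr, h, binaryCoeff, coeff_cubicPoly]
  simp

theorem disc_eq_of_eq_prod {f : BinaryCubic k} {c : k} {r : Fin 3 → Fin 2 → k}
    (hf : f.1 = C c * (lineForm (r 0) * lineForm (r 1) * lineForm (r 2))) :
    disc f = c ^ 4 * (det2 (r 0) (r 1) * det2 (r 1) (r 2) * det2 (r 0) (r 2)) ^ 2 := by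
  have h : f.1 = cubicPoly (c * (r 0 1 * r 1 1 * r 2 1))
      (-(c * (r 0 0 * r 1 1 * r 2 1 + r 0 1 * r 1 0 * r 2 1 + r 0 1 * r 1 1 * r 2 0)))
      (c * (r 0 0 * r 1 0 * r 2 1 + r 0 0 * r 1 1 * r 2 0 + r 0 1 * r 1 0 * r 2 0))
      (-(c * (r 0 0 * r 1 0 * r 2 0))) := by
    rw [hf]
    simp only [lineForm, cubicPoly, C_mul, C_add, C_neg]
    ring
  rw [disc_eq_of_eq_cubicPoly h]
  simp only [det2]
  ring

theorem ne_zero_of_disc_ne_zero {f : BinaryCubic k} (h : disc f ≠ 0) : f.1 ≠ 0 := by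
  intro h0
  refine h ?_
  rw [disc_eq_of_eq_cubicPoly (a := 0) (b := 0) (c := 0) (d := 0) (by simp [h0, cubicPoly])]
  ring

/-- The form `v₁ v₂ (v₁ - v₂)`, with zeros at `(1, 0)`, `(0, 1)` and `(1, 1)`. -/
noncomputable def stdForm (k : Type*) [Field k] : MvPolynomial (Fin 2) k :=
  X 0 * X 1 * (X 0 - X 1)

theorem eq_stdForm_of_zeros {f : BinaryCubic k} (h1 : eval ![1, 0] f.1 = 0)
    (h2 : eval ![0, 1] f.1 = 0) (h3 : eval ![1, 1] f.1 = 0) : ∃ c, f.1 = C c * stdForm k := by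
  have h := eq_cubicPoly f
  generalize binaryCoeff 3 0 f.1 = a, binaryCoeff 2 1 f.1 = b, binaryCoeff 1 2 f.1 = c,
    binaryCoeff 0 3 f.1 = d at h
  rw [h] at h1 h2 h3
  simp [cubicPoly] at h1 h2 h3
  subst h1 h2
  have hc : c = -b := by linear_combination h3
  subst hc
  refine ⟨b, ?_⟩
  rw [h]
  simp [cubicPoly, stdForm]
  ring

/-- The substitution `f(v) ↦ f(v h)` for the row vector `v = (v₁, v₂)`. -/
noncomputable def substForm (h : Matrix (Fin 2) (Fin 2) k) :
    MvPolynomial (Fin 2) k →ₐ[k] MvPolynomial (Fin 2) k :=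
  aeval fun i => C (h 0 i) * X 0 + C (h 1 i) * X 1

theorem eval_substForm (h : Matrix (Fin 2) (Fin 2) k) (r : Fin 2 → k) (f : MvPolynomial (Fin 2) k) :
    eval r (substForm h f) = eval (r ᵥ* h) f := by
  have : (eval r).comp (substForm h : _ →+* _) = eval (r ᵥ* h) := by
    refine ringHom_ext (fun t => ?_) fun i => ?_
    · simp [substForm]
    · simp [substForm, Matrix.vecMul, dotProduct, Fin.sum_univ_two, mul_comm]
  exact congrArg (fun φ => φ f) this

theorem substForm_mul (g h : Matrix (Fin 2) (Fin 2) k) (f : MvPolynomial (Fin 2) k) :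
    substForm (g * h) f = substForm g (substForm h f) := by
  have : substForm (g * h) = (substForm g).comp (substForm h) := by
    refine algHom_ext fun i => ?_
    simp [substForm, Matrix.mul_apply, Fin.sum_univ_two]
    ring
  exact congrArg (fun φ => φ f) this

theorem substForm_one (f : MvPolynomial (Fin 2) k) : substForm 1 f = f := by
  have : substForm (1 : Matrix (Fin 2) (Fin 2) k) = AlgHom.id k _ := by
    refine algHom_ext fun i => ?_
    fin_cases i <;> simp [substForm]
  exact congrArg (fun φ => φ f) this

theorem substForm_ne_zero (h : GL (Fin 2) k) {f : MvPolynomial (Fin 2) k} (hf : f ≠ 0) :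
    substForm h.1 f ≠ 0 := by
  intro h0
  have := substForm_mul (h⁻¹ : GL (Fin 2) k).1 h.1 f
  rw [h0, map_zero, Units.inv_mul, substForm_one] at this
  exact hf this

/-- `GL₂` moves any three points of the projective line to `(1, 0)`, `(0, 1)` and `(1, 1)`. -/
theorem exists_vecMul_eq (r : Fin 3 → Fin 2 → k) (hr : ∀ i j, i ≠ j → det2 (r i) (r j) ≠ 0) :
    ∃ (h : GL (Fin 2) k) (s t w : k), ![1, 0] ᵥ* h.1 = s • r 0 ∧ ![0, 1] ᵥ* h.1 = t • r 1 ∧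
      ![1, 1] ᵥ* h.1 = w • r 2 := by
  let s := det2 (r 2) (r 1)
  let t := det2 (r 0) (r 2)
  have hs : s ≠ 0 := hr 2 1 (by decide)
  have ht : t ≠ 0 := hr 0 2 (by decide)
  let M : Matrix (Fin 2) (Fin 2) k := !![s * r 0 0, s * r 0 1; t * r 1 0, t * r 1 1]
  have hM : M.det = s * t * det2 (r 0) (r 1) := by
    simp [M, Matrix.det_fin_two, det2]; ring
  have hM0 : M.det ≠ 0 := hM ▸ mul_ne_zero (mul_ne_zero hs ht) (hr 0 1 (by decide))
  refine ⟨Matrix.GeneralLinearGroup.mkOfDetNeZero M hM0, s, t, det2 (r 0) (r 1), ?_, ?_, ?_⟩ <;>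
    ext j <;> fin_cases j <;>
    simp [Matrix.GeneralLinearGroup.mkOfDetNeZero, M, Matrix.vecMul, dotProduct, Fin.sum_univ_two,
      s, t, det2] <;> ring

theorem eval_smul_eq_zero (f : BinaryCubic k) (s : k) (r : Fin 2 → k) (h : eval r f.1 = 0) :
    eval (s • r) f.1 = 0 := by
  have := aeval_mul_of_isHomogeneous (R := k) f.2 s r
  change eval (s • r) f.1 = s ^ 3 * eval r f.1 at this
  rw [this, h, mul_zero]

theorem isHomogeneous_substForm (h : Matrix (Fin 2) (Fin 2) k) (f : BinaryCubic k) :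
    substForm h f.1 ∈ homogeneousSubmodule (Fin 2) k 3 := by
  have := f.2.aeval (fun i => C (h 0 i) * X 0 + C (h 1 i) * X 1) (n := 1)
    fun i => isHomogeneous_linear _ _
  exact this

/-- The cubic forms with three distinct zeros on the projective line. -/
def HasThreeZeros (f : BinaryCubic k) : Prop :=
  f.1 ≠ 0 ∧ ∃ r : Fin 3 → Fin 2 → k, (∀ i, eval (r i) f.1 = 0) ∧
    ∀ i j, i ≠ j → det2 (r i) (r j) ≠ 0

/-- Up to a substitution, a form with three zeros is a multiple of the standard form. -/
theorem HasThreeZeros.exists_substForm {f : BinaryCubic k} (hf : HasThreeZeros f) :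
    ∃ (h : GL (Fin 2) k) (c : k), c ≠ 0 ∧ substForm h.1 f.1 = C c * stdForm k := by
  obtain ⟨h0, r, hr, hrr⟩ := hf
  obtain ⟨h, s, t, w, h1, h2, h3⟩ := exists_vecMul_eq r hrr
  obtain ⟨c, hc⟩ := eq_stdForm_of_zeros (f := ⟨_, isHomogeneous_substForm h.1 f⟩)
    (by rw [eval_substForm, h1]; exact eval_smul_eq_zero f _ _ (hr 0))
    (by rw [eval_substForm, h2]; exact eval_smul_eq_zero f _ _ (hr 1))
    (by rw [eval_substForm, h3]; exact eval_smul_eq_zero f _ _ (hr 2))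
  refine ⟨h, c, ?_, hc⟩
  rintro rfl
  exact substForm_ne_zero h h0 (hc.trans (by simp))

theorem HasThreeZeros.exists_eq_prod {f : BinaryCubic k} (hf : HasThreeZeros f) :
    ∃ (c : k) (r : Fin 3 → Fin 2 → k), c ≠ 0 ∧ (∀ i j, i ≠ j → det2 (r i) (r j) ≠ 0) ∧
      f.1 = C c * (lineForm (r 0) * lineForm (r 1) * lineForm (r 2)) := by
  obtain ⟨h, c, hc, hf⟩ := hf.exists_substForm
  let g := (h⁻¹ : GL (Fin 2) k).1
  have hg : g 0 0 * g 1 1 - g 0 1 * g 1 0 ≠ 0 := by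
    rw [← Matrix.det_fin_two]
    exact ((Matrix.isUnit_iff_isUnit_det _).1 (h⁻¹ : GL (Fin 2) k).isUnit).ne_zero
  refine ⟨c, ![![-g 1 0, g 0 0], ![-g 1 1, g 0 1], ![-(g 1 0 - g 1 1), g 0 0 - g 0 1]], hc, ?_, ?_⟩
  · have e : ∀ x, x = g 0 0 * g 1 1 - g 0 1 * g 1 0 ∨ x = -(g 0 0 * g 1 1 - g 0 1 * g 1 0) →
        x ≠ 0 := by
      rintro x (rfl | rfl)
      exacts [hg, neg_ne_zero.2 hg]
    intro i j hij
    apply e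
    fin_cases i <;> fin_cases j <;> simp [det2] at hij ⊢
    all_goals first | (left; ring1) | (right; ring1)
  · have h1 := substForm_mul (h⁻¹ : GL (Fin 2) k).1 h.1 f.1
    rw [Units.inv_mul, substForm_one, hf] at h1
    rw [h1]
    simp only [stdForm, substForm, lineForm, map_mul, map_sub, aeval_X, aeval_C]
    simp only [g, Matrix.cons_val_zero, Matrix.cons_val_one, Matrix.cons_val, C_neg, C_sub,
      algebraMap_eq]
    ring

/-- A binary cubic form has three distinct zeros if and only if its discriminant is non-zero and its
cubic algebra is `k × k × k`. -/
theorem hasThreeZeros_iff (f : BinaryCubic k) :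
    HasThreeZeros f ↔ disc f ≠ 0 ∧ Nonempty (CubicAlgebra f ≃ₐ[k] k × k × k) := by
  refine ⟨fun h => ?_, fun ⟨h, h'⟩ => ⟨ne_zero_of_disc_ne_zero h, exists_three_zeros f h'⟩⟩
  obtain ⟨c, r, hc, hr, hf⟩ := h.exists_eq_prod
  refine ⟨?_, nonempty_algEquiv_of_eq_prod f hc r hr hf⟩
  rw [disc_eq_of_eq_prod hf]
  exact mul_ne_zero (pow_ne_zero _ hc) (pow_ne_zero _ (mul_ne_zero (mul_ne_zero
    (hr 0 1 (by decide)) (hr 1 2 (by decide))) (hr 0 2 (by decide))))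

theorem hasThreeZeros_of_eq_stdForm {f : BinaryCubic k} {c : k} (hc : c ≠ 0)
    (hf : f.1 = C c * stdForm k) : HasThreeZeros f := by
  refine ⟨?_, ![![1, 0], ![0, 1], ![1, 1]], fun i => ?_, fun i j hij => ?_⟩
  · rw [hf]
    refine mul_ne_zero (by simpa using hc) (mul_ne_zero (mul_ne_zero (X_ne_zero _) (X_ne_zero _)) ?_)
    rw [sub_ne_zero]
    exact fun h => absurd (X_injective h) (by decide)
  · rw [hf]; fin_cases i <;> simp [stdForm]
  · fin_cases i <;> fin_cases j <;> simp [det2] at hij ⊢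

theorem disc_ne_zero_iff_of_eq_stdForm {f : BinaryCubic k} {c : k} (hf : f.1 = C c * stdForm k) :
    disc f ≠ 0 ↔ c ≠ 0 := by
  have h : f.1 = cubicPoly 0 c (-c) 0 := by
    rw [hf]; simp [cubicPoly, stdForm]; ring
  rw [disc_eq_of_eq_cubicPoly h]
  simp

end Forms

/-! ### Reduction to properties of the space of matrices -/

section Contracted

variable {k : Type u} [Field k] {V : Type v} [AddCommGroup V] [Module k V] {G : Type*} [Group G]

theorem rep_inv_apply (ρ : Representation k G V) (g : G) (x : V) : ρ g⁻¹ (ρ g x) = x := by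
  rw [← Module.End.mul_apply, ← map_mul, inv_mul_cancel, map_one, Module.End.one_apply]

/-- Injectivity of `A ×_K S → V` follows from: an element of `A` that maps a point of `S` into `S` lies
in `K`. -/
theorem isContractedProduct_of {ρ : Representation k G V} {A K : Subgroup G} {S T : Set V}
    (hKA : K ≤ A) (hKS : ∀ h ∈ K, ∀ s ∈ S, ρ h s ∈ S)
    (hinj : ∀ g ∈ A, ∀ s ∈ S, ρ g s ∈ S → g ∈ K) (hT : ∀ a ∈ A, ∀ s ∈ S, ρ a s ∈ T)
    (hsurj : ∀ t ∈ T, ∃ a ∈ A, ∃ s ∈ S, ρ a s = t) : IsContractedProduct ρ A K S T := by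
  refine ⟨hKA, hKS, ?_, ?_⟩
  · intro p q
    refine Quotient.inductionOn₂ p q fun p q hpq => Quotient.sound ?_
    change ρ p.1 p.2 = ρ q.1 q.2 at hpq
    have h : ρ ((q.1 : G)⁻¹ * p.1) p.2 = q.2 := by
      rw [map_mul, Module.End.mul_apply, hpq, rep_inv_apply]
    refine ⟨(q.1 : G)⁻¹ * p.1, hinj _ (A.mul_mem (A.inv_mem q.1.2) p.1.2) p.2 p.2.2 ?_, ?_, h.symm⟩
    · rw [h]; exact q.2.2
    · group
  · ext t
    constructor
    · rintro ⟨p, rfl⟩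
      exact Quotient.inductionOn p fun p => hT p.1 p.1.2 p.2 p.2.2
    · intro ht
      obtain ⟨a, ha, s, hs, rfl⟩ := hsurj t ht
      exact ⟨Quotient.mk _ (⟨a, ha⟩, ⟨s, hs⟩), rfl⟩

end Contracted

section Skeleton

variable {k : Type u} [Field k] {D : Type v} [Ring D] [Algebra k D]

/-- The matrices whose first row and first column vanish. -/
def FirstCrossZero (y : Matrix (Fin 3) (Fin 3) D) : Prop := ∀ i, y 0 i = 0 ∧ y i 0 = 0

/-- What the proof uses of a space `Y` of `3 × 3` matrices with an action `ρ` of a group `G₁`, of the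
binary cubic form `F x` of `x ∈ Y ⊕ Y`, of the subgroups `T` (diagonal matrices) and `P` (first row
`(*, 0, 0)`) of `G₁` and of the permutation matrices `θ`, `η`. The elements of `Sing` are the
singular matrices, and `δ a b c` is the diagonal matrix with the entries `a`, `b`, `c`.

Singularity and the non-vanishing of forms are invariant under `G₁`; no multiplicativity of the
cubic norm is assumed. The conditions in `exists_diag` say that the form of `(x₁, x₂)` has simple zeros
at `(1, 0)`, `(1, 1)` and `(0, 1)`. -/
structure IsCubicPair {Y : Submodule k (Matrix (Fin 3) (Fin 3) D)} {G₁ : Type*} [Group G₁]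
    (ρ : Representation k G₁ Y) (F : Y × Y → BinaryCubic k) (T P : Subgroup G₁) (θ η : G₁)
    (Sing : Set Y) (δ : k → k → k → Y) : Prop where
  coe_diag : ∀ a b c, (δ a b c).1 =
    Matrix.diagonal ![algebraMap k D a, algebraMap k D b, algebraMap k D c]
  eval_eq_zero : ∀ x r, eval r (F x).1 = 0 ↔ r 0 • x.1 + r 1 • x.2 ∈ Sing
  sing_iff : ∀ g y, ρ g y ∈ Sing ↔ y ∈ Sing
  form_ne_zero : ∀ g x, (F x).1 ≠ 0 → (F (ρ g x.1, ρ g x.2)).1 ≠ 0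
  form_subst : ∀ (h : Matrix (Fin 2) (Fin 2) k) x,
    (F (h 0 0 • x.1 + h 0 1 • x.2, h 1 0 • x.1 + h 1 1 • x.2)).1 = substForm h (F x).1
  form_diag : ∀ a b c, (F (δ 0 b (-c), δ a (-b) 0)).1 = C (-(a * b * c)) * stdForm k
  exists_diag : ∀ x₁ x₂, x₁ ∈ Sing → x₂ ∈ Sing → x₁ + x₂ ∈ Sing →
    binaryCoeff 2 1 (F (x₁, x₂)).1 ≠ 0 → binaryCoeff 2 1 (F (x₁ + x₂, x₁)).1 ≠ 0 →
    binaryCoeff 2 1 (F (x₂, x₁)).1 ≠ 0 →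
    ∃ g a b c, ρ g x₁ = δ 0 b (-c) ∧ ρ g x₂ = δ a (-b) 0
  diag_of_mem : ∀ g ∈ T, ∃ l m n, ∀ a b c, ρ g (δ a b c) = δ (l * a) (m * b) (n * c)
  theta_diag : ∀ a b c, ρ θ (δ a b c) = δ c a b
  eta_diag : ∀ a b c, ρ η (δ a b c) = δ a c b
  mem_of_diag : ∀ g a b c a' b' c', a ≠ 0 → b ≠ 0 → c ≠ 0 → ρ g (δ 0 b (-c)) = δ 0 b' (-c') →
    ρ g (δ a (-b) 0) = δ a' (-b') 0 → g ∈ T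
  cross_of_mem : ∀ g ∈ P, ∀ y, FirstCrossZero y.1 → FirstCrossZero (ρ g y).1
  sing_of_cross : ∀ y, FirstCrossZero y.1 → y ∈ Sing
  mem_of_cross : ∀ g b c, b ≠ 0 → c ≠ 0 → FirstCrossZero (ρ g (δ 0 b c)).1 → g ∈ P

namespace IsCubicPair

variable {Y : Submodule k (Matrix (Fin 3) (Fin 3) D)} {G₁ : Type*} [Group G₁]
  {ρ : Representation k G₁ Y} {F : Y × Y → BinaryCubic k} {T P : Subgroup G₁} {θ η : G₁}
  {Sing : Set Y} {δ : k → k → k → Y}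

theorem diag_add (H : IsCubicPair ρ F T P θ η Sing δ) (a b c a' b' c' : k) :
    δ a b c + δ a' b' c' = δ (a + a') (b + b') (c + c') := by
  apply Subtype.ext
  rw [Submodule.coe_add, H.coe_diag, H.coe_diag, H.coe_diag, Matrix.diagonal_add]
  congr 1
  ext i; fin_cases i <;> simp

theorem smul_diag (H : IsCubicPair ρ F T P θ η Sing δ) (t a b c : k) :
    t • δ a b c = δ (t * a) (t * b) (t * c) := by
  apply Subtype.ext
  rw [Submodule.coe_smul, H.coe_diag, H.coe_diag, ← Matrix.diagonal_smul]
  congr 1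
  ext i; fin_cases i <;> simp [Algebra.smul_def]

theorem diag_zero (H : IsCubicPair ρ F T P θ η Sing δ) : δ 0 0 0 = 0 := by
  rw [← zero_smul k (δ 0 0 0), H.smul_diag]; simp

theorem mem_subspaceU (H : IsCubicPair ρ F T P θ η Sing δ) (x : Y × Y) :
    x ∈ subspaceU Y ↔ ∃ a b c, x = (δ 0 b (-c), δ a (-b) 0) := by
  refine exists_congr fun a => exists_congr fun b => exists_congr fun c => ?_
  rw [Prod.ext_iff, Subtype.ext_iff, Subtype.ext_iff, H.coe_diag, H.coe_diag]
  simp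

theorem mem_subspaceU_inter (H : IsCubicPair ρ F T P θ η Sing δ) (x : Y × Y) :
    x ∈ (subspaceU Y : Set (Y × Y)) ∩ semistable F ↔
      ∃ a b c, a ≠ 0 ∧ b ≠ 0 ∧ c ≠ 0 ∧ x = (δ 0 b (-c), δ a (-b) 0) := by
  have key : ∀ a b c, (δ 0 b (-c), δ a (-b) 0) ∈ semistable F ↔ a ≠ 0 ∧ b ≠ 0 ∧ c ≠ 0 := by
    intro a b c
    have := disc_ne_zero_iff_of_eq_stdForm (H.form_diag a b c)
    rw [semistable, Set.mem_ofPred_eq, this, neg_ne_zero, mul_ne_zero_iff, mul_ne_zero_iff, and_assoc]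
  rw [Set.mem_inter_iff, SetLike.mem_coe, H.mem_subspaceU]
  constructor
  · rintro ⟨⟨a, b, c, rfl⟩, h⟩
    obtain ⟨ha, hb, hc⟩ := (key a b c).1 h
    exact ⟨a, b, c, ha, hb, hc, rfl⟩
  · rintro ⟨a, b, c, ha, hb, hc, rfl⟩
    exact ⟨⟨a, b, c, rfl⟩, (key a b c).2 ⟨ha, hb, hc⟩⟩

theorem mem_totallySplit (x : Y × Y) : x ∈ totallySplit F ↔ HasThreeZeros (F x) :=
  (hasThreeZeros_iff (F x)).symm

theorem eval_pairRep (H : IsCubicPair ρ F T P θ η Sing δ) (g : G₁ × GL (Fin 2) k) (x : Y × Y)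
    (r : Fin 2 → k) :
    eval r (F (pairRep ρ g x)).1 = 0 ↔ eval (r ᵥ* g.2.1) (F x).1 = 0 := by
  rw [H.eval_eq_zero, H.eval_eq_zero]
  have : r 0 • (pairRep ρ g x).1 + r 1 • (pairRep ρ g x).2 =
      ρ g.1 ((r ᵥ* g.2.1) 0 • x.1 + (r ᵥ* g.2.1) 1 • x.2) := by
    change r 0 • ρ g.1 _ + r 1 • ρ g.1 _ = _
    rw [← map_smul, ← map_smul, ← map_add]
    simp only [Matrix.vecMul, dotProduct, Fin.sum_univ_two]
    congr 1
    module
  rw [this, H.sing_iff]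

theorem det2_vecMul (r s : Fin 2 → k) (h : Matrix (Fin 2) (Fin 2) k) :
    det2 (r ᵥ* h) (s ᵥ* h) = det2 r s * h.det := by
  simp [det2, Matrix.vecMul, dotProduct, Fin.sum_univ_two, Matrix.det_fin_two]
  ring

/-- The set of totally split points is stable under the group. -/
theorem totallySplit_pairRep (H : IsCubicPair ρ F T P θ η Sing δ) (g : G₁ × GL (Fin 2) k)
    {x : Y × Y} (hx : x ∈ totallySplit F) : pairRep ρ g x ∈ totallySplit F := by
  rw [mem_totallySplit] at hx ⊢
  obtain ⟨h0, r, hr, hrr⟩ := hx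
  refine ⟨H.form_ne_zero g.1 (_, _) ?_, fun i => r i ᵥ* (g.2⁻¹ : GL (Fin 2) k).1, fun i => ?_,
    fun i j hij => ?_⟩
  · rw [H.form_subst]
    exact substForm_ne_zero g.2 h0
  · rw [H.eval_pairRep, Matrix.vecMul_vecMul, Units.inv_mul, Matrix.vecMul_one]
    exact hr i
  · rw [det2_vecMul]
    exact mul_ne_zero (hrr i j hij)
      ((Matrix.isUnit_iff_isUnit_det _).1 (g.2⁻¹ : GL (Fin 2) k).isUnit).ne_zero

theorem totallySplit_of_mem (H : IsCubicPair ρ F T P θ η Sing δ) {x : Y × Y}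
    (hx : x ∈ (subspaceU Y : Set (Y × Y)) ∩ semistable F) : x ∈ totallySplit F := by
  obtain ⟨a, b, c, ha, hb, hc, rfl⟩ := (H.mem_subspaceU_inter x).1 hx
  rw [mem_totallySplit]
  exact hasThreeZeros_of_eq_stdForm (by simp [ha, hb, hc]) (H.form_diag a b c)

/-- Every totally split point has a point of `U` in its orbit: `GL₂` moves the three zeros of the form
to `(1, 0)`, `(0, 1)` and `(1, 1)`, and then `G₁` diagonalizes both matrices. -/
theorem exists_pairRep_mem (H : IsCubicPair ρ F T P θ η Sing δ) {x : Y × Y}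
    (hx : x ∈ totallySplit F) :
    ∃ g, pairRep ρ g x ∈ (subspaceU Y : Set (Y × Y)) ∩ semistable F := by
  have hx' := hx
  rw [mem_totallySplit] at hx
  obtain ⟨h, c, hc, hF⟩ := hx.exists_substForm
  let y : Y × Y := (h 0 0 • x.1 + h 0 1 • x.2, h 1 0 • x.1 + h 1 1 • x.2)
  have hy : (F y).1 = C c * stdForm k := (H.form_subst h.1 x).trans hF
  have e1 := H.eval_eq_zero y ![1, 0]
  have e2 := H.eval_eq_zero y ![0, 1]
  have e3 := H.eval_eq_zero y ![1, 1]
  rw [hy] at e1 e2 e3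
  simp [stdForm] at e1 e2 e3
  have hcub : ∀ {f : MvPolynomial (Fin 2) k} {a b c d : k}, f = cubicPoly a b c d →
      binaryCoeff 2 1 f = b := by
    rintro _ a b c d rfl
    rw [binaryCoeff, coeff_cubicPoly]; simp
  obtain ⟨g, a, b, c', h1, h2⟩ := H.exists_diag y.1 y.2 e1 e2 e3 (by
      rw [hcub (a := 0) (b := c) (c := -c) (d := 0)]
      · exact hc
      · rw [hy]; simp only [stdForm, cubicPoly, C_neg, C_0]; ring) (by
      have := H.form_subst !![1, 1; 1, 0] y
      simp only [Matrix.of_apply, Matrix.cons_val', Matrix.cons_val_zero, Matrix.cons_val_one,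
        Matrix.cons_val_fin_one, one_smul, zero_smul, add_zero] at this
      rw [this, hcub (a := 0) (b := c) (c := c) (d := 0)]
      · exact hc
      · rw [hy]
        simp [stdForm, cubicPoly, substForm]; ring) (by
      have := H.form_subst !![0, 1; 1, 0] y
      simp only [Matrix.of_apply, Matrix.cons_val', Matrix.cons_val_zero, Matrix.cons_val_one,
        Matrix.cons_val_fin_one, one_smul, zero_smul, add_zero, zero_add] at this
      rw [this, hcub (a := 0) (b := -c) (c := c) (d := 0)]
      · simpa using hc
      · rw [hy]
        simp [stdForm, cubicPoly, substForm]; ring)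
  refine ⟨(g, h), ?_, (H.totallySplit_pairRep (g, h) hx').1⟩
  exact (H.mem_subspaceU _).2 ⟨a, b, c', Prod.ext h1 h2⟩

/-- The subgroup `H° 𝔖₃`. -/
abbrev stab (k : Type u) [Field k] {G₁ : Type*} [Group G₁] (T : Subgroup G₁) (θ η : G₁) :
    Subgroup (G₁ × GL (Fin 2) k) :=
  T.prod (Subgroup.center (GL (Fin 2) k)) ⊔ Subgroup.closure {(θ, theta2 k), (η, eta2 k)}

theorem pairRep_mk (g : G₁) (h : GL (Fin 2) k) (x₁ x₂ : Y) :
    pairRep ρ (g, h) (x₁, x₂) =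
      (ρ g (h.1 0 0 • x₁ + h.1 0 1 • x₂), ρ g (h.1 1 0 • x₁ + h.1 1 1 • x₂)) := rfl

theorem pairRep_theta (H : IsCubicPair ρ F T P θ η Sing δ) (a b c : k) :
    pairRep ρ (θ, theta2 k) (δ 0 b (-c), δ a (-b) 0) = (δ 0 a (-b), δ c (-a) 0) := by
  rw [pairRep_mk]
  simp [theta2, H.smul_diag, H.diag_add, H.theta_diag]

theorem pairRep_eta (H : IsCubicPair ρ F T P θ η Sing δ) (a b c : k) :
    pairRep ρ (η, eta2 k) (δ 0 b (-c), δ a (-b) 0) = (δ 0 c (-b), δ a (-c) 0) := by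
  rw [pairRep_mk]
  simp [eta2, H.smul_diag, H.diag_add, H.eta_diag]

theorem exists_scalar_of_mem_center {h : GL (Fin 2) k} (hh : h ∈ Subgroup.center (GL (Fin 2) k)) :
    ∃ t, h.1 = !![t, 0; 0, t] := by
  obtain ⟨t, ht⟩ := Matrix.GeneralLinearGroup.mem_center_iff_val_mem_range_scalar.1 hh
  exact ⟨t, by rw [← ht]; ext i j; fin_cases i <;> fin_cases j <;> simp⟩

theorem mem_center_of_eq_scalar {h : GL (Fin 2) k} {t : k} (hh : h.1 = !![t, 0; 0, t]) :
    h ∈ Subgroup.center (GL (Fin 2) k) :=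
  Matrix.GeneralLinearGroup.mem_center_iff_val_mem_range_scalar.2
    ⟨t, by rw [hh]; ext i j; fin_cases i <;> fin_cases j <;> simp⟩

/-- `H° 𝔖₃` maps `U` onto itself. -/
theorem image_subspaceU (H : IsCubicPair ρ F T P θ η Sing δ) {g : G₁ × GL (Fin 2) k}
    (hg : g ∈ stab k T θ η) :
    pairRep ρ g '' (subspaceU Y : Set (Y × Y)) = subspaceU Y := by
  let S : Subgroup (G₁ × GL (Fin 2) k) :=
    { carrier := {g | pairRep ρ g '' (subspaceU Y : Set (Y × Y)) = subspaceU Y}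
      one_mem' := by simp
      mul_mem' := by
        intro a b ha hb
        change pairRep ρ (a * b) '' _ = _
        rw [map_mul, Module.End.coe_mul, Set.image_comp, hb, ha]
      inv_mem' := by
        intro a ha
        change pairRep ρ a⁻¹ '' _ = _
        conv_lhs => rw [← show _ '' _ = _ from ha]
        rw [← Set.image_comp]
        convert! Set.image_id _
        ext1 x
        exact rep_inv_apply _ _ _ }
  change g ∈ S
  have h1 : T.prod (Subgroup.center (GL (Fin 2) k)) ≤ S := by
    have hsub : ∀ g ∈ T.prod (Subgroup.center (GL (Fin 2) k)), ∀ x ∈ subspaceU Y,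
        pairRep ρ g x ∈ subspaceU Y := by
      rintro ⟨g, h⟩ ⟨hg, hh⟩ x hx
      obtain ⟨a, b, c, rfl⟩ := (H.mem_subspaceU x).1 hx
      obtain ⟨l, m, n, hlmn⟩ := H.diag_of_mem g hg
      obtain ⟨t, ht⟩ : ∃ t, h.1 = !![t, 0; 0, t] := exists_scalar_of_mem_center hh
      rw [H.mem_subspaceU, pairRep_mk]
      exact ⟨l * (t * a), m * (t * b), n * (t * c), by simp [ht, H.smul_diag, H.diag_zero, hlmn]⟩
    intro g hg
    refine Set.Subset.antisymm (Set.image_subset_iff.2 (hsub g hg)) fun x hx => ?_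
    refine ⟨pairRep ρ g⁻¹ x, hsub _ (inv_mem hg) x hx, ?_⟩
    simpa only [inv_inv] using rep_inv_apply (pairRep ρ) g⁻¹ x
  refine (sup_le h1 ?_) hg
  rw [Subgroup.closure_le]
  rintro g (rfl | rfl)
  · refine Set.Subset.antisymm ?_ fun x hx => ?_
    · rintro _ ⟨x, hx, rfl⟩
      obtain ⟨a, b, c, rfl⟩ := (H.mem_subspaceU x).1 hx
      exact (H.mem_subspaceU _).2 ⟨c, a, b, H.pairRep_theta a b c⟩
    · obtain ⟨a, b, c, rfl⟩ := (H.mem_subspaceU x).1 hx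
      exact ⟨_, (H.mem_subspaceU _).2 ⟨b, c, a, rfl⟩, H.pairRep_theta b c a⟩
  · refine Set.Subset.antisymm ?_ fun x hx => ?_
    · rintro _ ⟨x, hx, rfl⟩
      obtain ⟨a, b, c, rfl⟩ := (H.mem_subspaceU x).1 hx
      exact (H.mem_subspaceU _).2 ⟨a, c, b, H.pairRep_eta a b c⟩
    · obtain ⟨a, b, c, rfl⟩ := (H.mem_subspaceU x).1 hx
      exact ⟨_, (H.mem_subspaceU _).2 ⟨a, c, b, rfl⟩, H.pairRep_eta a c b⟩

theorem pairRep_mem_of_stab (H : IsCubicPair ρ F T P θ η Sing δ) {g : G₁ × GL (Fin 2) k}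
    (hg : g ∈ stab k T θ η) {x : Y × Y} (hx : x ∈ (subspaceU Y : Set (Y × Y)) ∩ semistable F) :
    pairRep ρ g x ∈ (subspaceU Y : Set (Y × Y)) ∩ semistable F := by
  refine ⟨?_, (H.totallySplit_pairRep g (H.totallySplit_of_mem hx)).1⟩
  rw [← H.image_subspaceU hg]
  exact Set.mem_image_of_mem _ hx.1

theorem theta_mem : (θ, theta2 k) ∈ stab k T θ η :=
  (le_sup_right : _ ≤ stab k T θ η) (Subgroup.subset_closure (.inl rfl))

theorem eta_mem : (η, eta2 k) ∈ stab k T θ η :=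
  (le_sup_right : _ ≤ stab k T θ η) (Subgroup.subset_closure (.inr rfl))

/-- The zeros of the form of a point of `U` are the lines of `(1, 0)`, `(0, 1)` and `(1, 1)`. -/
theorem eval_pairRep_diag (H : IsCubicPair ρ F T P θ η Sing δ) {a b c : k} (ha : a ≠ 0)
    (hb : b ≠ 0) (hc : c ≠ 0) (g : G₁ × GL (Fin 2) k) (r : Fin 2 → k) :
    eval r (F (pairRep ρ g (δ 0 b (-c), δ a (-b) 0))).1 = 0 ↔
      ((r ᵥ* g.2.1) 0 = 0 ∨ (r ᵥ* g.2.1) 1 = 0) ∨ (r ᵥ* g.2.1) 0 - (r ᵥ* g.2.1) 1 = 0 := by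
  rw [H.eval_pairRep, H.form_diag]
  simp [stdForm, ha, hb, hc]

/-- An element of the group with scalar second component that maps a point of `U` into `U` has a
diagonal first component. -/
theorem mem_stab_of_scalar (H : IsCubicPair ρ F T P θ η Sing δ) {x : Y × Y}
    (hx : x ∈ (subspaceU Y : Set (Y × Y)) ∩ semistable F) {g : G₁ × GL (Fin 2) k}
    (hgx : pairRep ρ g x ∈ (subspaceU Y : Set (Y × Y)) ∩ semistable F) {t : k}
    (ht : g.2.1 = !![t, 0; 0, t]) : g ∈ stab k T θ η := by
  obtain ⟨g, h⟩ := g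
  obtain ⟨a, b, c, ha, hb, hc, rfl⟩ := (H.mem_subspaceU_inter x).1 hx
  obtain ⟨a', b', c', ha', hb', hc', h'⟩ := (H.mem_subspaceU_inter _).1 hgx
  have ht0 : t ≠ 0 := by
    rintro rfl
    have := ((Matrix.isUnit_iff_isUnit_det _).1 h.isUnit).ne_zero
    change h.1 = _ at ht
    rw [ht] at this
    simp at this
  change h.1 = _ at ht
  rw [pairRep_mk, ht] at h'
  simp [H.smul_diag, H.diag_zero] at h'
  refine (le_sup_left : _ ≤ stab k T θ η) ⟨?_, mem_center_of_eq_scalar ht⟩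
  exact H.mem_of_diag g (t * a) (t * b) (t * c) a' b' c' (mul_ne_zero ht0 ha) (mul_ne_zero ht0 hb)
    (mul_ne_zero ht0 hc) h'.1 h'.2

/-- An element of the group that maps a point of `U` to a point of `U` lies in `H° 𝔖₃`: its second
component permutes the lines of `(1, 0)`, `(0, 1)` and `(1, 1)`, and it becomes scalar after a
multiplication by an element generated by `θ₂` and `η₂`. -/
theorem mem_stab_of_mem (H : IsCubicPair ρ F T P θ η Sing δ) {x : Y × Y}
    (hx : x ∈ (subspaceU Y : Set (Y × Y)) ∩ semistable F) (g : G₁ × GL (Fin 2) k)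
    (hgx : pairRep ρ g x ∈ (subspaceU Y : Set (Y × Y)) ∩ semistable F) :
    g ∈ stab k T θ η := by
  -- `r ↦ r g₂` maps the zeros of the form of `g x` to those of the form of `x`.
  have lines : ∀ g : G₁ × GL (Fin 2) k,
      pairRep ρ g x ∈ (subspaceU Y : Set (Y × Y)) ∩ semistable F → ∀ r : Fin 2 → k,
      (r 0 = 0 ∨ r 1 = 0) ∨ r 0 - r 1 = 0 →
      ((r ᵥ* g.2.1) 0 = 0 ∨ (r ᵥ* g.2.1) 1 = 0) ∨ (r ᵥ* g.2.1) 0 - (r ᵥ* g.2.1) 1 = 0 := by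
    intro g hgx r hr
    obtain ⟨a, b, c, ha, hb, hc, rfl⟩ := (H.mem_subspaceU_inter x).1 hx
    obtain ⟨a', b', c', ha', hb', hc', h'⟩ := (H.mem_subspaceU_inter _).1 hgx
    rw [← H.eval_pairRep_diag ha hb hc, h']
    have := H.eval_pairRep_diag ha' hb' hc' 1 r
    rw [map_one, Module.End.one_apply] at this
    rw [this]
    simpa using hr
  have lines' : ∀ g : G₁ × GL (Fin 2) k,
      pairRep ρ g x ∈ (subspaceU Y : Set (Y × Y)) ∩ semistable F →
      ((g.2.1 0 0 = 0 ∨ g.2.1 0 1 = 0) ∨ g.2.1 0 0 - g.2.1 0 1 = 0) ∧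
      ((g.2.1 1 0 = 0 ∨ g.2.1 1 1 = 0) ∨ g.2.1 1 0 - g.2.1 1 1 = 0) ∧
      ((g.2.1 0 0 + g.2.1 1 0 = 0 ∨ g.2.1 0 1 + g.2.1 1 1 = 0) ∨
        g.2.1 0 0 + g.2.1 1 0 - (g.2.1 0 1 + g.2.1 1 1) = 0) ∧
      g.2.1 0 0 * g.2.1 1 1 - g.2.1 0 1 * g.2.1 1 0 ≠ 0 := by
    intro g hgx
    refine ⟨?_, ?_, ?_, ?_⟩
    · simpa [Matrix.vecMul, dotProduct] using lines g hgx ![1, 0] (by simp)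
    · simpa [Matrix.vecMul, dotProduct] using lines g hgx ![0, 1] (by simp)
    · simpa [Matrix.vecMul, dotProduct] using lines g hgx ![1, 1] (by simp)
    · rw [← Matrix.det_fin_two]
      exact ((Matrix.isUnit_iff_isUnit_det _).1 g.2.isUnit).ne_zero
  have hmul : ∀ h ∈ stab k T θ η, pairRep ρ (h * g) x ∈
      (subspaceU Y : Set (Y × Y)) ∩ semistable F := by
    intro h hh
    rw [map_mul, Module.End.mul_apply]
    exact H.pairRep_mem_of_stab hh hgx
  have lower : ∀ g : G₁ × GL (Fin 2) k, pairRep ρ g x ∈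
      (subspaceU Y : Set (Y × Y)) ∩ semistable F → g.2.1 0 1 = 0 → g ∈ stab k T θ η := by
    intro g hgx h0
    obtain ⟨-, h2, h3, h4⟩ := lines' g hgx
    have e := Matrix.eta_fin_two g.2.1
    rw [h0] at h3 h4 e
    generalize g.2.1 0 0 = p, g.2.1 1 0 = r, g.2.1 1 1 = s at h2 h3 h4 e
    have hp : p ≠ 0 := by rintro rfl; simp at h4
    have hs : s ≠ 0 := by rintro rfl; simp at h4
    by_cases hr : r = 0
    · subst hr
      have : p = s := by simpa [hp, hs, sub_eq_zero] using h3
      exact H.mem_stab_of_scalar hx hgx (t := p) (by rw [e, this])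
    · have hrs : r = s := by simpa [hr, hs, sub_eq_zero] using h2
      subst hrs
      have hpr : p = -r := by
        simp [hr, hp] at h3
        linear_combination h3
      subst hpr
      have : (η, eta2 k) * g ∈ stab k T θ η := by
        refine H.mem_stab_of_scalar hx (t := r) ?_ ?_
        · rw [map_mul, Module.End.mul_apply]
          exact H.pairRep_mem_of_stab eta_mem hgx
        · change (eta2 k).1 * g.2.1 = _
          rw [e]
          simp [eta2]
      exact (Subgroup.mul_mem_cancel_left _ eta_mem).1 this
  obtain ⟨h1, h2, h3, h4⟩ := lines' g hgx
  have hcases : g.2.1 0 1 = 0 ∨ g.2.1 1 1 = 0 ∨ g.2.1 0 1 + g.2.1 1 1 = 0 := by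
    generalize g.2.1 0 0 = p, g.2.1 0 1 = q, g.2.1 1 0 = r, g.2.1 1 1 = s at h1 h2 h3 h4
    by_contra! hcon
    obtain ⟨hq, hs, hqs⟩ := hcon
    simp only [hq, hs, hqs, or_false, sub_eq_zero] at h1 h2 h3
    rcases h1 with rfl | rfl <;> rcases h2 with rfl | rfl <;> simp_all
  rcases hcases with h | h | h
  · exact lower g hgx h
  · have := lower ((θ, theta2 k) * g) (hmul _ theta_mem) (by
      change ((theta2 k).1 * g.2.1) 0 1 = 0
      simpa [theta2, Matrix.mul_apply] using h)
    exact (Subgroup.mul_mem_cancel_left _ theta_mem).1 this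
  · have hθ : (θ, theta2 k) * (θ, theta2 k) ∈ stab k T θ η := mul_mem theta_mem theta_mem
    have := lower ((θ, theta2 k) * (θ, theta2 k) * g) (hmul _ hθ) (by
      change ((theta2 k).1 * (theta2 k).1 * g.2.1) 0 1 = 0
      simp [theta2, Matrix.mul_apply]
      linear_combination -h)
    exact (Subgroup.mul_mem_cancel_left _ hθ).1 this

/-- The decomposition of the set of totally split points. -/
theorem isContractedProduct_top (H : IsCubicPair ρ F T P θ η Sing δ) :
    IsContractedProduct (pairRep ρ) ⊤ (stab k T θ η) (subspaceU Y ∩ semistable F)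
      (totallySplit F) := by
  refine isContractedProduct_of le_top (fun h hh s hs => H.pairRep_mem_of_stab hh hs)
    (fun g _ s hs hgs => H.mem_stab_of_mem hs g hgs)
    (fun a _ s hs => H.totallySplit_pairRep a (H.totallySplit_of_mem hs)) fun x hx => ?_
  obtain ⟨g, hg⟩ := H.exists_pairRep_mem hx
  exact ⟨g⁻¹, trivial, _, hg, rep_inv_apply _ _ _⟩

theorem mem_B2_iff (h : GL (Fin 2) k) : h ∈ B2 k ↔ h.1 0 1 = 0 := by
  change (∀ i j, ¬ j ≤ i → h.1 i j = 0) ↔ _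
  simp [Fin.forall_fin_two]

/-- For a point of `W`, the vector `(1, 0)` is a zero of the form. Hence an element of the group that
maps a point of `U` to it can be changed by `𝔖₃` so that its second component is lower triangular;
then its first component maps a matrix `diag(0, b, c)` with `b c ≠ 0` to one with zero first row and
column, and this puts it into `P`. -/
theorem isContractedProduct_parabolic (H : IsCubicPair ρ F T P θ η Sing δ) :
    IsContractedProduct (pairRep ρ) (P.prod (B2 k)) (stab k T θ η ⊓ P.prod (B2 k))
      (subspaceU Y ∩ semistable F) (subspaceW Y ∩ totallySplit F) := by
  refine isContractedProduct_of inf_le_right (fun h hh s hs => H.pairRep_mem_of_stab hh.1 hs)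
    (fun g hg s hs hgs => ⟨H.mem_stab_of_mem hs g hgs, hg⟩) ?_ ?_
  · rintro ⟨g, h⟩ ⟨hg, hh⟩ x hx
    refine ⟨?_, H.totallySplit_pairRep _ (H.totallySplit_of_mem hx)⟩
    obtain ⟨a, b, c, ha, hb, hc, rfl⟩ := (H.mem_subspaceU_inter x).1 hx
    rw [pairRep_mk, (mem_B2_iff h).1 hh, zero_smul, add_zero, H.smul_diag]
    refine H.cross_of_mem g hg _ fun i => ?_
    rw [H.coe_diag]
    fin_cases i <;> simp
  · rintro x ⟨hxW, hx⟩
    obtain ⟨g, hg⟩ := H.exists_pairRep_mem hx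
    have hxg := rep_inv_apply (pairRep ρ) g x
    generalize pairRep ρ g x = u at hg hxg
    generalize g⁻¹ = g at hxg
    have hS : eval ![1, 0] (F x).1 = 0 := by
      rw [H.eval_eq_zero]
      refine H.sing_of_cross _ fun i => ?_
      simpa using hxW i
    -- It suffices to make the matrix in `GL₂` lower triangular.
    have key : ∀ h ∈ stab k T θ η, (g * h).2.1 0 1 = 0 → ∃ a ∈ P.prod (B2 k),
        ∃ s ∈ (subspaceU Y : Set (Y × Y)) ∩ semistable F, pairRep ρ a s = x := by
      intro h hh h0
      have hmem := H.pairRep_mem_of_stab (inv_mem hh) hg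
      have heq : pairRep ρ (g * h) (pairRep ρ h⁻¹ u) = x := by
        rw [← Module.End.mul_apply, ← map_mul, mul_inv_cancel_right, hxg]
      refine ⟨g * h, ⟨?_, (mem_B2_iff _).2 h0⟩, _, hmem, heq⟩
      obtain ⟨a, b, c, ha, hb, hc, h'⟩ := (H.mem_subspaceU_inter _).1 hmem
      have hne : (g * h).2.1 0 0 ≠ 0 := by
        intro h00
        have := ((Matrix.isUnit_iff_isUnit_det _).1 (g * h).2.isUnit).ne_zero
        rw [Matrix.det_fin_two, h0, h00] at this
        simp at this
      refine H.mem_of_cross _ ((g * h).2.1 0 0 * b) ((g * h).2.1 0 0 * -c) (mul_ne_zero hne hb)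
        (mul_ne_zero hne (neg_ne_zero.2 hc)) ?_
      have h1 := congrArg Prod.fst heq
      rw [h', pairRep_mk, h0, zero_smul, add_zero, H.smul_diag, mul_zero] at h1
      have h2 : ρ (g * h).1 (δ 0 ((g * h).2.1 0 0 * b) ((g * h).2.1 0 0 * -c)) = x.1 := h1
      rw [h2]
      exact hxW
    rw [← hxg] at hS
    obtain ⟨a, b, c, ha, hb, hc, h'⟩ := (H.mem_subspaceU_inter _).1 hg
    rw [h', H.eval_pairRep_diag ha hb hc] at hS
    simp only [Matrix.vecMul, dotProduct, Fin.sum_univ_two, Matrix.cons_val_zero, one_mul,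
      Matrix.cons_val_one, zero_mul, add_zero] at hS
    rcases hS with (h | h) | h
    · refine key ((θ, theta2 k) * (θ, theta2 k)) (mul_mem theta_mem theta_mem) ?_
      change (g.2.1 * ((theta2 k).1 * (theta2 k).1)) 0 1 = 0
      simpa [theta2, Matrix.mul_apply, Fin.sum_univ_two] using h
    · exact key 1 (one_mem _) (by rw [mul_one]; exact h)
    · refine key (θ, theta2 k) theta_mem ?_
      change (g.2.1 * (theta2 k).1) 0 1 = 0
      simp [theta2, Matrix.mul_apply, Fin.sum_univ_two]
      linear_combination h

end IsCubicPair
end Skeleton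

/-! ### Hermitian `3 × 3` matrices over an algebra with a quadratic involution -/

section QuadraticInvolution

/-- An involution `star` of an `R`-algebra `D` with reduced norm `nm x = x x* = x* x` and reduced
trace `tr x = x + x*` in `R`. -/
structure IsQuadraticInvolution {R : Type u} {D : Type v} [CommRing R] [Ring D] [Algebra R D]
    [StarRing D] (nm tr : D → R) : Prop where
  algebraMap_injective : Function.Injective (algebraMap R D)
  star_algebraMap : ∀ t : R, star (algebraMap R D t) = algebraMap R D t
  mul_star : ∀ x : D, x * star x = algebraMap R D (nm x)
  star_mul : ∀ x : D, star x * x = algebraMap R D (nm x)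
  add_star : ∀ x : D, x + star x = algebraMap R D (tr x)

namespace IsQuadraticInvolution

variable {R : Type u} {D : Type v} [CommRing R] [Ring D] [Algebra R D] [StarRing D]
  {nm tr : D → R}

theorem star_smul (h : IsQuadraticInvolution nm tr) (t : R) (x : D) :
    star (t • x) = t • star x := by
  rw [Algebra.smul_def, Algebra.smul_def, StarMul.star_mul, h.star_algebraMap, Algebra.commutes]

theorem smul_one_injective (h : IsQuadraticInvolution nm tr) {s t : R}
    (hst : s • (1 : D) = t • (1 : D)) : s = t :=
  h.algebraMap_injective (by rwa [Algebra.algebraMap_eq_smul_one, Algebra.algebraMap_eq_smul_one])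

theorem mul_star' (h : IsQuadraticInvolution nm tr) (x : D) : x * star x = nm x • (1 : D) := by
  rw [h.mul_star, Algebra.algebraMap_eq_smul_one]

theorem star_mul' (h : IsQuadraticInvolution nm tr) (x : D) : star x * x = nm x • (1 : D) := by
  rw [h.star_mul, Algebra.algebraMap_eq_smul_one]

theorem mul_star_mul (h : IsQuadraticInvolution nm tr) (x z : D) :
    x * (star x * z) = nm x • z := by
  rw [← mul_assoc, h.mul_star', smul_one_mul]

theorem star_mul_mul (h : IsQuadraticInvolution nm tr) (x z : D) :
    star x * (x * z) = nm x • z := by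
  rw [← mul_assoc, h.star_mul', smul_one_mul]

theorem tr_smul_one (h : IsQuadraticInvolution nm tr) (x : D) :
    tr x • (1 : D) = x + star x := by
  rw [h.add_star, Algebra.algebraMap_eq_smul_one]

theorem tr_smul (h : IsQuadraticInvolution nm tr) (x z : D) :
    tr x • z = x * z + star x * z := by
  rw [← add_mul, h.add_star, Algebra.smul_def]

theorem tr_smul' (h : IsQuadraticInvolution nm tr) (x z : D) :
    tr x • z = z * x + z * star x := by
  rw [← mul_add, h.add_star, Algebra.smul_def, Algebra.commutes]

theorem tr_star (h : IsQuadraticInvolution nm tr) (x : D) : tr (star x) = tr x :=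
  h.smul_one_injective (by rw [h.tr_smul_one, h.tr_smul_one, star_star, add_comm])

theorem nm_add (h : IsQuadraticInvolution nm tr) (x y : D) :
    nm (x + y) = nm x + nm y + tr (x * star y) := by
  refine h.smul_one_injective ?_
  rw [add_smul, add_smul, ← h.mul_star', ← h.mul_star', ← h.mul_star', h.tr_smul_one]
  simp only [star_add, StarMul.star_mul, star_star, add_mul, mul_add]
  abel

theorem nm_add' (h : IsQuadraticInvolution nm tr) (x y : D) :
    nm (x + y) = nm x + nm y + tr (star x * y) := by
  refine h.smul_one_injective ?_
  rw [add_smul, add_smul, ← h.star_mul', ← h.star_mul', ← h.star_mul', h.tr_smul_one]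
  simp only [star_add, StarMul.star_mul, star_star, add_mul, mul_add]
  abel

theorem tr_mul_star (h : IsQuadraticInvolution nm tr) (x y : D) :
    tr (x * star y) = tr (star x * y) := by
  have := (h.nm_add x y).symm.trans (h.nm_add' x y)
  exact add_left_cancel this

theorem tr_mul_comm (h : IsQuadraticInvolution nm tr) (x y : D) : tr (x * y) = tr (y * x) := by
  have h1 := h.tr_mul_star x (star y)
  rw [star_star] at h1
  rw [h1, ← h.tr_star, StarMul.star_mul, star_star, star_star]

theorem nm_mul (h : IsQuadraticInvolution nm tr) (x y : D) : nm (x * y) = nm x * nm y := by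
  refine h.smul_one_injective ?_
  rw [← h.mul_star', StarMul.star_mul, mul_assoc, h.mul_star_mul, mul_smul_comm, h.mul_star', smul_smul,
    mul_comm]

theorem nm_star (h : IsQuadraticInvolution nm tr) (x : D) : nm (star x) = nm x :=
  h.smul_one_injective (by rw [← h.mul_star', star_star, h.star_mul'])

theorem nm_smul (h : IsQuadraticInvolution nm tr) (t : R) (x : D) : nm (t • x) = t ^ 2 * nm x := by
  refine h.smul_one_injective ?_
  rw [← h.mul_star', h.star_smul, smul_mul_smul_comm, h.mul_star', smul_smul, sq]

theorem tr_smul_apply (h : IsQuadraticInvolution nm tr) (t : R) (x : D) :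
    tr (t • x) = t * tr x := by
  refine h.smul_one_injective ?_
  rw [h.tr_smul_one, mul_smul, h.tr_smul_one, h.star_smul, smul_add]

theorem tr_add (h : IsQuadraticInvolution nm tr) (x y : D) : tr (x + y) = tr x + tr y := by
  refine h.smul_one_injective ?_
  rw [add_smul, h.tr_smul_one, h.tr_smul_one, h.tr_smul_one, star_add]; abel

theorem tr_neg (h : IsQuadraticInvolution nm tr) (x : D) : tr (-x) = -tr x := by
  refine h.smul_one_injective ?_
  rw [neg_smul, h.tr_smul_one, h.tr_smul_one, star_neg]; abel

theorem tr_sub (h : IsQuadraticInvolution nm tr) (x y : D) : tr (x - y) = tr x - tr y := by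
  rw [sub_eq_add_neg, h.tr_add, h.tr_neg, sub_eq_add_neg]

theorem nm_neg (h : IsQuadraticInvolution nm tr) (x : D) : nm (-x) = nm x := by
  refine h.smul_one_injective ?_
  rw [← h.mul_star', ← h.mul_star', star_neg, neg_mul_neg]

theorem nm_sub (h : IsQuadraticInvolution nm tr) (x y : D) :
    nm (x - y) = nm x + nm y - tr (x * star y) := by
  rw [sub_eq_add_neg, h.nm_add, h.nm_neg, star_neg, mul_neg, h.tr_neg, sub_eq_add_neg]

theorem tr_zero (h : IsQuadraticInvolution nm tr) : tr 0 = 0 :=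
  h.smul_one_injective (by rw [h.tr_smul_one]; simp)

theorem nm_zero (h : IsQuadraticInvolution nm tr) : nm 0 = 0 :=
  h.smul_one_injective (by rw [← h.mul_star']; simp)

end IsQuadraticInvolution

/-- The entries of a Hermitian `3 × 3` matrix `(a, p, q; p*, b, r; q*, r*, c)` with diagonal entries
in `R`. -/
@[ext] structure HermData (R : Type u) (D : Type v) where
  (a b c : R)
  (p q r : D)

namespace HermData

variable {R : Type u} {D : Type v} [CommRing R] [Ring D] [Algebra R D] [StarRing D]
  (nm tr : D → R)

/-- The Hermitian matrix with the given entries. -/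
def toMatrix (y : HermData R D) : Matrix (Fin 3) (Fin 3) D :=
  !![y.a • (1 : D), y.p, y.q; star y.p, y.b • (1 : D), y.r; star y.q, star y.r, y.c • (1 : D)]

/-- The cubic norm. -/
def norm (y : HermData R D) : R :=
  y.a * y.b * y.c + tr (y.p * (y.r * star y.q)) - y.a * nm y.r - y.b * nm y.q - y.c * nm y.p

/-- The adjoint of a Hermitian matrix, a quadratic map. -/
def adj (y : HermData R D) : HermData R D where
  a := y.b * y.c - nm y.r
  b := y.a * y.c - nm y.q
  c := y.a * y.b - nm y.p
  p := y.q * star y.r - y.c • y.p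
  q := y.p * y.r - y.b • y.q
  r := star y.p * y.q - y.a • y.r

/-- The trace form of Hermitian matrices. -/
def pairing (y z : HermData R D) : R :=
  y.a * z.a + y.b * z.b + y.c * z.c + tr (y.p * star z.p) + tr (y.q * star z.q)
    + tr (y.r * star z.r)

variable {nm tr}

theorem conjTranspose_toMatrix (h : IsQuadraticInvolution nm tr) (y : HermData R D) :
    y.toMatrixᴴ = y.toMatrix := by
  ext i j
  fin_cases i <;> fin_cases j <;> simp [toMatrix, h.star_smul]

theorem tr_cyclic_p (h : IsQuadraticInvolution nm tr) (p q r : D) :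
    tr (star p * (q * star r)) = tr (p * (r * star q)) := by
  rw [← h.tr_star (p * (r * star q)), h.tr_mul_comm]
  simp only [StarMul.star_mul, star_star, mul_assoc]

theorem tr_cyclic_q (h : IsQuadraticInvolution nm tr) (p q r : D) :
    tr (star q * (p * r)) = tr (p * (r * star q)) := by
  rw [h.tr_mul_comm, mul_assoc]

theorem tr_cyclic_r (h : IsQuadraticInvolution nm tr) (p q r : D) :
    tr (r * (star q * p)) = tr (p * (r * star q)) := by
  rw [← mul_assoc, h.tr_mul_comm]

theorem tr_cyclic_star (h : IsQuadraticInvolution nm tr) (p q r : D) :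
    tr (q * (star r * star p)) = tr (p * (r * star q)) := by
  rw [← h.tr_star (p * (r * star q))]
  simp only [StarMul.star_mul, star_star, mul_assoc]

/-- The adjoint is a norm multiple of the inverse matrix. -/
theorem toMatrix_mul_adj (h : IsQuadraticInvolution nm tr) (y : HermData R D) :
    y.toMatrix * (y.adj nm).toMatrix = y.norm nm tr • (1 : Matrix (Fin 3) (Fin 3) D) := by
  have e0 := h.tr_smul_one (y.p * (y.r * star y.q))
  have e1 := h.tr_smul_one (star y.p * (y.q * star y.r))
  have e2 := h.tr_smul_one (star y.q * (y.p * y.r))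
  rw [tr_cyclic_p h] at e1
  rw [tr_cyclic_q h] at e2
  ext i j
  fin_cases i <;> fin_cases j <;>
    simp only [Matrix.mul_apply, Fin.sum_univ_three, toMatrix, adj, norm, Matrix.of_apply,
      Matrix.cons_val', Matrix.cons_val_zero, Matrix.cons_val_one, Matrix.cons_val,
      Matrix.cons_val_fin_one, Fin.zero_eta, Fin.mk_one, Fin.reduceFinMk, Fin.isValue,
      Matrix.smul_apply, Matrix.one_apply_eq, ne_eq, zero_ne_one, one_ne_zero, not_false_eq_true,
      Matrix.one_apply_ne, Fin.reduceEq, star_sub, StarMul.star_mul, star_star, h.star_smul, mul_sub,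
      mul_smul_comm, smul_mul_assoc, one_mul, mul_one, mul_assoc, h.mul_star', h.star_mul',
      h.mul_star_mul, h.star_mul_mul, sub_smul, add_smul, smul_zero] at e0 e1 e2 ⊢
  · rw [e0]; module
  · module
  · module
  · module
  · rw [e1]; module
  · module
  · module
  · module
  · rw [e2]; module

theorem adj_adj (h : IsQuadraticInvolution nm tr) (y : HermData R D) :
    (y.adj nm).adj nm = ⟨y.norm nm tr * y.a, y.norm nm tr * y.b, y.norm nm tr * y.c,
      y.norm nm tr • y.p, y.norm nm tr • y.q, y.norm nm tr • y.r⟩ := by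
  ext1
  iterate 3
    simp only [adj, norm, h.nm_sub, h.nm_mul, h.nm_star, h.nm_smul, h.star_smul, mul_smul_comm,
      h.tr_smul_apply, mul_assoc, tr_cyclic_p h, tr_cyclic_star h]
    ring
  iterate 2
    simp only [adj, norm, sub_smul, add_smul, mul_smul, h.tr_smul, mul_assoc, sub_mul, mul_sub,
      star_sub, h.star_smul, StarMul.star_mul, star_star, smul_mul_assoc, mul_smul_comm,
      h.mul_star', h.star_mul', h.mul_star_mul, h.star_mul_mul, mul_one]
    module
  · simp only [adj, norm, ← tr_cyclic_r h, sub_smul, add_smul, mul_smul, h.tr_smul, mul_assoc,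
      sub_mul, mul_sub, star_sub, h.star_smul, StarMul.star_mul, star_star, smul_mul_assoc,
      mul_smul_comm, h.mul_star', h.star_mul', h.mul_star_mul, h.star_mul_mul, mul_one]
    module

/-- A Hermitian matrix `z` with vanishing adjoint has rank one, in the sense that `z y z` is the
multiple `T(z, y) z` of `z` for every Hermitian matrix `y`. -/
theorem mul_mul_eq_pairing_smul (h : IsQuadraticInvolution nm tr) {z : HermData R D}
    (hz : z.adj nm = ⟨0, 0, 0, 0, 0, 0⟩) (y : HermData R D) :
    z.toMatrix * (y.toMatrix * z.toMatrix) = z.pairing tr y • z.toMatrix := by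
  simp only [adj, HermData.mk.injEq, sub_eq_zero] at hz
  obtain ⟨ha, hb, hc, hp, hq, hr⟩ := hz
  have hp' : z.r * star z.q = z.c • star z.p := by
    rw [← h.star_smul, ← hp, StarMul.star_mul, star_star]
  have hq' : star z.r * star z.p = z.b • star z.q := by
    rw [← h.star_smul, ← hq, StarMul.star_mul]
  have hr' : star z.q * z.p = z.a • star z.r := by
    rw [← h.star_smul, ← hr, StarMul.star_mul, star_star]
  have hpm : ∀ x, z.q * (star z.r * x) = z.c • (z.p * x) := fun x => by
    rw [← mul_assoc, hp, smul_mul_assoc]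
  have hqm : ∀ x, z.p * (z.r * x) = z.b • (z.q * x) := fun x => by
    rw [← mul_assoc, hq, smul_mul_assoc]
  have hpm' : ∀ x, z.r * (star z.q * x) = z.c • (star z.p * x) := fun x => by
    rw [← mul_assoc, hp', smul_mul_assoc]
  -- The traces that occur in the diagonal entries, multiplied by the diagonal entries of `z`.
  have t00 : (z.a * tr (z.r * star y.r)) • (1 : D) =
      z.p * (y.r * star z.q) + z.q * (star y.r * star z.p) := by
    have := h.tr_smul_one (z.p * (y.r * star z.q))
    rw [← tr_cyclic_r h, hr', mul_smul_comm, h.tr_smul_apply, h.tr_mul_comm, ← h.tr_star] at this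
    simpa only [StarMul.star_mul, star_star, mul_assoc, h.tr_mul_comm _ (star z.r), ← h.tr_mul_star]
      using this
  have t11 : (z.b * tr (z.q * star y.q)) • (1 : D) =
      star z.p * (y.q * star z.r) + z.r * (star y.q * z.p) := by
    have := h.tr_smul_one (star z.p * (y.q * star z.r))
    rw [h.tr_mul_comm, mul_assoc, hq', mul_smul_comm, h.tr_smul_apply, h.tr_mul_comm] at this
    simpa only [StarMul.star_mul, star_star, mul_assoc, ← h.tr_mul_star] using this
  have t22 : (z.c * tr (z.p * star y.p)) • (1 : D) =
      star z.q * (y.p * z.r) + star z.r * (star y.p * z.q) := by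
    have := h.tr_smul_one (star z.q * (y.p * z.r))
    rw [h.tr_mul_comm, mul_assoc, hp', mul_smul_comm, h.tr_smul_apply, h.tr_mul_comm] at this
    simpa only [StarMul.star_mul, star_star, mul_assoc, ← h.tr_mul_star] using this
  -- Both sides are Hermitian, so it suffices to compare the entries above the diagonal.
  have hM : ∀ i j, i ≤ j → (z.toMatrix * (y.toMatrix * z.toMatrix)) i j =
      (z.pairing tr y • z.toMatrix) i j := by
    -- The traces that occur in the off-diagonal entries, as sums of two products.
    have pp := h.tr_smul (z.p * star y.p) z.p
    have pq := h.tr_smul (z.p * star y.p) z.q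
    have pr := h.tr_smul (star z.p * y.p) z.r
    have qp := h.tr_smul (z.q * star y.q) z.p
    have qq := h.tr_smul (z.q * star y.q) z.q
    have qr := h.tr_smul' (star z.q * y.q) z.r
    have rp := h.tr_smul' (z.r * star y.r) z.p
    have rq := h.tr_smul' (star z.r * y.r) z.q
    have rr := h.tr_smul (z.r * star y.r) z.r
    have p0 := h.tr_smul_one (z.p * star y.p)
    have p0' := h.tr_smul_one (star z.p * y.p)
    have q0 := h.tr_smul_one (z.q * star y.q)
    have q0' := h.tr_smul_one (star z.q * y.q)
    have r0 := h.tr_smul_one (z.r * star y.r)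
    have r0' := h.tr_smul_one (star z.r * y.r)
    rw [← h.tr_mul_star] at pr qr rq p0' q0' r0'
    intro i j hij
    fin_cases i <;> fin_cases j <;> first | exact absurd hij (by decide) | skip
    all_goals
      simp only [Matrix.mul_apply, Fin.sum_univ_three, toMatrix, pairing, Matrix.of_apply,
        Matrix.cons_val', Matrix.cons_val_zero, Matrix.cons_val_one, Matrix.cons_val,
        Matrix.cons_val_fin_one, Fin.zero_eta, Fin.mk_one, Fin.reduceFinMk, Fin.isValue,
        Matrix.smul_apply, mul_add, StarMul.star_mul, star_star,
        mul_smul_comm, smul_mul_assoc, one_mul, mul_one, mul_assoc, h.mul_star', h.star_mul',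
        add_smul, hp, hq, hr, hr', hpm, hqm, hpm']
        at pp pq pr qp qq qr rp rq rr p0 p0' q0 q0' r0 r0' t00 t11 t22 ⊢
      simp only [← ha, ← hb, ← hc] at pp pq pr qp qq qr rp rq rr p0 p0' q0 q0' r0 r0' t00 t11 t22 ⊢
    · linear_combination (norm := module) -z.a • p0 - z.a • q0 - t00
    · linear_combination (norm := module) -pp - qp - rp
    · linear_combination (norm := module) -pq - qq - rq
    · linear_combination (norm := module) -z.b • p0' - z.b • r0 - t11
    · linear_combination (norm := module) -pr - qr - rr
    · linear_combination (norm := module) -z.c • q0' - z.c • r0' - t22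
  ext i j
  rcases le_total i j with hij | hij
  · exact hM i j hij
  · have h1 : (z.toMatrix * (y.toMatrix * z.toMatrix))ᴴ =
        z.toMatrix * (y.toMatrix * z.toMatrix) := by
      simp only [Matrix.conjTranspose_mul, conjTranspose_toMatrix h, mul_assoc]
    have h2 : (z.pairing tr y • z.toMatrix)ᴴ = z.pairing tr y • z.toMatrix := by
      ext i j
      rw [Matrix.conjTranspose_apply, Matrix.smul_apply, h.star_smul, Matrix.smul_apply,
        ← Matrix.conjTranspose_apply, conjTranspose_toMatrix h]
    rw [← h1, ← h2, Matrix.conjTranspose_apply, Matrix.conjTranspose_apply, hM j i hij]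

end HermData
end QuadraticInvolution

/-! ### Singular Hermitian matrices -/

section Singular

namespace HermData

variable {R : Type u} {D : Type v} [CommRing R] [Ring D] [Algebra R D] [StarRing D]
  {nm tr : D → R}

theorem adj_mul_toMatrix (h : IsQuadraticInvolution nm tr) (y : HermData R D) :
    (y.adj nm).toMatrix * y.toMatrix = y.norm nm tr • (1 : Matrix (Fin 3) (Fin 3) D) := by
  have := congrArg conjTranspose (toMatrix_mul_adj h y)
  rw [conjTranspose_mul, conjTranspose_toMatrix h, conjTranspose_toMatrix h] at this
  rw [this]
  ext i j
  rw [conjTranspose_apply, Matrix.smul_apply, h.star_smul, Matrix.smul_apply, ← conjTranspose_apply,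
    conjTranspose_one]

theorem toMatrix_injective (h : IsQuadraticInvolution nm tr) {y z : HermData R D}
    (hyz : y.toMatrix = z.toMatrix) : y = z := by
  have e : ∀ i j, y.toMatrix i j = z.toMatrix i j := fun i j => by rw [hyz]
  exact HermData.ext (h.smul_one_injective (e 0 0)) (h.smul_one_injective (e 1 1))
    (h.smul_one_injective (e 2 2)) (e 0 1) (e 0 2) (e 1 2)

theorem toMatrix_zero : (⟨0, 0, 0, 0, 0, 0⟩ : HermData R D).toMatrix = 0 := by
  ext i j; fin_cases i <;> fin_cases j <;> simp [toMatrix]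

theorem toMatrix_smul_one (t : R) :
    (⟨t, t, t, 0, 0, 0⟩ : HermData R D).toMatrix = t • (1 : Matrix (Fin 3) (Fin 3) D) := by
  ext i j; fin_cases i <;> fin_cases j <;> simp [toMatrix]

/-- A Hermitian matrix has non-zero norm if and only if it is not a left zero divisor. If the norm
vanishes and the matrix `y` is not a left zero divisor, then the adjoint vanishes, which gives
`y² = t y` with the trace `t` of `y`; hence `y = t`, and `t² = 0` as the adjoint vanishes. -/
theorem norm_ne_zero_iff [IsDomain R] [Module.IsTorsionFree R D]
    (h : IsQuadraticInvolution nm tr) (y : HermData R D) :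
    y.norm nm tr ≠ 0 ↔ ∀ w : Matrix (Fin 3) (Fin 3) D, y.toMatrix * w = 0 → w = 0 := by
  constructor
  · intro hn w hw
    have h1 : y.norm nm tr • w = 0 := by
      rw [← one_mul w, ← smul_mul_assoc, ← adj_mul_toMatrix h, mul_assoc, hw, mul_zero]
    ext i j
    have h2 := congrFun (congrFun h1 i) j
    rw [Matrix.smul_apply] at h2
    exact (smul_eq_zero.1 h2).resolve_left hn
  · intro hw hn
    have h1 : (y.adj nm).toMatrix = 0 := hw _ (by rw [toMatrix_mul_adj h, hn, zero_smul])
    have h2 : y.adj nm = ⟨0, 0, 0, 0, 0, 0⟩ := toMatrix_injective h (h1.trans toMatrix_zero.symm)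
    have h3 := mul_mul_eq_pairing_smul h h2 ⟨1, 1, 1, 0, 0, 0⟩
    rw [toMatrix_smul_one, one_smul, one_mul] at h3
    set t := pairing tr y ⟨1, 1, 1, 0, 0, 0⟩
    have h4 := hw (y.toMatrix - t • 1) (by rw [mul_sub, h3, mul_smul_comm, mul_one, sub_self])
    have h5 : y = ⟨t, t, t, 0, 0, 0⟩ := toMatrix_injective h (by
      rw [toMatrix_smul_one]; exact sub_eq_zero.1 h4)
    have h6 : t = 0 := by
      have := congrArg HermData.a h2
      rw [h5] at this
      simpa [adj, h.nm_zero] using this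
    have h7 : (1 : Matrix (Fin 3) (Fin 3) D) = 0 :=
      hw 1 (by rw [h5, h6, toMatrix_zero, zero_mul])
    have h8 := congrFun (congrFun h7 0) 0
    rw [one_apply_eq, Matrix.zero_apply] at h8
    refine one_ne_zero (h.smul_one_injective (s := (1 : R)) (t := 0) ?_)
    rw [h8, smul_zero, smul_zero]

/-- The non-vanishing of the norm is invariant under `y ↦ g y g*`. -/
theorem norm_ne_zero_of_congr [IsDomain R] [Module.IsTorsionFree R D]
    (h : IsQuadraticInvolution nm tr) {y z : HermData R D} {g g' : Matrix (Fin 3) (Fin 3) D}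
    (hg : g' * g = 1) (hg' : g * g' = 1) (hz : z.toMatrix = g * y.toMatrix * gᴴ)
    (hy : y.norm nm tr ≠ 0) : z.norm nm tr ≠ 0 := by
  rw [norm_ne_zero_iff h] at hy ⊢
  intro w hw
  rw [hz] at hw
  have h1 : gᴴ * w = 0 := hy _ (by
    rw [← one_mul (_ * _), ← hg, mul_assoc, ← mul_assoc g, ← mul_assoc (g * _), hw, mul_zero])
  rw [← one_mul w, ← conjTranspose_one, ← hg', conjTranspose_mul, mul_assoc, h1, mul_zero]

/-- The norm of a linear combination of two Hermitian matrices. -/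
theorem norm_smul_add_smul (h : IsQuadraticInvolution nm tr) (s t : R) (y z : HermData R D) :
    norm nm tr ⟨s * y.a + t * z.a, s * y.b + t * z.b, s * y.c + t * z.c, s • y.p + t • z.p,
      s • y.q + t • z.q, s • y.r + t • z.r⟩ =
    s ^ 3 * y.norm nm tr + s ^ 2 * t * (y.adj nm).pairing tr z +
      s * t ^ 2 * (z.adj nm).pairing tr y + t ^ 3 * z.norm nm tr := by
  have hs : ∀ x y : D, tr (x * star y) = tr (y * star x) := fun x y => by
    rw [← h.tr_star, StarMul.star_mul, star_star]
  simp only [norm, pairing, adj, h.nm_add, h.nm_smul, h.star_smul, star_add, add_mul, mul_add,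
    sub_mul, smul_mul_assoc, mul_smul_comm, h.tr_add, h.tr_sub, h.tr_smul_apply, mul_assoc,
    tr_cyclic_p h, tr_cyclic_star h, hs z.p y.p, hs z.q y.q, hs z.r y.r]
  ring

end HermData

end Singular

/-! ### Simultaneous diagonalization -/

section Diagonalization

namespace HermData

variable {k : Type u} {D : Type v} [Field k] [Ring D] [Algebra k D] [StarRing D]
  {nm tr : D → k}

/-- A non-zero Hermitian form represents a non-zero scalar if the trace form of the algebra is
nondegenerate. -/
theorem exists_apply_ne_zero (h : IsQuadraticInvolution nm tr)
    (hnd : ∀ x : D, x ≠ 0 → ∃ d, tr (x * d) ≠ 0) {z : HermData k D}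
    (hz : z ≠ ⟨0, 0, 0, 0, 0, 0⟩) :
    ∃ (e : Fin 3 → D) (c : k), c ≠ 0 ∧ star e ⬝ᵥ z.toMatrix *ᵥ e = algebraMap k D c := by
  by_cases ha : z.a ≠ 0
  · refine ⟨![1, 0, 0], z.a, ha, ?_⟩
    simp [toMatrix, Matrix.mulVec, dotProduct, Fin.sum_univ_three, Algebra.algebraMap_eq_smul_one]
  by_cases hb : z.b ≠ 0
  · refine ⟨![0, 1, 0], z.b, hb, ?_⟩
    simp [toMatrix, Matrix.mulVec, dotProduct, Fin.sum_univ_three, Algebra.algebraMap_eq_smul_one]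
  by_cases hc : z.c ≠ 0
  · refine ⟨![0, 0, 1], z.c, hc, ?_⟩
    simp [toMatrix, Matrix.mulVec, dotProduct, Fin.sum_univ_three, Algebra.algebraMap_eq_smul_one]
  push Not at ha hb hc
  -- All diagonal entries vanish: if the entry `x` in the place `(i, j)` does not, the vector
  -- `e_i + e_j d` has the value `x d + (x d)*`.
  by_cases hp : z.p ≠ 0
  · obtain ⟨d, hd⟩ := hnd _ hp
    refine ⟨![1, d, 0], tr (z.p * d), hd, ?_⟩
    simp [toMatrix, Matrix.mulVec, dotProduct, Fin.sum_univ_three, ← h.add_star, ha, hb]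
  by_cases hq : z.q ≠ 0
  · obtain ⟨d, hd⟩ := hnd _ hq
    refine ⟨![1, 0, d], tr (z.q * d), hd, ?_⟩
    simp [toMatrix, Matrix.mulVec, dotProduct, Fin.sum_univ_three, ← h.add_star, ha, hc]
  by_cases hr : z.r ≠ 0
  · obtain ⟨d, hd⟩ := hnd _ hr
    refine ⟨![0, 1, d], tr (z.r * d), hd, ?_⟩
    simp [toMatrix, Matrix.mulVec, dotProduct, Fin.sum_univ_three, ← h.add_star, hb, hc]
  push Not at hp hq hr
  exact absurd (HermData.ext ha hb hc hp hq hr) hz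

/-- A Hermitian matrix `y` of norm zero with non-zero adjoint `z` kills a vector on which every
Hermitian form `y'` has the value `c T(z, y')`, where `T` is the trace form and `c ≠ 0` does not
depend on `y'`: the vector is `z e`, where `e` has the value `c` for the form `z`. -/
theorem exists_kernel_vector (h : IsQuadraticInvolution nm tr)
    (hnd : ∀ x : D, x ≠ 0 → ∃ d, tr (x * d) ≠ 0) {y : HermData k D} (hy : y.norm nm tr = 0)
    (hz : y.adj nm ≠ ⟨0, 0, 0, 0, 0, 0⟩) :
    ∃ (w : Fin 3 → D) (c : k), c ≠ 0 ∧ y.toMatrix *ᵥ w = 0 ∧ ∀ y' : HermData k D,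
      star w ⬝ᵥ y'.toMatrix *ᵥ w = algebraMap k D (c * (y.adj nm).pairing tr y') := by
  obtain ⟨e, c, hc, he⟩ := exists_apply_ne_zero h hnd hz
  refine ⟨(y.adj nm).toMatrix *ᵥ e, c, hc, ?_, fun y' => ?_⟩
  · rw [mulVec_mulVec, toMatrix_mul_adj h, hy, zero_smul, zero_mulVec]
  · have h0 : (y.adj nm).adj nm = ⟨0, 0, 0, 0, 0, 0⟩ := by rw [adj_adj h, hy]; simp
    rw [star_mulVec, conjTranspose_toMatrix h, ← dotProduct_mulVec, mulVec_mulVec, mulVec_mulVec,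
      mul_assoc, mul_mul_eq_pairing_smul h h0, smul_mulVec, dotProduct_smul, he, Algebra.smul_def, ← map_mul,
      mul_comm]

theorem pairing_zero (h : IsQuadraticInvolution nm tr) (y : HermData k D) :
    pairing tr ⟨0, 0, 0, 0, 0, 0⟩ y = 0 := by
  simp [pairing, h.tr_zero]

/-- Two Hermitian matrices `y₁`, `y₂` such that `y₁`, `y₂` and `y₁ + y₂` have norm zero and such that
these three zeros are simple can be diagonalized simultaneously: the kernel vectors of `y₁`,
`y₁ + y₂` and `y₂` are orthogonal to one another for both forms. -/
theorem exists_unit_diagonal [FiniteDimensional k D] (h : IsQuadraticInvolution nm tr)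
    (hnd : ∀ x : D, x ≠ 0 → ∃ d, tr (x * d) ≠ 0) {y₁ y₂ y₃ : HermData k D}
    (h3 : y₃.toMatrix = y₁.toMatrix + y₂.toMatrix) (hn1 : y₁.norm nm tr = 0)
    (hn2 : y₂.norm nm tr = 0) (hn3 : y₃.norm nm tr = 0)
    (hp1 : (y₁.adj nm).pairing tr y₂ ≠ 0) (hp2 : (y₂.adj nm).pairing tr y₁ ≠ 0)
    (hp3 : (y₃.adj nm).pairing tr y₁ ≠ 0) :
    ∃ (g : (Matrix (Fin 3) (Fin 3) D)ˣ) (a b c : k),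
      g.1 * y₁.toMatrix * g.1ᴴ =
        diagonal ![algebraMap k D 0, algebraMap k D b, algebraMap k D (-c)] ∧
      g.1 * y₂.toMatrix * g.1ᴴ =
        diagonal ![algebraMap k D a, algebraMap k D (-b), algebraMap k D 0] := by
  obtain ⟨w1, c1, hc1, hw1, hf1⟩ := exists_kernel_vector h hnd hn1 (by
    intro h0; rw [h0, pairing_zero h] at hp1; exact hp1 rfl)
  obtain ⟨w2, c2, hc2, hw2, hf2⟩ := exists_kernel_vector h hnd hn3 (by
    intro h0; rw [h0, pairing_zero h] at hp3; exact hp3 rfl)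
  obtain ⟨w3, c3, hc3, hw3, hf3⟩ := exists_kernel_vector h hnd hn2 (by
    intro h0; rw [h0, pairing_zero h] at hp2; exact hp2 rfl)
  set b := c2 * (y₃.adj nm).pairing tr y₁ with hb
  set a := c1 * (y₁.adj nm).pairing tr y₂ with ha
  set c := -(c3 * (y₂.adj nm).pairing tr y₁) with hc
  have hb0 : b ≠ 0 := mul_ne_zero hc2 hp3
  have ha0 : a ≠ 0 := mul_ne_zero hc1 hp1
  have hcc : c ≠ 0 := neg_ne_zero.2 (mul_ne_zero hc3 hp2)
  -- The rows of `g` are the conjugates of the three vectors.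
  let v : Fin 3 → Fin 3 → D := ![w1, w2, w3]
  let g : Matrix (Fin 3) (Fin 3) D := Matrix.of fun i j => star (v i j)
  have hent : ∀ (X : Matrix (Fin 3) (Fin 3) D) i j,
      (g * X * gᴴ) i j = star (v i) ⬝ᵥ X *ᵥ v j := by
    intro X i j
    rw [mul_assoc, Matrix.mul_apply]
    refine Finset.sum_congr rfl fun l _ => ?_
    rw [Matrix.mul_apply]
    simp [g, Matrix.mulVec, dotProduct]
  have hleft : ∀ (y : HermData k D) w, y.toMatrix *ᵥ w = 0 → ∀ w',
      star w ⬝ᵥ y.toMatrix *ᵥ w' = 0 := by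
    intro y w hw w'
    rw [dotProduct_mulVec, ← conjTranspose_toMatrix h y, ← star_mulVec, hw, star_zero,
      zero_dotProduct]
  have hsum : ∀ w w', star w ⬝ᵥ y₁.toMatrix *ᵥ w' + star w ⬝ᵥ y₂.toMatrix *ᵥ w' =
      star w ⬝ᵥ y₃.toMatrix *ᵥ w' := by
    intro w w'
    rw [h3, add_mulVec, dotProduct_add]
  have h12 : ∀ w, star w2 ⬝ᵥ y₁.toMatrix *ᵥ w + star w2 ⬝ᵥ y₂.toMatrix *ᵥ w = 0 := fun w => by
    rw [hsum, hleft _ _ hw2]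
  have h21 : ∀ w, star w ⬝ᵥ y₁.toMatrix *ᵥ w2 + star w ⬝ᵥ y₂.toMatrix *ᵥ w2 = 0 := fun w => by
    rw [hsum, hw2, dotProduct_zero]
  have d1 : g * y₁.toMatrix * gᴴ =
      diagonal ![algebraMap k D 0, algebraMap k D b, algebraMap k D (-c)] := by
    ext i j
    rw [hent]
    fin_cases i <;> fin_cases j <;> simp [v, hw1, hleft _ _ hw1, hf2, hf3, hb, hc]
    · have := h12 w3; rwa [hw3, dotProduct_zero, add_zero] at this
    · have := h21 w3; rwa [hleft _ _ hw3, add_zero] at this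
  have d2 : g * y₂.toMatrix * gᴴ =
      diagonal ![algebraMap k D a, algebraMap k D (-b), algebraMap k D 0] := by
    ext i j
    rw [hent]
    fin_cases i <;> fin_cases j <;> simp [v, hw3, hleft _ _ hw3, hf1, ha]
    · have := h21 w1; rwa [hleft _ _ hw1, zero_add] at this
    · have := h12 w1; rwa [hw1, dotProduct_zero, zero_add] at this
    · have := h12 w2; rw [hf2] at this; exact eq_neg_of_add_eq_zero_right this
  -- `g` has a right inverse, hence is a unit of a finite-dimensional algebra.
  let m : Matrix (Fin 3) (Fin 3) D := y₁.toMatrix * gᴴ *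
      diagonal ![0, algebraMap k D b⁻¹, algebraMap k D (-c)⁻¹] +
    y₂.toMatrix * gᴴ * diagonal ![algebraMap k D a⁻¹, 0, 0]
  have hgm : g * m = 1 := by
    simp only [m, mul_add, ← mul_assoc, d1, d2, diagonal_mul_diagonal]
    rw [diagonal_add, ← diagonal_one]
    congr 1
    ext i
    fin_cases i
    · simpa using (map_mul (algebraMap k D) a a⁻¹).symm.trans (by simp [ha0])
    · simpa using (map_mul (algebraMap k D) b b⁻¹).symm.trans (by simp [hb0])
    · simpa using (map_mul (algebraMap k D) (-c) (-c)⁻¹).symm.trans (by simp [hcc])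
  have hmg : m * g = 1 := by
    have hinj : Function.Injective (LinearMap.mulLeft k m) := by
      intro x x' hx
      have hx' : m * x = m * x' := hx
      rw [← one_mul x, ← one_mul x', ← hgm, mul_assoc, hx', mul_assoc]
    obtain ⟨s, hs⟩ := LinearMap.injective_iff_surjective.1 hinj 1
    have hs' : m * s = 1 := hs
    have : g = s := by rw [← mul_one g, ← hs', ← mul_assoc, hgm, one_mul]
    rw [this, hs']
  exact ⟨⟨g, m, hgm, hmg⟩, a, b, c, d1, d2⟩

end HermData

end Diagonalization

/-! ### Diagonal matrices -/

section DiagonalMatrices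

variable {K : Type*} {D : Type*} [Field K] [Ring D] [Algebra K D] [FiniteDimensional K D]

theorem mem_T3_iff (g : (Matrix (Fin 3) (Fin 3) D)ˣ) :
    g ∈ T3 K D ↔ ∀ i j, i ≠ j → g.1 i j = 0 := Iff.rfl

theorem mem_P12_iff (g : (Matrix (Fin 3) (Fin 3) D)ˣ) :
    g ∈ P12 K D ↔ ∀ j, j ≠ 0 → g.1 0 j = 0 := by
  change (∀ i j, ¬(i = 0 → j = 0) → g.1 i j = 0) ↔ _
  constructor
  · exact fun h j hj => h 0 j fun h0 => hj (h0 rfl)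
  · intro h i j hij
    obtain ⟨rfl, hj⟩ := Classical.not_imp.1 hij
    exact h j hj

end DiagonalMatrices

section TwoSided

variable {k : Type u} {D : Type v} [Field k] [Ring D] [Algebra k D]

/-- The diagonal matrix with given scalar entries. -/
def scalarDiag (D : Type v) [Ring D] [Algebra k D] (a b c : k) : Matrix (Fin 3) (Fin 3) D :=
  diagonal ![algebraMap k D a, algebraMap k D b, algebraMap k D c]

theorem mul_diagonal_mul (g h : Matrix (Fin 3) (Fin 3) D) (d : Fin 3 → D)
    (hg : ∀ i j, i ≠ j → g i j = 0) (hh : ∀ i j, i ≠ j → h i j = 0) :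
    g * diagonal d * h = diagonal fun i => g i i * d i * h i i := by
  ext i j
  rw [Matrix.mul_apply, Finset.sum_eq_single i]
  · rw [mul_diagonal]
    by_cases hij : i = j
    · subst hij; rw [diagonal_apply_eq]
    · rw [hh i j hij, mul_zero, diagonal_apply_ne _ hij]
  · intro l _ hl
    rw [mul_diagonal, hg i l hl.symm, zero_mul, zero_mul]
  · exact fun hi => absurd (Finset.mem_univ i) hi

/-- A matrix `g` that takes, together with some `h`, two diagonal matrices `diag(0, b, -c)` and
`diag(a, -b, 0)` with `a b c ≠ 0` to diagonal matrices of the same form is diagonal. -/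
theorem apply_eq_zero_of_mul_scalarDiag {g h h' : Matrix (Fin 3) (Fin 3) D} (hh : h * h' = 1)
    {a b c a' b' c' : k} (ha : a ≠ 0) (hb : b ≠ 0) (hc : c ≠ 0)
    (h1 : g * scalarDiag D 0 b (-c) * h = scalarDiag D 0 b' (-c'))
    (h2 : g * scalarDiag D a (-b) 0 * h = scalarDiag D a' (-b') 0) {i j : Fin 3} (hij : i ≠ j) :
    g i j = 0 := by
  have e : ∀ {x y : Matrix (Fin 3) (Fin 3) D}, g * x * h = y → g * x = y * h' := by
    rintro x y rfl
    rw [mul_assoc, hh, mul_one]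
  have e1 : ∀ i j, g i j * ![algebraMap k D 0, algebraMap k D b, algebraMap k D (-c)] j =
      ![algebraMap k D 0, algebraMap k D b', algebraMap k D (-c')] i * h' i j := fun i j => by
    rw [← mul_diagonal, ← diagonal_mul]; exact congrFun (congrFun (e h1) i) j
  have e2 : ∀ i j, g i j * ![algebraMap k D a, algebraMap k D (-b), algebraMap k D 0] j =
      ![algebraMap k D a', algebraMap k D (-b'), algebraMap k D 0] i * h' i j := fun i j => by
    rw [← mul_diagonal, ← diagonal_mul]; exact congrFun (congrFun (e h2) i) j
  have hz : ∀ {t : k} {x : D}, t ≠ 0 → x * algebraMap k D t = 0 → x = 0 := by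
    intro t x ht hx
    rw [← mul_one x, ← map_one (algebraMap k D), ← mul_inv_cancel₀ ht, map_mul, ← mul_assoc, hx,
      zero_mul]
  have hb' := neg_ne_zero.2 hb
  have hc' := neg_ne_zero.2 hc
  fin_cases i <;> fin_cases j <;> first | exact absurd rfl hij | skip
  · exact hz hb (by simpa using e1 0 1)
  · exact hz hc' (by simpa using e1 0 2)
  · have h3 := e1 1 0
    have h4 := e2 1 0
    simp only [Fin.isValue, cons_val_zero, cons_val_one, map_zero, mul_zero, map_neg, neg_mul]
      at h3 h4
    exact hz ha (by rw [← h3, neg_zero] at h4; exact h4)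
  · have h3 := e1 1 2
    have h4 := e2 1 2
    simp only [Fin.isValue, cons_val, cons_val_one, map_zero, mul_zero, map_neg, neg_mul]
      at h3 h4
    exact hz hc' (by rw [map_neg]; rw [neg_eq_zero.1 h4.symm] at h3; exact h3)
  · exact hz ha (by simpa using e2 2 0)
  · exact hz hb' (by simpa using e2 2 1)

/-- A matrix `g` that takes, together with some `h`, a matrix `diag(0, b, c)` with `b c ≠ 0` to a
matrix with zero first row has the first row `(*, 0, 0)`. -/
theorem apply_zero_eq_zero_of_mul_scalarDiag {g h h' : Matrix (Fin 3) (Fin 3) D} (hh : h * h' = 1)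
    {b c : k} (hb : b ≠ 0) (hc : c ≠ 0) (h0 : ∀ j, (g * scalarDiag D 0 b c * h) 0 j = 0)
    {j : Fin 3} (hj : j ≠ 0) : g 0 j = 0 := by
  have e : ∀ j, g 0 j * ![algebraMap k D 0, algebraMap k D b, algebraMap k D c] j = 0 := by
    intro j
    rw [← mul_diagonal]
    change (g * scalarDiag D 0 b c) 0 j = 0
    rw [← mul_one (g * _), ← hh, ← mul_assoc, Matrix.mul_apply]
    exact Finset.sum_eq_zero fun l _ => by rw [h0, zero_mul]
  have hz : ∀ {t : k} {x : D}, t ≠ 0 → x * algebraMap k D t = 0 → x = 0 := by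
    intro t x ht hx
    rw [← mul_one x, ← map_one (algebraMap k D), ← mul_inv_cancel₀ ht, map_mul, ← mul_assoc, hx,
      zero_mul]
  fin_cases j
  · exact absurd rfl hj
  · exact hz hb (by simpa using e 1)
  · exact hz hc (by simpa using e 2)

theorem FirstCrossZero.mul_mul {y : Matrix (Fin 3) (Fin 3) D} (hy : FirstCrossZero y)
    {g h : Matrix (Fin 3) (Fin 3) D} (hg : ∀ j, j ≠ 0 → g 0 j = 0) (hh : ∀ j, j ≠ 0 → h j 0 = 0) :
    FirstCrossZero (g * y * h) := by
  intro i
  simp [Matrix.mul_apply, Fin.sum_univ_three, hg 1 (by decide), hg 2 (by decide),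
    hh 1 (by decide), hh 2 (by decide), (hy _).1, (hy _).2]

theorem theta_mul_scalarDiag (a b c : k) :
    (theta1 D).1 * scalarDiag D a b c * (theta1 D).1ᵀ = scalarDiag D c a b := by
  ext i j
  fin_cases i <;> fin_cases j <;>
    simp only [theta1, scalarDiag, Matrix.mul_apply, Fin.sum_univ_three, diagonal_apply] <;> simp

theorem eta_mul_scalarDiag (a b c : k) :
    (eta1 D).1 * scalarDiag D a b c * (eta1 D).1ᵀ = scalarDiag D a c b := by
  ext i j
  fin_cases i <;> fin_cases j <;>
    simp only [eta1, scalarDiag, Matrix.mul_apply, Fin.sum_univ_three, diagonal_apply] <;> simp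

end TwoSided

/-! ### The determinant of a matrix of linear forms -/

section Determinant

variable {R : Type u} [CommRing R]

/-- The coefficients of `det (x₁ v₁ + x₂ v₂)`. -/
theorem det_linearMatrix (x₁ x₂ : Matrix (Fin 3) (Fin 3) R) :
    (linearMatrix x₁ x₂).det = cubicPoly x₁.det (x₁.adjugate * x₂).trace
      (x₂.adjugate * x₁).trace x₂.det := by
  simp only [cubicPoly, linearMatrix, det_fin_three, adjugate_fin_three, Matrix.trace, Fin.sum_univ_three,
    Matrix.mul_apply, Matrix.of_apply, Matrix.diag, cons_val', cons_val_zero, cons_val_one, cons_val,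
    cons_val_fin_one, map_add, map_sub, map_mul, map_neg]
  ring

theorem map_eval_linearMatrix (x₁ x₂ : Matrix (Fin 3) (Fin 3) R) (r : Fin 2 → R) :
    (linearMatrix x₁ x₂).map (eval r) = r 0 • x₁ + r 1 • x₂ := by
  ext i j
  simp [linearMatrix, mul_comm]

theorem eval_det_linearMatrix (x₁ x₂ : Matrix (Fin 3) (Fin 3) R) (r : Fin 2 → R) :
    eval r (linearMatrix x₁ x₂).det = (r 0 • x₁ + r 1 • x₂).det := by
  rw [← map_eval_linearMatrix, ← RingHom.mapMatrix_apply, ← RingHom.map_det]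

theorem linearMatrix_mul_mul (g h x₁ x₂ : Matrix (Fin 3) (Fin 3) R) :
    linearMatrix (g * x₁ * h) (g * x₂ * h) = g.map C * linearMatrix x₁ x₂ * h.map C := by
  have e : ∀ x₁ x₂ : Matrix (Fin 3) (Fin 3) R, linearMatrix x₁ x₂ =
      (X 0 : MvPolynomial (Fin 2) R) • x₁.map C + (X 1 : MvPolynomial (Fin 2) R) • x₂.map C := by
    intro x₁ x₂
    ext i j
    simp [linearMatrix, mul_comm]
  rw [e, e]
  simp only [Matrix.map_mul, mul_add, add_mul, Matrix.mul_smul, Matrix.smul_mul]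

theorem det_linearMatrix_mul_mul (g h x₁ x₂ : Matrix (Fin 3) (Fin 3) R) :
    (linearMatrix (g * x₁ * h) (g * x₂ * h)).det =
      C (g.det * h.det) * (linearMatrix x₁ x₂).det := by
  rw [linearMatrix_mul_mul, det_mul, det_mul, ← RingHom.mapMatrix_apply, ← RingHom.mapMatrix_apply,
    ← RingHom.map_det, ← RingHom.map_det, map_mul]
  ring

end Determinant

/-! ### Pfaffians of Hermitian matrices of quaternions -/

section QuaternionPfaffian

theorem isQuadraticInvolution_quaternion {R : Type u} [CommRing R] (c₁ c₂ c₃ : R) :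
    IsQuadraticInvolution (R := R) (D := ℍ[R,c₁,c₂,c₃]) nrd trd where
  algebraMap_injective := fun s t hst => congrArg QuaternionAlgebra.re hst
  star_algebraMap t := by ext <;> simp
  mul_star x := QuaternionAlgebra.mul_star_eq_coe x
  star_mul x := by
    rw [QuaternionAlgebra.star_mul_eq_coe]
    ext <;> simp [nrd]; ring
  add_star x := by ext <;> simp [trd]

/-- The trace form is nondegenerate. -/
theorem exists_trd_mul_ne_zero {k : Type u} [Field k] {c₁ c₂ c₃ : k}
    (hc : c₃ * (c₂ ^ 2 + 4 * c₁) ≠ 0) (x : ℍ[k,c₁,c₂,c₃]) (hx : x ≠ 0) :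
    ∃ d, trd (x * d) ≠ 0 := by
  by_contra! h
  obtain ⟨a, b, c, d⟩ := x
  have h1 := h ⟨1, 0, 0, 0⟩
  have h2 := h ⟨0, 1, 0, 0⟩
  have h3 := h ⟨0, 0, 1, 0⟩
  have h4 := h ⟨0, 0, 0, 1⟩
  simp only [trd, QuaternionAlgebra.re_add, QuaternionAlgebra.re_star, QuaternionAlgebra.re_mul,
    QuaternionAlgebra.imI_mul] at h1 h2 h3 h4
  have hc' := hc
  rw [mul_ne_zero_iff] at hc
  apply hx
  ext
  · exact (mul_eq_zero.1 (show (c₂ ^ 2 + 4 * c₁) * a = 0 by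
      linear_combination (2 * c₁ + c₂ ^ 2) * h1 - c₂ * h2)).resolve_left hc.2
  · exact (mul_eq_zero.1 (show (c₂ ^ 2 + 4 * c₁) * b = 0 by
      linear_combination 2 * h2 - c₂ * h1)).resolve_left hc.2
  · exact (mul_eq_zero.1 (show (c₃ * (c₂ ^ 2 + 4 * c₁)) * c = 0 by
      linear_combination 2 * c₁ * h3 + c₂ * h4)).resolve_left hc'
  · exact (mul_eq_zero.1 (show (c₃ * (c₂ ^ 2 + 4 * c₁)) * d = 0 by
      linear_combination c₂ * h3 - 2 * h4)).resolve_left hc'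

variable {R : Type u} [CommRing R] {c₁ c₂ c₃ : R}

/-- The entries of a Hermitian matrix; only those on and above the diagonal, and only the scalar
parts of the diagonal ones, are read. -/
def quatData (y : Matrix (Fin 3) (Fin 3) ℍ[R,c₁,c₂,c₃]) : HermData R ℍ[R,c₁,c₂,c₃] :=
  ⟨(y 0 0).re, (y 1 1).re, (y 2 2).re, y 0 1, y 0 2, y 1 2⟩

/-- Hermitian matrices of quaternions with scalar diagonal entries. -/
def IsQuatHermitian (y : Matrix (Fin 3) (Fin 3) ℍ[R,c₁,c₂,c₃]) : Prop :=
  yᴴ = y ∧ ∀ i, ∃ t : R, y i i = algebraMap R ℍ[R,c₁,c₂,c₃] t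

theorem IsQuatHermitian.toMatrix_quatData {y : Matrix (Fin 3) (Fin 3) ℍ[R,c₁,c₂,c₃]}
    (hy : IsQuatHermitian y) : (quatData y).toMatrix = y := by
  have hd : ∀ i, (y i i).re • (1 : ℍ[R,c₁,c₂,c₃]) = y i i := fun i => by
    obtain ⟨t, ht⟩ := hy.2 i
    rw [ht, ← Algebra.algebraMap_eq_smul_one]; rfl
  have hs : ∀ i j, star (y i j) = y j i := fun i j => congrFun (congrFun hy.1 j) i
  ext1 i j
  fin_cases i <;> fin_cases j <;> simp [HermData.toMatrix, quatData, hd, hs]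

theorem IsQuatHermitian.pfaff_eq {y : Matrix (Fin 3) (Fin 3) ℍ[R,c₁,c₂,c₃]}
    (hy : IsQuatHermitian y) : pfaff y = (quatData y).norm nrd trd := by
  have hs : star (y 0 2) = y 2 0 := congrFun (congrFun hy.1 2) 0
  simp only [pfaff, HermData.norm, quatData, hs, mul_assoc]

theorem IsQuatHermitian.pfaff_ne_zero_of_congr [IsDomain R]
    {y z g g' : Matrix (Fin 3) (Fin 3) ℍ[R,c₁,c₂,c₃]}
    (hy : IsQuatHermitian y) (hz : IsQuatHermitian z) (hg : g' * g = 1) (hg' : g * g' = 1)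
    (hzy : z = g * y * gᴴ) (h0 : pfaff y ≠ 0) : pfaff z ≠ 0 := by
  rw [hy.pfaff_eq] at h0
  rw [hz.pfaff_eq]
  refine HermData.norm_ne_zero_of_congr (isQuadraticInvolution_quaternion c₁ c₂ c₃) hg hg' ?_ h0
  rw [hy.toMatrix_quatData, hz.toMatrix_quatData, hzy]

/-- The Pfaffian commutes with ring homomorphisms applied to the coordinates. -/
theorem map_pfaff {S : Type v} [CommRing S] {c₁' c₂' c₃' : S} (φ : R →+* S) (h1 : φ c₁ = c₁')
    (h2 : φ c₂ = c₂') (h3 : φ c₃ = c₃') {y : Matrix (Fin 3) (Fin 3) ℍ[R,c₁,c₂,c₃]}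
    {z : Matrix (Fin 3) (Fin 3) ℍ[S,c₁',c₂',c₃']}
    (h : ∀ i j, φ (y i j).re = (z i j).re ∧ φ (y i j).imI = (z i j).imI ∧
      φ (y i j).imJ = (z i j).imJ ∧ φ (y i j).imK = (z i j).imK) : φ (pfaff y) = pfaff z := by
  simp only [pfaff, nrd, trd, QuaternionAlgebra.re_add, QuaternionAlgebra.re_mul,
    QuaternionAlgebra.imI_mul, QuaternionAlgebra.imJ_mul, QuaternionAlgebra.imK_mul,
    QuaternionAlgebra.re_star, QuaternionAlgebra.imI_star, QuaternionAlgebra.imJ_star,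
    QuaternionAlgebra.imK_star, map_add, map_sub, map_mul, map_neg, h1, h2, h3, (h _ _).1,
    (h _ _).2.1, (h _ _).2.2.1, (h _ _).2.2.2]

end QuaternionPfaffian

/-! ### The Pfaffian of a Hermitian matrix of linear forms -/

section QuaternionForm

variable {k : Type u} [Field k] {c₁ c₂ c₃ : k}

/-- The inclusion of the quaternions over `k` into those over `k[v₁, v₂]`. -/
noncomputable def quatC : ℍ[k,c₁,c₂,c₃] →+*
    ℍ[MvPolynomial (Fin 2) k,(C c₁ : MvPolynomial (Fin 2) k),C c₂,C c₃] where
  toFun x := ⟨C x.re, C x.imI, C x.imJ, C x.imK⟩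
  map_one' := by ext1 <;> simp
  map_mul' x y := by ext1 <;> simp
  map_zero' := by ext1 <;> simp
  map_add' x y := by ext1 <;> simp

theorem star_quatC (x : ℍ[k,c₁,c₂,c₃]) : star (quatC x) = quatC (star x) := by
  ext1 <;> simp [quatC]

theorem linearMatrixC_eq (x₁ x₂ : Matrix (Fin 3) (Fin 3) ℍ[k,c₁,c₂,c₃]) :
    linearMatrixC c₁ c₂ c₃ x₁ x₂ = (X 0 : MvPolynomial (Fin 2) k) • x₁.map quatC +
      (X 1 : MvPolynomial (Fin 2) k) • x₂.map quatC := by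
  ext1 i j
  ext1 <;> simp [linearMatrixC, quatC, mul_comm]

theorem linearMatrixC_mul_mul (g x₁ x₂ : Matrix (Fin 3) (Fin 3) ℍ[k,c₁,c₂,c₃]) :
    linearMatrixC c₁ c₂ c₃ (g * x₁ * gᴴ) (g * x₂ * gᴴ) =
      g.map quatC * linearMatrixC c₁ c₂ c₃ x₁ x₂ * (g.map quatC)ᴴ := by
  have hg : (g.map quatC)ᴴ = gᴴ.map quatC := by
    ext1 i j
    rw [conjTranspose_apply, Matrix.map_apply, Matrix.map_apply, star_quatC, conjTranspose_apply]
  rw [linearMatrixC_eq, linearMatrixC_eq, hg]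
  simp only [Matrix.map_mul, mul_add, add_mul, Matrix.mul_smul, Matrix.smul_mul]

theorem isQuatHermitian_linearMatrixC {x₁ x₂ : Matrix (Fin 3) (Fin 3) ℍ[k,c₁,c₂,c₃]}
    (h₁ : x₁ ∈ SpaceC c₁ c₂ c₃) (h₂ : x₂ ∈ SpaceC c₁ c₂ c₃) :
    IsQuatHermitian (linearMatrixC c₁ c₂ c₃ x₁ x₂) := by
  refine ⟨?_, fun i => ?_⟩
  · ext1 i j
    have e₁ : star (x₁ j i) = x₁ i j := congrFun (congrFun h₁.1 i) j
    have e₂ : star (x₂ j i) = x₂ i j := congrFun (congrFun h₂.1 i) j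
    rw [conjTranspose_apply]
    simp only [linearMatrixC, of_apply, ← e₁, ← e₂]
    ext1 <;> simp <;> ring
  · obtain ⟨s, hs⟩ := h₁.2 i
    obtain ⟨t, ht⟩ := h₂.2 i
    refine ⟨C s * X 0 + C t * X 1, ?_⟩
    simp only [linearMatrixC, of_apply, hs, ht]
    ext1 <;> simp

theorem eval_pfaff_linearMatrixC (x₁ x₂ : Matrix (Fin 3) (Fin 3) ℍ[k,c₁,c₂,c₃]) (r : Fin 2 → k) :
    eval r (pfaff (linearMatrixC c₁ c₂ c₃ x₁ x₂)) = pfaff (r 0 • x₁ + r 1 • x₂) := by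
  refine map_pfaff (eval r) (eval_C _) (eval_C _) (eval_C _) fun i j => ?_
  simp [linearMatrixC, mul_comm]

theorem pfaff_linearMatrixC_comb (x₁ x₂ : Matrix (Fin 3) (Fin 3) ℍ[k,c₁,c₂,c₃])
    (h : Matrix (Fin 2) (Fin 2) k) :
    pfaff (linearMatrixC c₁ c₂ c₃ (h 0 0 • x₁ + h 0 1 • x₂) (h 1 0 • x₁ + h 1 1 • x₂)) =
      substForm h (pfaff (linearMatrixC c₁ c₂ c₃ x₁ x₂)) := by
  have hC : ∀ t, substForm h (C t) = C t := fun t => by simp [substForm]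
  have key : ∀ s t : k, substForm h (C s * X 0 + C t * X 1) =
      C (h 0 0 * s + h 0 1 * t) * X 0 + C (h 1 0 * s + h 1 1 * t) * X 1 := by
    intro s t
    simp [substForm]
    ring
  refine (map_pfaff (substForm h).toRingHom (hC _) (hC _) (hC _) fun i j => ?_).symm
  exact ⟨key _ _, key _ _, key _ _, key _ _⟩

theorem trd_quatC (x : ℍ[k,c₁,c₂,c₃]) : trd (quatC x) = C (trd x) := by
  rw [trd, star_quatC, ← map_add]; rfl

theorem nrd_quatC (x : ℍ[k,c₁,c₂,c₃]) : nrd (quatC x) = C (nrd x) := by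
  rw [nrd, star_quatC, ← map_mul]; rfl

/-- The Hermitian matrix over `k[v₁, v₂]` given by a Hermitian matrix over `k`. -/
noncomputable def HermData.mapC (y : HermData k ℍ[k,c₁,c₂,c₃]) : HermData (MvPolynomial (Fin 2) k)
    ℍ[MvPolynomial (Fin 2) k,(C c₁ : MvPolynomial (Fin 2) k),C c₂,C c₃] :=
  ⟨C y.a, C y.b, C y.c, quatC y.p, quatC y.q, quatC y.r⟩

theorem quatC_smul (t : k) (x : ℍ[k,c₁,c₂,c₃]) :
    quatC (t • x) = (C t : MvPolynomial (Fin 2) k) • quatC x := by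
  ext1 <;> simp [quatC]

theorem HermData.norm_mapC (y : HermData k ℍ[k,c₁,c₂,c₃]) :
    y.mapC.norm nrd trd = C (y.norm nrd trd) := by
  simp only [norm, mapC, nrd_quatC, star_quatC, ← map_mul, trd_quatC, ← map_add, ← map_sub]

theorem HermData.pairing_mapC (y z : HermData k ℍ[k,c₁,c₂,c₃]) :
    (y.mapC.adj nrd).pairing trd z.mapC = C ((y.adj nrd).pairing trd z) := by
  simp only [pairing, adj, mapC, nrd_quatC, star_quatC, ← quatC_smul, ← map_mul, ← map_sub, C_add,
    trd_quatC]

/-- The coefficients of `Pfaff (x₁ v₁ + x₂ v₂)`. -/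
theorem pfaff_linearMatrixC {x₁ x₂ : Matrix (Fin 3) (Fin 3) ℍ[k,c₁,c₂,c₃]}
    (h₁ : x₁ ∈ SpaceC c₁ c₂ c₃) (h₂ : x₂ ∈ SpaceC c₁ c₂ c₃) :
    pfaff (linearMatrixC c₁ c₂ c₃ x₁ x₂) =
      cubicPoly (pfaff x₁) (((quatData x₁).adj nrd).pairing trd (quatData x₂))
        (((quatData x₂).adj nrd).pairing trd (quatData x₁)) (pfaff x₂) := by
  have e : quatData (linearMatrixC c₁ c₂ c₃ x₁ x₂) =
      ⟨X 0 * (quatData x₁).mapC.a + X 1 * (quatData x₂).mapC.a,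
        X 0 * (quatData x₁).mapC.b + X 1 * (quatData x₂).mapC.b,
        X 0 * (quatData x₁).mapC.c + X 1 * (quatData x₂).mapC.c,
        (X 0 : MvPolynomial (Fin 2) k) • (quatData x₁).mapC.p +
          (X 1 : MvPolynomial (Fin 2) k) • (quatData x₂).mapC.p,
        (X 0 : MvPolynomial (Fin 2) k) • (quatData x₁).mapC.q +
          (X 1 : MvPolynomial (Fin 2) k) • (quatData x₂).mapC.q,
        (X 0 : MvPolynomial (Fin 2) k) • (quatData x₁).mapC.r +
          (X 1 : MvPolynomial (Fin 2) k) • (quatData x₂).mapC.r⟩ := by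
    rw [linearMatrixC_eq]
    ext1 <;> simp [quatData, HermData.mapC, quatC]
  rw [(isQuatHermitian_linearMatrixC h₁ h₂).pfaff_eq, e,
    HermData.norm_smul_add_smul (isQuadraticInvolution_quaternion _ _ _), HermData.norm_mapC,
    HermData.norm_mapC, HermData.pairing_mapC, HermData.pairing_mapC,
    ← IsQuatHermitian.pfaff_eq h₁, ← IsQuatHermitian.pfaff_eq h₂, cubicPoly]
  ring

end QuaternionForm

/-! ### Hermitian matrices over a quaternion algebra -/

section CaseC

variable {k : Type u} [Field k] (c₁ c₂ c₃ : k)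

theorem scalarDiag_mem_SpaceC (a b c : k) :
    scalarDiag ℍ[k,c₁,c₂,c₃] a b c ∈ SpaceC c₁ c₂ c₃ := by
  refine ⟨?_, fun i => ⟨![a, b, c] i, ?_⟩⟩
  · rw [scalarDiag, diagonal_conjTranspose]
    congr 1
    ext1 i
    have h := (isQuadraticInvolution_quaternion c₁ c₂ c₃).star_algebraMap
    fin_cases i
    exacts [h a, h b, h c]
  · rw [scalarDiag, diagonal_apply_eq]
    fin_cases i <;> rfl

/-- The diagonal matrix with given scalar entries, as an element of `H₃(B)`. -/
def diagC (a b c : k) : SpaceC c₁ c₂ c₃ :=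
  ⟨scalarDiag _ a b c, scalarDiag_mem_SpaceC c₁ c₂ c₃ a b c⟩

theorem formC_diag (a b c : k) :
    (formC c₁ c₂ c₃ (diagC c₁ c₂ c₃ 0 b (-c), diagC c₁ c₂ c₃ a (-b) 0)).1 =
      C (-(a * b * c)) * stdForm k := by
  change pfaff (linearMatrixC c₁ c₂ c₃ (scalarDiag _ 0 b (-c)) (scalarDiag _ a (-b) 0)) = _
  have h0 : ∀ i j, i ≠ j →
      linearMatrixC c₁ c₂ c₃ (scalarDiag _ 0 b (-c)) (scalarDiag _ a (-b) 0) i j = 0 := by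
    intro i j hij
    ext1 <;> simp [linearMatrixC, scalarDiag, diagonal_apply_ne _ hij]
  rw [pfaff, h0 0 1 (by decide), h0 0 2 (by decide), h0 1 2 (by decide)]
  simp [nrd, trd, linearMatrixC, scalarDiag, stdForm]
  ring

/-- The action of `GL₃(B)` on the Hermitian matrices over a quaternion algebra `B`. -/
theorem isCubicPair_quaternion (hc : c₃ * (c₂ ^ 2 + 4 * c₁) ≠ 0) :
    IsCubicPair (repC₁ c₁ c₂ c₃) (formC c₁ c₂ c₃) (T3 k ℍ[k,c₁,c₂,c₃]) (P12 k ℍ[k,c₁,c₂,c₃])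
      (theta1 _) (eta1 _) {y | pfaff y.1 = 0} (diagC c₁ c₂ c₃) where
  coe_diag a b c := rfl
  eval_eq_zero x r := by
    change eval r (pfaff (linearMatrixC c₁ c₂ c₃ x.1.1 x.2.1)) = 0 ↔ _
    rw [eval_pfaff_linearMatrixC]
    rfl
  sing_iff g y := by
    change pfaff (repC₁ c₁ c₂ c₃ g y).1 = 0 ↔ pfaff y.1 = 0
    rw [← not_iff_not]
    refine ⟨fun h => ?_, fun h => ?_⟩
    · refine IsQuatHermitian.pfaff_ne_zero_of_congr (repC₁ c₁ c₂ c₃ g y).2 y.2 g.mul_inv g.inv_mul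
        ?_ h
      exact congrArg Subtype.val (rep_inv_apply (repC₁ c₁ c₂ c₃) g y).symm
    · exact IsQuatHermitian.pfaff_ne_zero_of_congr y.2 (repC₁ c₁ c₂ c₃ g y).2 g.inv_mul g.mul_inv
        rfl h
  form_ne_zero g x hx := by
    refine IsQuatHermitian.pfaff_ne_zero_of_congr (isQuatHermitian_linearMatrixC x.1.2 x.2.2)
      (isQuatHermitian_linearMatrixC (repC₁ c₁ c₂ c₃ g x.1).2 (repC₁ c₁ c₂ c₃ g x.2).2)
      (g := g.1.map quatC) (g' := (g⁻¹).1.map quatC) ?_ ?_ (linearMatrixC_mul_mul g.1 x.1.1 x.2.1) hx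
    · rw [← Matrix.map_mul, g.inv_mul, Matrix.map_one _ (map_zero _) (map_one _)]
    · rw [← Matrix.map_mul, g.mul_inv, Matrix.map_one _ (map_zero _) (map_one _)]
  form_subst h x := pfaff_linearMatrixC_comb x.1.1 x.2.1 h
  form_diag := formC_diag c₁ c₂ c₃
  exists_diag x₁ x₂ h₁ h₂ h₃ hp₁ hp₃ hp₂ := by
    have hcoeff : ∀ y z : SpaceC c₁ c₂ c₃, binaryCoeff 2 1 (formC c₁ c₂ c₃ (y, z)).1 =
        ((quatData y.1).adj nrd).pairing trd (quatData z.1) := by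
      intro y z
      change binaryCoeff 2 1 (pfaff (linearMatrixC c₁ c₂ c₃ y.1 z.1)) = _
      rw [pfaff_linearMatrixC y.2 z.2, binaryCoeff, coeff_cubicPoly]
      simp
    rw [hcoeff] at hp₁ hp₂ hp₃
    have hn : ∀ y : SpaceC c₁ c₂ c₃, pfaff y.1 = 0 → (quatData y.1).norm nrd trd = 0 := fun y hy => by
      rw [← IsQuatHermitian.pfaff_eq y.2, hy]
    have hm : ∀ y : SpaceC c₁ c₂ c₃, (quatData y.1).toMatrix = y.1 := fun y =>
      IsQuatHermitian.toMatrix_quatData y.2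
    obtain ⟨g, a, b, c, e₁, e₂⟩ := HermData.exists_unit_diagonal
      (isQuadraticInvolution_quaternion c₁ c₂ c₃) (exists_trd_mul_ne_zero hc)
      (by rw [hm, hm, hm]; rfl) (hn _ h₁) (hn _ h₂) (hn _ h₃) hp₁ hp₂ hp₃
    rw [hm] at e₁ e₂
    exact ⟨g, a, b, c, Subtype.ext e₁, Subtype.ext e₂⟩
  diag_of_mem g hg := by
    rw [mem_T3_iff] at hg
    refine ⟨nrd (g.1 0 0), nrd (g.1 1 1), nrd (g.1 2 2), fun a b c => Subtype.ext ?_⟩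
    change g.1 * diagonal _ * g.1ᴴ = diagonal _
    rw [mul_diagonal_mul _ _ _ hg fun i j hij => by rw [conjTranspose_apply, hg j i hij.symm, star_zero]]
    have h := (isQuadraticInvolution_quaternion c₁ c₂ c₃).mul_star
    congr 1
    ext1 i
    rw [conjTranspose_apply]
    fin_cases i <;> simp only [Fin.zero_eta, Fin.mk_one, Fin.reduceFinMk, Fin.isValue, cons_val_zero,
      cons_val_one, cons_val, ← Algebra.commutes] <;> rw [mul_assoc, h, ← map_mul, mul_comm]
  theta_diag a b c := Subtype.ext (by
    have : (theta1 ℍ[k,c₁,c₂,c₃]).1ᴴ = (theta1 ℍ[k,c₁,c₂,c₃]).1ᵀ := by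
      ext1 i j; fin_cases i <;> fin_cases j <;> simp [theta1]
    refine Eq.trans ?_ (theta_mul_scalarDiag a b c)
    rw [← this]; rfl)
  eta_diag a b c := Subtype.ext (by
    have : (eta1 ℍ[k,c₁,c₂,c₃]).1ᴴ = (eta1 ℍ[k,c₁,c₂,c₃]).1ᵀ := by
      ext1 i j; fin_cases i <;> fin_cases j <;> simp [eta1]
    refine Eq.trans ?_ (eta_mul_scalarDiag a b c)
    rw [← this]; rfl)
  mem_of_diag g a b c a' b' c' ha hb hc h₁ h₂ := (mem_T3_iff g).2 fun i j =>
    apply_eq_zero_of_mul_scalarDiag (h := g.1ᴴ) (h' := (g⁻¹).1ᴴ)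
      (by rw [← conjTranspose_mul, g.inv_mul, conjTranspose_one]) ha hb hc
      (congrArg Subtype.val h₁) (congrArg Subtype.val h₂)
  cross_of_mem g hg y hy := by
    rw [mem_P12_iff] at hg
    exact hy.mul_mul hg fun j hj => by rw [conjTranspose_apply, hg j hj, star_zero]
  sing_of_cross y hy := by
    change pfaff y.1 = 0
    simp [pfaff, nrd, trd, (hy _).1, (hy _).2]
  mem_of_cross g b c hb hc h := (mem_P12_iff g).2 fun j =>
    apply_zero_eq_zero_of_mul_scalarDiag (h := g.1ᴴ) (h' := (g⁻¹).1ᴴ)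
      (by rw [← conjTranspose_mul, g.inv_mul, conjTranspose_one]) hb hc fun j => (h j).1

end CaseC

/-! ### Binary cubic forms given by determinants -/

section DeterminantForm

variable {k : Type u} [Field k]

theorem map_substForm {F : Type v} [Field F] (φ : k →+* F) (h : Matrix (Fin 2) (Fin 2) k)
    (f : MvPolynomial (Fin 2) k) :
    map φ (substForm h f) = substForm (h.map φ) (map φ f) := by
  have : (map φ).comp (substForm h).toRingHom = (substForm (h.map φ)).toRingHom.comp (map φ) := by
    refine ringHom_ext (fun t => ?_) fun i => ?_ <;> simp [substForm]
  exact congrArg (fun ψ => ψ f) this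

theorem det_linearMatrix_comb (x₁ x₂ : Matrix (Fin 3) (Fin 3) k) (h : Matrix (Fin 2) (Fin 2) k) :
    (linearMatrix (h 0 0 • x₁ + h 0 1 • x₂) (h 1 0 • x₁ + h 1 1 • x₂)).det =
      substForm h (linearMatrix x₁ x₂).det := by
  rw [AlgHom.map_det]
  congr 1
  ext1 i j
  simp [substForm, linearMatrix]
  ring

theorem det_linearMatrix_scalarDiag {F : Type v} [Field F] [Algebra k F] (a b c : k) :
    (linearMatrix (scalarDiag F 0 b (-c)) (scalarDiag F a (-b) 0)).det =
      map (algebraMap k F) (C (-(a * b * c)) * stdForm k) := by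
  simp [det_fin_three, linearMatrix, scalarDiag, stdForm]
  ring

theorem FirstCrossZero.det_eq_zero {y : Matrix (Fin 3) (Fin 3) k} (hy : FirstCrossZero y) :
    y.det = 0 :=
  det_eq_zero_of_row_eq_zero 0 fun j => (hy j).1

end DeterminantForm

/-! ### Square matrices as Hermitian matrices over `k × k` -/

section CaseA

variable (k : Type u) [Field k]

/-- The exchange of the factors of `k × k`. -/
@[reducible] def swapStarRing : StarRing (k × k) where
  star := Prod.swap
  star_involutive := Prod.swap_swap
  star_mul x y := by ext <;> simp [mul_comm]
  star_add x y := by ext <;> simp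

attribute [local instance] swapStarRing

theorem star_prod (x : k × k) : star x = (x.2, x.1) := rfl

theorem isQuadraticInvolution_swap :
    IsQuadraticInvolution (R := k) (fun x : k × k => x.1 * x.2) (fun x => x.1 + x.2) where
  algebraMap_injective s t hst := congrArg Prod.fst hst
  star_algebraMap t := rfl
  mul_star x := by ext <;> simp [star_prod, mul_comm]
  star_mul x := by ext <;> simp [star_prod, mul_comm]
  add_star x := by ext <;> simp [star_prod, add_comm]

/-- The entries of the Hermitian matrix `(y, ᵗy)` over `k × k` given by the matrix `y` over `k`. -/
def pairData {k : Type u} (y : Matrix (Fin 3) (Fin 3) k) : HermData k (k × k) :=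
  ⟨y 0 0, y 1 1, y 2 2, (y 0 1, y 1 0), (y 0 2, y 2 0), (y 1 2, y 2 1)⟩

theorem pairData_add (y z : Matrix (Fin 3) (Fin 3) k) :
    (pairData (y + z)).toMatrix = (pairData y).toMatrix + (pairData z).toMatrix := by
  ext i j <;> fin_cases i <;> fin_cases j <;> simp [HermData.toMatrix, pairData, star_prod]

theorem map_fst_pairData (y : Matrix (Fin 3) (Fin 3) k) :
    (pairData y).toMatrix.map (RingHom.fst k k) = y := by
  ext i j; fin_cases i <;> fin_cases j <;> simp [HermData.toMatrix, pairData, star_prod]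

theorem norm_pairData (y : Matrix (Fin 3) (Fin 3) k) :
    (pairData y).norm (fun x : k × k => x.1 * x.2) (fun x => x.1 + x.2) = y.det := by
  simp [HermData.norm, pairData, star_prod, det_fin_three]
  ring

theorem pairing_pairData (y z : Matrix (Fin 3) (Fin 3) k) :
    ((pairData y).adj (fun x : k × k => x.1 * x.2)).pairing (fun x => x.1 + x.2) (pairData z) =
      (y.adjugate * z).trace := by
  simp [HermData.adj, HermData.pairing, pairData, star_prod, adjugate_fin_three, Matrix.trace,
    Fin.sum_univ_three, Matrix.vecMul, dotProduct]
  ring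

theorem exists_trace_mul_ne_zero_swap (x : k × k) (hx : x ≠ 0) :
    ∃ d : k × k, (x * d).1 + (x * d).2 ≠ 0 := by
  by_cases h : x.1 = 0
  · exact ⟨(0, 1), by simpa using fun h' => hx (Prod.ext h h')⟩
  · exact ⟨(1, 0), by simpa using h⟩

/-- The diagonal matrix with given entries, as an element of `M₃(k)`. -/
def diagA (a b c : k) : SpaceA k := ⟨scalarDiag k a b c, Submodule.mem_top⟩

/-- The action of `GL₃(k) × GL₃(k)` on `M₃(k)`. -/
theorem isCubicPair_matrix :
    IsCubicPair (repA₁ k) (formA k) ((T3 k k).prod (T3 k k)) ((P12 k k).prod (P12 k k))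
      (theta1 k, theta1 k) (eta1 k, eta1 k) {y | y.1.det = 0} (diagA k) where
  coe_diag a b c := rfl
  eval_eq_zero x r := by
    change eval r (linearMatrix x.1.1 x.2.1).det = 0 ↔ _
    rw [eval_det_linearMatrix]
    rfl
  sing_iff g y := by
    change (g.1.1 * y.1 * g.2.1ᵀ).det = 0 ↔ y.1.det = 0
    rw [det_mul, det_mul, det_transpose]
    have h1 : g.1.1.det ≠ 0 := ((Matrix.isUnit_iff_isUnit_det _).1 g.1.isUnit).ne_zero
    have h2 : g.2.1.det ≠ 0 := ((Matrix.isUnit_iff_isUnit_det _).1 g.2.isUnit).ne_zero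
    simp [h1, h2]
  form_ne_zero g x hx := by
    change (linearMatrix (g.1.1 * x.1.1 * g.2.1ᵀ) (g.1.1 * x.2.1 * g.2.1ᵀ)).det ≠ 0
    rw [det_linearMatrix_mul_mul, det_transpose]
    have h1 : g.1.1.det ≠ 0 := ((Matrix.isUnit_iff_isUnit_det _).1 g.1.isUnit).ne_zero
    have h2 : g.2.1.det ≠ 0 := ((Matrix.isUnit_iff_isUnit_det _).1 g.2.isUnit).ne_zero
    exact mul_ne_zero (by simp [h1, h2]) hx
  form_subst h x := det_linearMatrix_comb x.1.1 x.2.1 h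
  form_diag a b c := by
    refine (det_linearMatrix_scalarDiag (F := k) a b c).trans ?_
    rw [Algebra.algebraMap_self, MvPolynomial.map_id]
  exists_diag x₁ x₂ h₁ h₂ h₃ hp₁ hp₃ hp₂ := by
    have hcoeff : ∀ y z : SpaceA k, binaryCoeff 2 1 (formA k (y, z)).1 =
        (y.1.adjugate * z.1).trace := by
      intro y z
      change binaryCoeff 2 1 (linearMatrix y.1 z.1).det = _
      rw [det_linearMatrix, binaryCoeff, coeff_cubicPoly]
      simp
    rw [hcoeff, ← pairing_pairData] at hp₁ hp₂ hp₃
    obtain ⟨g, a, b, c, e₁, e₂⟩ := HermData.exists_unit_diagonal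
      (isQuadraticInvolution_swap k) (exists_trace_mul_ne_zero_swap k)
      (pairData_add k x₁.1 x₂.1) ((norm_pairData k _).trans h₁) ((norm_pairData k _).trans h₂)
      ((norm_pairData k _).trans h₃) hp₁ hp₂ hp₃
    have hg : (g.1ᴴ).map (RingHom.fst k k) = (g.1.map (RingHom.snd k k))ᵀ := rfl
    have hd : ∀ a b c, (diagonal ![algebraMap k (k × k) a, algebraMap k (k × k) b,
        algebraMap k (k × k) c]).map (RingHom.fst k k) = scalarDiag k a b c := by
      intro a b c
      ext i j; fin_cases i <;> fin_cases j <;> simp [scalarDiag]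
    refine ⟨(Units.map (RingHom.fst k k).mapMatrix.toMonoidHom g,
      Units.map (RingHom.snd k k).mapMatrix.toMonoidHom g), a, b, c, Subtype.ext ?_, Subtype.ext ?_⟩
    · have := congrArg (fun x => x.map (RingHom.fst k k)) e₁
      rw [hd, Matrix.map_mul, Matrix.map_mul, map_fst_pairData, hg] at this
      exact this
    · have := congrArg (fun x => x.map (RingHom.fst k k)) e₂
      rw [hd, Matrix.map_mul, Matrix.map_mul, map_fst_pairData, hg] at this
      exact this
  diag_of_mem g hg := by
    have h₁ := (mem_T3_iff _).1 hg.1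
    have h₂ := (mem_T3_iff _).1 hg.2
    refine ⟨g.1.1 0 0 * g.2.1 0 0, g.1.1 1 1 * g.2.1 1 1, g.1.1 2 2 * g.2.1 2 2,
      fun a b c => Subtype.ext ?_⟩
    change g.1.1 * diagonal _ * g.2.1ᵀ = diagonal _
    rw [mul_diagonal_mul _ g.2.1ᵀ _ h₁ fun i j hij => h₂ j i hij.symm]
    congr 1
    ext1 i
    rw [transpose_apply]
    fin_cases i <;> simp <;> ring
  theta_diag a b c := Subtype.ext (theta_mul_scalarDiag a b c)
  eta_diag a b c := Subtype.ext (eta_mul_scalarDiag a b c)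
  mem_of_diag g a b c a' b' c' ha hb hc h₁ h₂ := by
    have e₁ : g.1.1 * scalarDiag k 0 b (-c) * g.2.1ᵀ = _ := congrArg Subtype.val h₁
    have e₂ : g.1.1 * scalarDiag k a (-b) 0 * g.2.1ᵀ = _ := congrArg Subtype.val h₂
    refine ⟨(mem_T3_iff _).2 fun i j => apply_eq_zero_of_mul_scalarDiag (h' := (g.2⁻¹).1ᵀ)
      (by rw [← transpose_mul, g.2.inv_mul, transpose_one]) ha hb hc e₁ e₂,
      (mem_T3_iff _).2 fun i j => apply_eq_zero_of_mul_scalarDiag (h' := (g.1⁻¹).1ᵀ)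
      (by rw [← transpose_mul, g.1.inv_mul, transpose_one]) ha hb hc (b' := b') (c' := c')
        (a' := a') ?_ ?_⟩
    · have := congrArg transpose e₁
      simpa only [transpose_mul, transpose_transpose, scalarDiag, diagonal_transpose, diagA,
        ← mul_assoc] using this
    · have := congrArg transpose e₂
      simpa only [transpose_mul, transpose_transpose, scalarDiag, diagonal_transpose, diagA,
        ← mul_assoc] using this
  cross_of_mem g hg y hy :=
    hy.mul_mul ((mem_P12_iff _).1 hg.1) fun j hj => (mem_P12_iff _).1 hg.2 j hj
  sing_of_cross y hy := hy.det_eq_zero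
  mem_of_cross g b c hb hc h := by
    refine ⟨(mem_P12_iff _).2 fun j => apply_zero_eq_zero_of_mul_scalarDiag (h' := (g.2⁻¹).1ᵀ)
      (by rw [← transpose_mul, g.2.inv_mul, transpose_one]) hb hc fun j => (h j).1,
      (mem_P12_iff _).2 fun j => apply_zero_eq_zero_of_mul_scalarDiag (h' := (g.1⁻¹).1ᵀ)
      (by rw [← transpose_mul, g.1.inv_mul, transpose_one]) hb hc fun j => ?_⟩
    have e : g.2.1 * scalarDiag k 0 b c * g.1.1ᵀ = (g.1.1 * scalarDiag k 0 b c * g.2.1ᵀ)ᵀ := by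
      simp only [transpose_mul, transpose_transpose, scalarDiag, diagonal_transpose, ← mul_assoc]
    rw [e]
    exact (h j).2

end CaseA

/-! ### Hermitian matrices over a quadratic extension -/

section CaseB

variable {k : Type u} [Field k] {F : Type v} [Field F] [Algebra k F] (σ : F ≃ₐ[k] F)

theorem apply_swap_eq {σ : F ≃ₐ[k] F} (y : SpaceB σ) (i j : Fin 3) : y.1 j i = σ (y.1 i j) :=
  congrFun (congrFun y.2 i) j

theorem scalarDiag_mem_SpaceB (a b c : k) : scalarDiag F a b c ∈ SpaceB σ := by
  change _ = _
  rw [scalarDiag, diagonal_transpose, diagonal_map (map_zero σ)]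
  congr 1
  ext1 i
  fin_cases i
  exacts [(σ.commutes a).symm, (σ.commutes b).symm, (σ.commutes c).symm]

variable [Algebra.IsQuadraticExtension k F]

/-- The non-trivial automorphism of a quadratic extension as an involution. -/
@[reducible] def galoisStarRing : StarRing F where
  star := σ
  star_involutive := involutive_of_quadratic σ
  star_mul x y := by rw [map_mul, mul_comm]
  star_add := map_add σ

theorem exists_nm (hσ : σ ≠ 1) (x : F) : ∃ t, algebraMap k F t = x * σ x :=
  exists_algebraMap_eq σ hσ _ (by rw [map_mul, involutive_of_quadratic, mul_comm])

theorem exists_tr (hσ : σ ≠ 1) (x : F) : ∃ t, algebraMap k F t = x + σ x :=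
  exists_algebraMap_eq σ hσ _ (by rw [map_add, involutive_of_quadratic, add_comm])

/-- The norm `x x^σ` of a quadratic extension. -/
noncomputable def galoisNm (hσ : σ ≠ 1) (x : F) : k := (exists_nm σ hσ x).choose

/-- The trace `x + x^σ` of a quadratic extension. -/
noncomputable def galoisTr (hσ : σ ≠ 1) (x : F) : k := (exists_tr σ hσ x).choose

theorem algebraMap_galoisNm (hσ : σ ≠ 1) (x : F) :
    algebraMap k F (galoisNm σ hσ x) = x * σ x := (exists_nm σ hσ x).choose_spec

theorem algebraMap_galoisTr (hσ : σ ≠ 1) (x : F) :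
    algebraMap k F (galoisTr σ hσ x) = x + σ x := (exists_tr σ hσ x).choose_spec

theorem isQuadraticInvolution_galois (hσ : σ ≠ 1) :
    letI := galoisStarRing σ
    IsQuadraticInvolution (R := k) (galoisNm σ hσ) (galoisTr σ hσ) :=
  letI := galoisStarRing σ
  { algebraMap_injective := (algebraMap k F).injective
    star_algebraMap := σ.commutes
    mul_star := fun x => (algebraMap_galoisNm σ hσ x).symm
    star_mul := fun x => (mul_comm _ _).trans (algebraMap_galoisNm σ hσ x).symm
    add_star := fun x => (algebraMap_galoisTr σ hσ x).symm }

/-- The trace form is nondegenerate: if the trace vanishes, then `y^σ = -y` for all `y`, and `y = 1`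
shows that the characteristic is `2`, so that `σ = 1`. -/
theorem exists_galoisTr_mul_ne_zero (hσ : σ ≠ 1) (x : F) (hx : x ≠ 0) :
    ∃ d, galoisTr σ hσ (x * d) ≠ 0 := by
  by_contra! h
  have h' : ∀ y, y + σ y = 0 := fun y => by
    rw [← algebraMap_galoisTr σ hσ, ← mul_inv_cancel_left₀ hx y, h, map_zero]
  refine hσ (AlgEquiv.ext fun y => ?_)
  have h2 : (1 : F) + 1 = 0 := by simpa using h' 1
  change σ y = y
  linear_combination h' y - y * h2

theorem exists_hermData (hσ : σ ≠ 1) (y : SpaceB σ) :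
    letI := galoisStarRing σ
    ∃ d : HermData k F, d.toMatrix = y.1 := by
  have h : ∀ i, ∃ t, algebraMap k F t = y.1 i i := fun i =>
    exists_algebraMap_eq σ hσ _ (apply_swap_eq y i i).symm
  choose t ht using h
  let _ := galoisStarRing σ
  refine ⟨⟨t 0, t 1, t 2, y.1 0 1, y.1 0 2, y.1 1 2⟩, ?_⟩
  have hs : ∀ i j, star (y.1 i j) = y.1 j i := fun i j => (apply_swap_eq y i j).symm
  ext i j
  fin_cases i <;> fin_cases j <;>
    simp [HermData.toMatrix, ← ht, hs, Algebra.algebraMap_eq_smul_one]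

theorem algebraMap_norm_eq_det (hσ : σ ≠ 1) (d : HermData k F) :
    letI := galoisStarRing σ
    algebraMap k F (d.norm (galoisNm σ hσ) (galoisTr σ hσ)) = d.toMatrix.det := by
  let _ := galoisStarRing σ
  have hs : ∀ x : F, star x = σ x := fun _ => rfl
  simp [HermData.norm, HermData.toMatrix, det_fin_three, algebraMap_galoisNm, algebraMap_galoisTr,
    hs, ← Algebra.algebraMap_eq_smul_one, involutive_of_quadratic]
  ring

theorem algebraMap_pairing_eq_trace (hσ : σ ≠ 1) (d e : HermData k F) :
    letI := galoisStarRing σ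
    algebraMap k F ((d.adj (galoisNm σ hσ)).pairing (galoisTr σ hσ) e) =
      (d.toMatrix.adjugate * e.toMatrix).trace := by
  let _ := galoisStarRing σ
  have hs : ∀ x : F, star x = σ x := fun _ => rfl
  simp [HermData.adj, HermData.pairing, HermData.toMatrix, adjugate_fin_three, Matrix.trace,
    Fin.sum_univ_three, algebraMap_galoisNm, algebraMap_galoisTr,
    hs, involutive_of_quadratic, Algebra.smul_def]
  ring

/-- The diagonal matrix with given scalar entries, as an element of `H₃(F)`. -/
def diagB (a b c : k) : SpaceB σ := ⟨scalarDiag F a b c, scalarDiag_mem_SpaceB σ a b c⟩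

/-- The action of `GL₃(F)` on the Hermitian matrices over a quadratic extension `F`. -/
theorem isCubicPair_hermitian (hσ : σ ≠ 1) :
    IsCubicPair (repB₁ σ) (formB σ hσ) (T3 F F) (P12 F F) (theta1 F) (eta1 F)
      {y | y.1.det = 0} (diagB σ) where
  coe_diag a b c := rfl
  eval_eq_zero x r := by
    rw [← map_eq_zero_iff (algebraMap k F) (algebraMap k F).injective]
    have : algebraMap k F (eval r (formB σ hσ x).1) =
        eval (fun i => algebraMap k F (r i)) (linearMatrix x.1.1 x.2.1).det := by
      rw [← map_formB σ hσ, MvPolynomial.eval_map]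
      exact eval₂_comp_left (algebraMap k F) (RingHom.id k) r _
    rw [this, eval_det_linearMatrix]
    simp only [algebraMap_smul]
    rfl
  sing_iff g y := by
    change (g.1 * y.1 * (g.1.map σ)ᵀ).det = 0 ↔ y.1.det = 0
    have h1 : g.1.det ≠ 0 := ((Matrix.isUnit_iff_isUnit_det _).1 g.isUnit).ne_zero
    have h2 : (g.1.map σ).det = σ g.1.det := (AlgEquiv.map_det σ g.1).symm
    rw [det_mul, det_mul, det_transpose, h2]
    simp [h1]
  form_ne_zero g x hx h0 := by
    have h1 : g.1.det ≠ 0 := ((Matrix.isUnit_iff_isUnit_det _).1 g.isUnit).ne_zero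
    have h2 : (g.1.map σ).det = σ g.1.det := (AlgEquiv.map_det σ g.1).symm
    have h := map_formB σ hσ (repB₁ σ g x.1, repB₁ σ g x.2)
    rw [h0, map_zero] at h
    change 0 = (linearMatrix (g.1 * x.1.1 * (g.1.map σ)ᵀ) (g.1 * x.2.1 * (g.1.map σ)ᵀ)).det at h
    rw [det_linearMatrix_mul_mul, det_transpose, h2, ← map_formB σ hσ] at h
    refine mul_ne_zero ?_ ?_ h.symm
    · simp [h1]
    · rwa [Ne, map_eq_zero_iff _ (map_injective _ (algebraMap k F).injective)]
  form_subst h x := by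
    refine map_injective _ (algebraMap k F).injective ?_
    rw [map_formB, map_substForm, map_formB, ← det_linearMatrix_comb]
    simp only [Matrix.map_apply, algebraMap_smul]
    rfl
  form_diag a b c := by
    refine map_injective _ (algebraMap k F).injective ?_
    rw [map_formB, ← det_linearMatrix_scalarDiag]
    rfl
  exists_diag x₁ x₂ h₁ h₂ h₃ hp₁ hp₃ hp₂ := by
    let _ := galoisStarRing σ
    have hcoeff : ∀ (y z : SpaceB σ) (d e : HermData k F), d.toMatrix = y.1 → e.toMatrix = z.1 →
        binaryCoeff 2 1 (formB σ hσ (y, z)).1 =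
          (d.adj (galoisNm σ hσ)).pairing (galoisTr σ hσ) e := by
      intro y z d e hd he
      apply (algebraMap k F).injective
      rw [algebraMap_pairing_eq_trace, hd, he, binaryCoeff, ← coeff_map, map_formB,
        det_linearMatrix, coeff_cubicPoly]
      simp
    have hn : ∀ (y : SpaceB σ) (d : HermData k F), d.toMatrix = y.1 → y.1.det = 0 →
        d.norm (galoisNm σ hσ) (galoisTr σ hσ) = 0 := by
      intro y d hd hy
      rw [← map_eq_zero_iff (algebraMap k F) (algebraMap k F).injective, algebraMap_norm_eq_det, hd,
        hy]
    obtain ⟨d₁, e₁⟩ := exists_hermData σ hσ x₁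
    obtain ⟨d₂, e₂⟩ := exists_hermData σ hσ x₂
    obtain ⟨d₃, e₃⟩ := exists_hermData σ hσ (x₁ + x₂)
    rw [hcoeff _ _ _ _ e₁ e₂] at hp₁
    rw [hcoeff _ _ _ _ e₂ e₁] at hp₂
    rw [hcoeff _ _ _ _ e₃ e₁] at hp₃
    obtain ⟨g, a, b, c, f₁, f₂⟩ := HermData.exists_unit_diagonal
      (isQuadraticInvolution_galois σ hσ) (exists_galoisTr_mul_ne_zero σ hσ)
      (by rw [e₁, e₂, e₃]; rfl) (hn _ _ e₁ h₁) (hn _ _ e₂ h₂) (hn _ _ e₃ h₃) hp₁ hp₂ hp₃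
    rw [e₁] at f₁
    rw [e₂] at f₂
    exact ⟨g, a, b, c, Subtype.ext f₁, Subtype.ext f₂⟩
  diag_of_mem g hg := by
    rw [mem_T3_iff] at hg
    refine ⟨galoisNm σ hσ (g.1 0 0), galoisNm σ hσ (g.1 1 1), galoisNm σ hσ (g.1 2 2),
      fun a b c => Subtype.ext ?_⟩
    change g.1 * diagonal _ * (g.1.map σ)ᵀ = diagonal _
    rw [mul_diagonal_mul _ _ _ hg fun i j hij => by
      rw [transpose_apply, Matrix.map_apply, hg j i hij.symm, map_zero]]
    congr 1
    ext1 i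
    rw [transpose_apply, Matrix.map_apply]
    fin_cases i <;> simp [algebraMap_galoisNm] <;> ring
  theta_diag a b c := Subtype.ext (by
    have : ((theta1 F).1.map σ)ᵀ = (theta1 F).1ᵀ := by
      ext1 i j; fin_cases i <;> fin_cases j <;> simp [theta1]
    refine Eq.trans ?_ (theta_mul_scalarDiag a b c)
    rw [← this]; rfl)
  eta_diag a b c := Subtype.ext (by
    have : ((eta1 F).1.map σ)ᵀ = (eta1 F).1ᵀ := by
      ext1 i j; fin_cases i <;> fin_cases j <;> simp [eta1]
    refine Eq.trans ?_ (eta_mul_scalarDiag a b c)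
    rw [← this]; rfl)
  mem_of_diag g a b c a' b' c' ha hb hc h₁ h₂ := (mem_T3_iff g).2 fun i j =>
    apply_eq_zero_of_mul_scalarDiag (h := (g.1.map σ)ᵀ) (h' := ((g⁻¹).1.map σ)ᵀ)
      (by rw [← transpose_mul, ← Matrix.map_mul, g.inv_mul,
        Matrix.map_one _ (map_zero σ) (map_one σ), transpose_one]) ha hb hc
      (congrArg Subtype.val h₁) (congrArg Subtype.val h₂)
  cross_of_mem g hg y hy := by
    rw [mem_P12_iff] at hg
    exact hy.mul_mul hg fun j hj => by rw [transpose_apply, Matrix.map_apply, hg j hj, map_zero]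
  sing_of_cross y hy := hy.det_eq_zero
  mem_of_cross g b c hb hc h := (mem_P12_iff g).2 fun j =>
    apply_zero_eq_zero_of_mul_scalarDiag (h := (g.1.map σ)ᵀ) (h' := ((g⁻¹).1.map σ)ᵀ)
      (by rw [← transpose_mul, ← Matrix.map_mul, g.inv_mul,
        Matrix.map_one _ (map_zero σ) (map_one σ), transpose_one]) hb hc fun j => (h j).1

end CaseB

end CubicReducible

theorem mainTheorem6 {k : Type*} [Field k] :
    (IsContractedProduct (repA k) ⊤ (stabA k)
        (subspaceU (SpaceA k) ∩ semistable (formA k)) (totallySplit (formA k)) ∧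
      IsContractedProduct (repA k) (parabolicA k) (stabA k ⊓ parabolicA k)
        (subspaceU (SpaceA k) ∩ semistable (formA k))
        (subspaceW (SpaceA k) ∩ totallySplit (formA k))) ∧
    (∀ (F : Type*) [Field F] [Algebra k F] [Algebra.IsQuadraticExtension k F]
        (σ : F ≃ₐ[k] F) (hσ : σ ≠ 1),
      IsContractedProduct (repB σ) ⊤ (stabB k F)
        (subspaceU (SpaceB σ) ∩ semistable (formB σ hσ)) (totallySplit (formB σ hσ)) ∧
      IsContractedProduct (repB σ) (parabolicB k F) (stabB k F ⊓ parabolicB k F)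
        (subspaceU (SpaceB σ) ∩ semistable (formB σ hσ))
        (subspaceW (SpaceB σ) ∩ totallySplit (formB σ hσ))) ∧
    (∀ c₁ c₂ c₃ : k, c₃ * (c₂ ^ 2 + 4 * c₁) ≠ 0 →
      IsContractedProduct (repC c₁ c₂ c₃) ⊤ (stabC c₁ c₂ c₃)
        (subspaceU (SpaceC c₁ c₂ c₃) ∩ semistable (formC c₁ c₂ c₃))
        (totallySplit (formC c₁ c₂ c₃)) ∧
      IsContractedProduct (repC c₁ c₂ c₃) (parabolicC c₁ c₂ c₃)
        (stabC c₁ c₂ c₃ ⊓ parabolicC c₁ c₂ c₃)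
        (subspaceU (SpaceC c₁ c₂ c₃) ∩ semistable (formC c₁ c₂ c₃))
        (subspaceW (SpaceC c₁ c₂ c₃) ∩ totallySplit (formC c₁ c₂ c₃))) := by
  refine ⟨⟨?_, ?_⟩, fun F _ _ _ σ hσ => ⟨?_, ?_⟩, fun c₁ c₂ c₃ hc => ⟨?_, ?_⟩⟩
  · exact (isCubicPair_matrix k).isContractedProduct_top
  · exact (isCubicPair_matrix k).isContractedProduct_parabolic
  · exact (isCubicPair_hermitian σ hσ).isContractedProduct_top
  · exact (isCubicPair_hermitian σ hσ).isContractedProduct_parabolic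
  · exact (isCubicPair_quaternion c₁ c₂ c₃ hc).isContractedProduct_top
  · exact (isCubicPair_quaternion c₁ c₂ c₃ hc).isContractedProduct_parabolic
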